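/- **Setting.** Let $\mathbf H=(H_{j,k})_{j,k\in\{1,2\}}$ be a random complex $2\times2$ matrix ($H_{j,k}$ is the fading gain from transmitter $k$ to receiver $j$; its law is the stationary law of the fading process) with $\mathbb E\log(1+|H_{j,k}|^2)<\infty$ and $\Pr(H_{j,k}\ne0)>0$ for all $j,k$, let $\overline P_1,\overline P_2>0$, and write $C(x)=\log_2(1+x)$. Let $\mathcal P$ be the set of policies $P=(P_1,P_2)$ with $P_k(\mathbf h)\ge0$ measurable and $\mathbb E[P_k(\mathbf H)]\le\overline P_k$. The capacity region of the two-user ergodic fading compound MAC (C-MAC) is $$\mathcal C=\bigcup_{P\in\mathcal P}\mathcal C_1(P)\cap\mathcal C_2(P),\qquad \mathcal C_j(P)=\Big\{(R_1,R_2)\ge 0:\ \sum_{k\in S}R_k\le \mathbb E\Big[C\Big(\sum_{k\in S}|H_{j,k}|^2P_k(\mathbf H)\Big)\Big]\ \forall S\subseteq\{1,2\}\Big\}.$$ Fix $0<\mu_1<\mu_2$. A policy $P\in\mathcal P$ is *optimal* if some $(R_1,R_2)\in\mathcal C_1(P)\cap\mathcal C_2(P)$ maximizes $\mu_1R_1+\mu_2R_2$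 over $\mathcal C$. Put $A_{j,k}(P)=\mathbb E[C(|H_{j,k}|^2P_k(\mathbf H))]$ and $B_j(P)=\mathbb E[C(\sum_k|H_{j,k}|^2P_k(\mathbf H))]$, and let $$S^{(1)}=A_{1,1}+A_{2,2},\quad S^{(2)}=A_{2,1}+A_{1,2},\quad S^{(3a)}=B_2,\quad S^{(3b)}=B_1,$$ $$S^{(1)}_\mu=\mu_1A_{1,1}+\mu_2A_{2,2},\quad S^{(2)}_\mu=\mu_1A_{2,1}+\mu_2A_{1,2},\quad S^{(i)}_\mu=\mu_1S^{(i)}+(\mu_2-\mu_1)\min_{j}A_{j,2}\ \ (i=3a,3b).$$ **Cases.** There are eleven cases $x$, each with a set $I_x$ of binding expressions and with conditions on $P$: * inactive cases $l=1,2$: $I=\{l\}$, $S^{(l)}<\min(S^{(3a)},S^{(3b)})$; * case $3a$: $I=\{3a\}$, $S^{(3a)}<\min(S^{(3b)},S^{(1)},S^{(2)})$; case $3b$: $I=\{3b\}$, $S^{(3b)}<\min(S^{(3a)},S^{(1)},S^{(2)})$; case $3c$: $I=\{3a,3b\}$, $S^{(3a)}=S^{(3b)}<\min(S^{(1)},S^{(2)})$;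 * boundary cases ($l=1,2$, and $l'$ the other index): $(l,3a)$: $I=\{l,3a\}$, $S^{(3a)}<S^{(3b)}$ and $S^{(l)}<S^{(3b)}$; $(l,3b)$: $I=\{l,3b\}$, $S^{(3b)}<S^{(3a)}$ and $S^{(l)}<S^{(3a)}$; $(l,3c)$: $I=\{l,3a,3b\}$, $S^{(3a)}=S^{(3b)}=S^{(l)}\le S^{(l')}$. In each case the conditions also include that $S^{(i)}_\mu$, $i\in I_x$, are equal. A policy is *$x$-optimal* if it maximizes $\min_{i\in I_x}S^{(i)}_\mu$ over $\mathcal P$, and it is *selected by $x$* if in addition it satisfies the conditions of case $x$. **Theorem.** For all $\mathbf H$, $\overline P_k$ and $\mu$ as above: 1. *(Algorithm.)* For every $x$ there is an $x$-optimal policy. Every policy $P$ that is selected by some $x$ is optimal, $\max_{R\in\mathcal C}(\mu_1R_1+\mu_2R_2)=\min_{i\in I_x}S_\mu^{(i)}(P)$, and $P$ maximizes the common value of $S^{(i)}_\mu$, $i\in I_x$, among the policies in $\mathcal P$ at which these are equal. Conversely every optimal policy is selected by some case. The conditions of two different cases never hold at the same policy unless $S^{(1)}=S^{(2)}=S^{(3a)}=S^{(3b)}$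 there. In particular, running through the cases in the order $1,2,3a,3b,3c,(1,3a),(2,3a),(1,3b),(2,3b),(1,3c),(2,3c)$ until some policy is selected, the search stops, and it stops at optimal policies only. 2. *(Inactive cases.)* A policy is $1$-optimal iff each $P_k$ is the single-user waterfilling policy of the link $H_{k,k}$, and $2$-optimal iff each $P_k$ is that of $H_{j,k}$, $j\ne k$. (The waterfilling policy of user $k$ on $H_{j,k}$ is $P_k=(1/\lambda-1/|H_{j,k}|^2)^+$ a.s., and $0$ where $H_{j,k}=0$, with $\lambda>0$ such that $\mathbb E[P_k]=\overline P_k$.) If a policy is selected by case $1$ (resp. $2$), then each user's link $H_{k,k}$ (resp. $H_{j,k}$, $j\neq k$) is its bottleneck: its interference-free ergodic capacity is attained and is strictly smaller than that of the user's other link. 3. *(Cases $3a$, $3b$, matching receivers.)* A policy with $A_{2,2}(P)<A_{1,2}(P)$ is $3a$-optimal iff it is an opportunistic multiuser waterfilling policy at receiver $2$; one with $A_{1,2}(P)<A_{2,2}(P)$ is $3b$-optimal iff it is one at receiver $1$. Here $P$ is an *opportunistic multiuser waterfilling policy at receiver $j$* if for some $\lambda_1,\lambda_2>0$, with $u_k(z)=\mu_k/(1+z)-\lambda_k/|H_{j,k}|^2$,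 almost surely for every $k$: $P_k=0$ if $H_{j,k}=0$, and otherwise $|H_{j,k}|^2P_k$ is the length of the set of $z>0$ with $u_k(z)>0$ and, if the other user has a nonzero gain to receiver $j$, $u_k(z)>u_{k'}(z)$ for the other user $k'$; and $\mathbb E[P_k]=\overline P_k$. 4. *(Opportunistic form.)* For every case $x$, in particular for the active and boundary cases, $P\in\mathcal P$ is $x$-optimal iff $\mathbb E[P_k]=\overline P_k$ for $k=1,2$ and there are weights $w_1,w_2,w_{3a},w_{3b}\ge0$ with sum $1$, carried by those $i\in I_x$ for which $S^{(i)}_\mu(P)=\min_{i'\in I_x}S^{(i')}_\mu(P)$, weights $\beta_1,\beta_2\ge0$ with sum $1$, carried by the minimizers $j$ of $A_{j,2}(P)$, and $\lambda_1,\lambda_2>0$ such that almost surely, for $k=1,2$: if $f_k|_{P_k=0}\le\lambda_k$ then $P_k=0$, and otherwise $P_k>0$ solves $f_k=\lambda_k$. Here, with $g_{j,k}=|H_{j,k}|^2$ and $k'\neq k$, $$f_k=\frac{w_1\mu_kg_{k,k}}{1+g_{k,k}P_k}+\frac{w_2\mu_kg_{k',k}}{1+g_{k',k}P_k}+\frac{w_{3a}\mu_1g_{2,k}}{1+\sum_ig_{2,i}P_i}+\frac{w_{3b}\mu_1g_{1,k}}{1+\sum_ig_{1,i}P_i}+\mathbf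 1_{\{k=2\}}(w_{3a}+w_{3b})(\mu_2-\mu_1)\sum_j\frac{\beta_jg_{j,2}}{1+g_{j,2}P_2}.$$ 5. *(Generally not waterfilling.)* For each of the nine active and boundary cases $x$ there are $\mathbf H$, $\overline P_k$ and $\mu$ as above such that every optimal policy (one exists) is selected by $x$, no $P_k$ is a single-user waterfilling policy of user $k$ on either of its links, and $P$ is not an opportunistic multiuser waterfilling policy at either receiver. -/

import Mathlib

open MeasureTheory

noncomputable section

namespace CMAC

/-- A fading state `h`: the entry `h j k` is the gain from transmitter `k` to receiver `j`.
Users `1, 2` and receivers `1, 2` of the usual notation are the indices `0, 1`. -/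
abbrev Fading := Fin 2 → Fin 2 → ℂ

/-- A pair of power allocations: `P k h` is the power spent by user `k` in the fading state `h`. -/
abbrev Policy := Fin 2 → Fading → ℝ

/-- The other index in `{0, 1}`. -/
def other (k : Fin 2) : Fin 2 := Fin.rev k

/-- `C(x) = log₂ (1 + x)`. -/
def cap (x : ℝ) : ℝ := Real.logb 2 (1 + x)

/-- The power gain `|h_{j,k}|²`. -/
def gain (j k : Fin 2) (h : Fading) : ℝ := ‖h j k‖ ^ 2

/-- Standing assumptions on the law `ν` of the fading matrix and on the average powers:
the power budgets are positive, ergodic rates are finite, and no link is almost surely absent. -/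
structure IsAdmissible (ν : Measure Fading) (Pbar : Fin 2 → ℝ) : Prop where
  isProb : IsProbabilityMeasure ν
  power_pos : ∀ k, 0 < Pbar k
  log_integrable : ∀ j k, Integrable (fun h => Real.log (1 + gain j k h)) ν
  link_present : ∀ j k, 0 < ν {h | h j k ≠ 0}

/-- Single-user power allocations with average power at most `c`. -/
def userPolicies (ν : Measure Fading) (c : ℝ) : Set (Fading → ℝ) :=
  {p | Measurable p ∧ (∀ h, 0 ≤ p h) ∧ Integrable p ν ∧ ∫ h, p h ∂ν ≤ c}

/-- The set of feasible power policies. -/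
def policies (ν : Measure Fading) (Pbar : Fin 2 → ℝ) : Set Policy :=
  {P | ∀ k, P k ∈ userPolicies ν (Pbar k)}

/-- `E[C(∑_{k ∈ S} |H_{j,k}|² P_k(H))]`. -/
def rate (ν : Measure Fading) (P : Policy) (j : Fin 2) (S : Finset (Fin 2)) : ℝ :=
  ∫ h, cap (∑ k ∈ S, gain j k h * P k h) ∂ν

/-- The multiaccess rate region (a pentagon) at receiver `j` for the policy `P`. -/
def macRegion (ν : Measure Fading) (P : Policy) (j : Fin 2) : Set (Fin 2 → ℝ) :=
  {R | (∀ k, 0 ≤ R k) ∧ ∀ S : Finset (Fin 2), ∑ k ∈ S, R k ≤ rate ν P j S}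

/-- The capacity region of the ergodic fading compound multiaccess channel. -/
def capacityRegion (ν : Measure Fading) (Pbar : Fin 2 → ℝ) : Set (Fin 2 → ℝ) :=
  ⋃ P ∈ policies ν Pbar, macRegion ν P 0 ∩ macRegion ν P 1

/-- `P` is an optimal policy for the weights `μ`: some rate pair that is achieved with `P`
maximizes the weighted rate over the whole capacity region. -/
def IsOptimal (ν : Measure Fading) (Pbar μ : Fin 2 → ℝ) (P : Policy) : Prop :=
  P ∈ policies ν Pbar ∧
    ∃ R ∈ macRegion ν P 0 ∩ macRegion ν P 1,
      ∀ R' ∈ capacityRegion ν Pbar, ∑ k, μ k * R' k ≤ ∑ k, μ k * R k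

/-! ### The rate expressions and the cases -/

/-- The four elementary rate expressions. -/
inductive Basic
  | b1 | b2 | b3a | b3b
  deriving DecidableEq

instance : Fintype Basic where
  elems := {.b1, .b2, .b3a, .b3b}
  complete := by intro a; cases a <;> simp

/-- The sum-rates `S^{(1)}, S^{(2)}, S^{(3a)}, S^{(3b)}`. -/
def sumRate (ν : Measure Fading) (P : Policy) : Basic → ℝ
  | .b1 => ∑ k, rate ν P k {k}
  | .b2 => ∑ k, rate ν P (other k) {k}
  | .b3a => rate ν P 1 Finset.univ
  | .b3b => rate ν P 0 Finset.univ

/-- The weighted rates `S^{(1)}(μ,P), S^{(2)}(μ,P), S^{(3a)}(μ,P), S^{(3b)}(μ,P)` for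
`μ₁ < μ₂`. -/
def weightedRate (ν : Measure Fading) (μ : Fin 2 → ℝ) (P : Policy) : Basic → ℝ
  | .b1 => ∑ k, μ k * rate ν P k {k}
  | .b2 => ∑ k, μ k * rate ν P (other k) {k}
  | .b3a => μ 0 * sumRate ν P .b3a + (μ 1 - μ 0) * min (rate ν P 0 {1}) (rate ν P 1 {1})
  | .b3b => μ 0 * sumRate ν P .b3b + (μ 1 - μ 0) * min (rate ν P 0 {1}) (rate ν P 1 {1})

/-- The eleven cases: inactive `1, 2`; active `3a, 3b, 3c`; boundary `(l, n)`. -/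
inductive Case
  | c1 | c2 | c3a | c3b | c3c | c13a | c23a | c13b | c23b | c13c | c23c
  deriving DecidableEq

/-- The position of a case in the search: inactive, then active, then boundary cases, with
`(1,3c)` and `(2,3c)` last. -/
def Case.rank : Case → ℕ
  | .c1 => 0 | .c2 => 1 | .c3a => 2 | .c3b => 3 | .c3c => 4
  | .c13a => 5 | .c23a => 6 | .c13b => 7 | .c23b => 8 | .c13c => 9 | .c23c => 10

/-- The rate expressions that are binding, and hence equal, in a case. -/
def Case.parts : Case → Finset Basic
  | .c1 => {.b1}
  | .c2 => {.b2}
  | .c3a => {.b3a}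
  | .c3b => {.b3b}
  | .c3c => {.b3a, .b3b}
  | .c13a => {.b1, .b3a}
  | .c23a => {.b2, .b3a}
  | .c13b => {.b1, .b3b}
  | .c23b => {.b2, .b3b}
  | .c13c => {.b1, .b3a, .b3b}
  | .c23c => {.b2, .b3a, .b3b}

theorem Case.parts_nonempty (x : Case) : x.parts.Nonempty := by
  cases x <;> simp [Case.parts]

/-- The objective of a case: the smallest of its binding weighted rates. -/
def caseRate (ν : Measure Fading) (μ : Fin 2 → ℝ) (x : Case) (P : Policy) : ℝ :=
  x.parts.inf' x.parts_nonempty (weightedRate ν μ P)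

/-- `P` solves the optimization problem of the case `x`, over all feasible policies. -/
def IsCaseOptimal (ν : Measure Fading) (Pbar μ : Fin 2 → ℝ) (x : Case) (P : Policy) : Prop :=
  P ∈ policies ν Pbar ∧ ∀ Q ∈ policies ν Pbar, caseRate ν μ x Q ≤ caseRate ν μ x P

/-- The binding weighted rates of the case `x` agree at `P`. -/
def PartsEqual (ν : Measure Fading) (μ : Fin 2 → ℝ) (x : Case) (P : Policy) : Prop :=
  ∀ a ∈ x.parts, ∀ b ∈ x.parts, weightedRate ν μ P a = weightedRate ν μ P b

/-- The inequalities between sum-rates that distinguish the case `x`. -/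
def SumRateCondition (ν : Measure Fading) (P : Policy) : Case → Prop
  | .c1 => sumRate ν P .b1 < min (sumRate ν P .b3a) (sumRate ν P .b3b)
  | .c2 => sumRate ν P .b2 < min (sumRate ν P .b3a) (sumRate ν P .b3b)
  | .c3a => sumRate ν P .b3a <
      min (sumRate ν P .b3b) (min (sumRate ν P .b1) (sumRate ν P .b2))
  | .c3b => sumRate ν P .b3b <
      min (sumRate ν P .b3a) (min (sumRate ν P .b1) (sumRate ν P .b2))
  | .c3c => sumRate ν P .b3a = sumRate ν P .b3b ∧
      sumRate ν P .b3b < min (sumRate ν P .b1) (sumRate ν P .b2)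
  | .c13a => sumRate ν P .b3a < sumRate ν P .b3b ∧ sumRate ν P .b1 < sumRate ν P .b3b
  | .c23a => sumRate ν P .b3a < sumRate ν P .b3b ∧ sumRate ν P .b2 < sumRate ν P .b3b
  | .c13b => sumRate ν P .b3b < sumRate ν P .b3a ∧ sumRate ν P .b1 < sumRate ν P .b3a
  | .c23b => sumRate ν P .b3b < sumRate ν P .b3a ∧ sumRate ν P .b2 < sumRate ν P .b3a
  | .c13c => sumRate ν P .b3a = sumRate ν P .b3b ∧ sumRate ν P .b3b = sumRate ν P .b1 ∧
      sumRate ν P .b1 ≤ sumRate ν P .b2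
  | .c23c => sumRate ν P .b3a = sumRate ν P .b3b ∧ sumRate ν P .b3b = sumRate ν P .b2 ∧
      sumRate ν P .b2 ≤ sumRate ν P .b1

/-- The conditions of the case `x` at the policy `P`. -/
def CaseCondition (ν : Measure Fading) (μ : Fin 2 → ℝ) (x : Case) (P : Policy) : Prop :=
  PartsEqual ν μ x P ∧ SumRateCondition ν P x

/-- `P` is optimal for the case `x` and satisfies the conditions of that case. -/
def Selects (ν : Measure Fading) (Pbar μ : Fin 2 → ℝ) (x : Case) (P : Policy) : Prop :=
  IsCaseOptimal ν Pbar μ x P ∧ CaseCondition ν μ x P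

/-- The search through the cases, in the given order, stops at the case `x` with the policy
`P`. -/
def IsSearchOutput (ν : Measure Fading) (Pbar μ : Fin 2 → ℝ) (x : Case) (P : Policy) : Prop :=
  Selects ν Pbar μ x P ∧ ∀ y : Case, y.rank < x.rank → ∀ Q, ¬ Selects ν Pbar μ y Q

/-! ### The forms of the policies -/

/-- The (interference-free) ergodic capacity of the link from transmitter `k` to receiver `j`. -/
def linkCapacity (ν : Measure Fading) (Pbar : Fin 2 → ℝ) (j k : Fin 2) : ℝ :=
  sSup ((fun p : Fading → ℝ => ∫ h, cap (gain j k h * p h) ∂ν) '' userPolicies ν (Pbar k))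

/-- `p` is the single-user waterfilling policy of user `k` over its link to receiver `j`. -/
def IsWaterfilling (ν : Measure Fading) (Pbar : Fin 2 → ℝ) (j k : Fin 2) (p : Fading → ℝ) :
    Prop :=
  ∃ l : ℝ, 0 < l ∧
    (∀ᵐ h ∂ν, p h = if h j k = 0 then 0 else max (1 / l - 1 / gain j k h) 0) ∧
    ∫ h, p h ∂ν = Pbar k

/-- The marginal utility of user `k` at receiver `j` and interference level `z`, for the rate
weights `μ` and the power prices `l`. -/
def utility (μ l : Fin 2 → ℝ) (j : Fin 2) (h : Fading) (k : Fin 2) (z : ℝ) : ℝ :=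
  μ k / (1 + z) - l k / gain j k h

/-- The interference levels that greedy multiuser waterfilling at receiver `j` gives to user `k`:
those at which its marginal utility is positive and exceeds that of the other user. -/
def servedLevels (μ l : Fin 2 → ℝ) (j : Fin 2) (h : Fading) (k : Fin 2) : Set ℝ :=
  {z | 0 < z ∧ 0 < utility μ l j h k z ∧
    (h j (other k) ≠ 0 → utility μ l j h (other k) z < utility μ l j h k z)}

/-- `P` is an opportunistic multiuser waterfilling policy for the multiaccess channel to
receiver `j` with rate weights `μ`: the received power of every user is the length of the set of
levels it is served at. -/
def IsMultiuserWaterfilling (ν : Measure Fading) (Pbar μ : Fin 2 → ℝ) (j : Fin 2)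
    (P : Policy) : Prop :=
  ∃ l : Fin 2 → ℝ, (∀ k, 0 < l k) ∧
    (∀ᵐ h ∂ν, ∀ k, P k h =
      if h j k = 0 then 0 else (volume (servedLevels μ l j h k)).toReal / gain j k h) ∧
    ∀ k, ∫ h, P k h ∂ν = Pbar k

/-- The marginal reward (up to the factor `1 / ln 2`) of the power of user `k` in the state `h`
when the powers are `p`. The weights `w` mix the four rate expressions and `b` mixes the
single-user rates of user `2` at the two receivers. -/
def marginal (μ : Fin 2 → ℝ) (w : Basic → ℝ) (b : Fin 2 → ℝ) (h : Fading) (p : Fin 2 → ℝ)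
    (k : Fin 2) : ℝ :=
  w .b1 * (μ k * gain k k h / (1 + gain k k h * p k))
  + w .b2 * (μ k * gain (other k) k h / (1 + gain (other k) k h * p k))
  + w .b3a * (μ 0 * gain 1 k h / (1 + ∑ i, gain 1 i h * p i))
  + w .b3b * (μ 0 * gain 0 k h / (1 + ∑ i, gain 0 i h * p i))
  + if k = 1 then
      (w .b3a + w .b3b) * (μ 1 - μ 0) * ∑ j, b j * (gain j 1 h / (1 + gain j 1 h * p 1))
    else 0

/-- `P` is an opportunistic policy of the form belonging to the case `x`. The mixing weights `w`
are carried by the smallest rate expressions of the case, and `b` by the receivers at which user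
`2` has its smallest single-user rate. In almost every state, user `k` is silent if its marginal
reward at zero power is at most its price `l k`; otherwise its power is the positive solution of
`marginal reward = l k`. All the power is used. -/
def IsOpportunistic (ν : Measure Fading) (Pbar μ : Fin 2 → ℝ) (x : Case) (P : Policy) : Prop :=
  ∃ (w : Basic → ℝ) (b l : Fin 2 → ℝ),
    (∀ a, 0 ≤ w a) ∧ ∑ a, w a = 1 ∧
    (∀ a, w a ≠ 0 → a ∈ x.parts ∧ weightedRate ν μ P a = caseRate ν μ x P) ∧
    (∀ j, 0 ≤ b j) ∧ ∑ j, b j = 1 ∧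
    (∀ j, b j ≠ 0 → ∀ i, rate ν P j {1} ≤ rate ν P i {1}) ∧
    (∀ k, 0 < l k) ∧
    (∀ᵐ h ∂ν, ∀ k,
      (marginal μ w b h (Function.update (fun i => P i h) k 0) k ≤ l k → P k h = 0) ∧
      (l k < marginal μ w b h (Function.update (fun i => P i h) k 0) k →
        0 < P k h ∧ marginal μ w b h (fun i => P i h) k = l k)) ∧
    ∀ k, ∫ h, P k h ∂ν = Pbar k

/-- `P` is not waterfilling: no user waterfills over any of its links, and `P` is not multiuser
waterfilling at any receiver. -/
def IsNonWaterfilling (ν : Measure Fading) (Pbar μ : Fin 2 → ℝ) (P : Policy) : Prop :=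
  (∀ j k, ¬ IsWaterfilling ν Pbar j k (P k)) ∧
    ∀ j, ¬ IsMultiuserWaterfilling ν Pbar μ j P

end CMAC

end

/-!
The weighted sum-rate problem for the ergodic fading compound multiaccess channel is a max-min
problem. For `μ₁ < μ₂`, intersecting the two pentagons of a policy `P` shows that the largest
weighted sum-rate that `P` achieves is the smallest of the four weighted rates `weightedRate`
(`policyValue`, `exists_weighted_sum_eq_policyValue`), so that the optimal policies are the
maximizers of `policyValue` (`isOptimal_iff_policyValue`). The problem of a case keeps only the
binding ones of the four expressions. Its value is thus an upper bound, which is tight where the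
conditions of the case hold, since these say that the binding expressions are the smallest ones
(`weightedRate_le_of_reducedCondition`).

*Existence.* A maximizing sequence need not converge, and the feasible policies are not compact in
an obvious sense. The superlevel sets of a minimum of concave rates are convex, however, and from
decreasing convex sets one can choose near-minimizers of the strictly convex functional
`∑ k, E[1 / (1 + P_k)]`; these converge almost surely (`exists_tendsto_mem_policies`). The rates
are upper semicontinuous along such sequences, since truncating the powers at `M` costs at most a constant
times `1 / M` (`le_mixedRate_of_tendsto`).

*Multipliers.* Every weighted rate is a minimum over the two receivers of nonnegative mixtures of
the concave rates `rate ν P j S`. Separating hyperplanes give weights on these mixtures and prices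
for the powers such that a solution maximizes the Lagrangian (`exists_lagrangian`), which can be
done state by state (`isStationary_of_forall_lagrangian_le`). As every link is present with
positive probability, the prices are positive and all power is used (`exists_isStationary`).
Conversely, stationary policies maximize the Lagrangian by the tangent inequality of the
logarithm. This is the opportunistic form (`isCaseOptimal_iff_isOpportunistic`); for a single
binding expression the stationarity conditions can be solved, which gives waterfilling and
multiuser waterfilling.

*Every optimal policy is selected.* The multipliers of an optimal policy are carried by its
smallest expressions, and comparing these shows which case conditions hold
(`exists_reducedCondition`). Only if all four tie is there a choice, between `(1,3c)` and
`(2,3c)`; there weight can be moved from `1` and `2` to `3a` and `3b` until one of `1` and `2` has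
none left (`isCaseOptimal_of_tie`).

*Examples.* Equality in the tangent inequality determines all received powers on which the mixture
depends (`IsStationary.received_eq`). In the examples with two or three states these and the power
budgets determine the powers, so the optimal policy is unique, and its powers violate the
waterfilling formulas.

As in the definitions, users and receivers `1, 2` are the indices `0, 1`, and comments number them
`1, 2`.
-/

noncomputable section

namespace CMAC

open Filter Topology

/-! ### Mixtures of rates and their marginals -/

/-- The powers that the policy `P` allocates in the fading state `h`. -/
def powers (P : Policy) (h : Fading) : Fin 2 → ℝ := fun k => P k h

/-- The power received at `j` from the users in `S`. -/
def received (j : Fin 2) (S : Finset (Fin 2)) (h : Fading) (p : Fin 2 → ℝ) : ℝ :=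
  ∑ k ∈ S, gain j k h * p k

/-- The power allocations without a power budget. -/
def allocations (ν : Measure Fading) : Set Policy :=
  {P | ∀ k, Measurable (P k) ∧ (∀ h, 0 ≤ P k h) ∧ Integrable (P k) ν}

/-- Coefficients for the twice four rates `rate ν P j S`. -/
abbrev Coef := Fin 2 → Finset (Fin 2) → ℝ

/-- The mixture of the rates `rate ν P j S` with coefficients `c`. -/
def mixedRate (ν : Measure Fading) (c : Coef) (P : Policy) : ℝ :=
  ∑ j, ∑ S, c j S * rate ν P j S

/-- The integrand of `mixedRate`, up to the factor `1 / log 2`. -/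
def logSum (c : Coef) (h : Fading) (p : Fin 2 → ℝ) : ℝ :=
  ∑ j, ∑ S, c j S * Real.log (1 + received j S h p)

/-- The partial derivative of `logSum c h` at `p` in the power of user `k`. -/
def slope (c : Coef) (h : Fading) (p : Fin 2 → ℝ) (k : Fin 2) : ℝ :=
  ∑ j, ∑ S, if k ∈ S then c j S * (gain j k h / (1 + received j S h p)) else 0

theorem gain_nonneg (j k : Fin 2) (h : Fading) : 0 ≤ gain j k h := by
  unfold gain; positivity

theorem gain_pos {j k : Fin 2} {h : Fading} (hh : h j k ≠ 0) : 0 < gain j k h := by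
  unfold gain; positivity

theorem gain_eq_zero {j k : Fin 2} {h : Fading} (hh : h j k = 0) : gain j k h = 0 := by
  simp [gain, hh]

@[fun_prop]
theorem measurable_gain (j k : Fin 2) : Measurable (gain j k) := by
  unfold gain; fun_prop

theorem received_nonneg (j : Fin 2) (S : Finset (Fin 2)) (h : Fading) {p : Fin 2 → ℝ}
    (hp : ∀ k, 0 ≤ p k) : 0 ≤ received j S h p :=
  Finset.sum_nonneg fun k _ => mul_nonneg (gain_nonneg j k h) (hp k)

theorem measurable_received (j : Fin 2) (S : Finset (Fin 2)) {P : Policy}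
    (hP : ∀ k, Measurable (P k)) : Measurable fun h => received j S h (powers P h) := by
  unfold received powers
  exact Finset.measurable_sum _ fun k _ => (measurable_gain j k).mul (hP k)

theorem rate_eq (ν : Measure Fading) (P : Policy) (j : Fin 2) (S : Finset (Fin 2)) :
    rate ν P j S = (∫ h, Real.log (1 + received j S h (powers P h)) ∂ν) / Real.log 2 := by
  rw [← integral_div]; rfl

theorem log_two_pos : 0 < Real.log 2 := Real.log_pos (by norm_num)

theorem policies_subset_allocations {ν : Measure Fading} {Pbar : Fin 2 → ℝ} :
    policies ν Pbar ⊆ allocations ν :=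
  fun _ hP k => ⟨(hP k).1, (hP k).2.1, (hP k).2.2.1⟩

/-- The logarithms of the gains and the powers dominate all rate integrands. -/
theorem log_received_le (j : Fin 2) (S : Finset (Fin 2)) (h : Fading) {p : Fin 2 → ℝ}
    (hp : ∀ k, 0 ≤ p k) :
    Real.log (1 + received j S h p) ≤ ∑ k, (Real.log (1 + gain j k h) + p k) := by
  have h1 : ∀ k, 0 ≤ gain j k h * p k := fun k => mul_nonneg (gain_nonneg j k h) (hp k)
  have h2 : received j S h p ≤ ∑ k, gain j k h * p k :=
    Finset.sum_le_sum_of_subset_of_nonneg (Finset.subset_univ S) fun k _ _ => h1 k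
  have h3 : ∀ k, Real.log (1 + gain j k h * p k) ≤ Real.log (1 + gain j k h) + p k := by
    intro k
    have hg := gain_nonneg j k h
    have := hp k
    calc Real.log (1 + gain j k h * p k)
        ≤ Real.log ((1 + gain j k h) * (1 + p k)) := by
          apply Real.log_le_log <;> nlinarith [h1 k]
      _ = Real.log (1 + gain j k h) + Real.log (1 + p k) :=
          Real.log_mul (by positivity) (by positivity)
      _ ≤ _ := by linarith [Real.log_le_sub_one_of_pos (show 0 < 1 + p k by positivity)]
  have h4 : Real.log (1 + received j S h p)
      ≤ Real.log ((1 + gain j 0 h * p 0) * (1 + gain j 1 h * p 1)) := by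
    have := received_nonneg j S h hp
    apply Real.log_le_log (by positivity)
    rw [Fin.sum_univ_two] at h2
    nlinarith [mul_nonneg (h1 0) (h1 1)]
  rw [Real.log_mul (by linarith [h1 0]) (by linarith [h1 1])] at h4
  rw [Fin.sum_univ_two]
  linarith [h3 0, h3 1]

theorem integrable_log_received {ν : Measure Fading} {Pbar : Fin 2 → ℝ}
    (hν : IsAdmissible ν Pbar) {P : Policy} (hP : P ∈ allocations ν)
    (j : Fin 2) (S : Finset (Fin 2)) :
    Integrable (fun h => Real.log (1 + received j S h (powers P h))) ν := by
  have hb : Integrable (fun h => ∑ k, (Real.log (1 + gain j k h) + P k h)) ν :=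
    integrable_finsetSum _ fun k _ => (hν.log_integrable j k).add (hP k).2.2
  refine hb.mono' ?_ (ae_of_all _ fun h => ?_)
  · exact (Real.measurable_log.comp ((measurable_received j S fun k =>
      (hP k).1).const_add 1)).aestronglyMeasurable
  · have h0 := received_nonneg j S h (p := powers P h) fun k => (hP k).2.1 h
    rw [Real.norm_of_nonneg (Real.log_nonneg (by linarith))]
    exact log_received_le j S h fun k => (hP k).2.1 h

theorem integrable_logSum {ν : Measure Fading} {Pbar : Fin 2 → ℝ}
    (hν : IsAdmissible ν Pbar) {P : Policy} (hP : P ∈ allocations ν) (c : Coef) :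
    Integrable (fun h => logSum c h (powers P h)) ν :=
  integrable_finsetSum _ fun j _ => integrable_finsetSum _ fun S _ =>
    (integrable_log_received hν hP j S).const_mul _

theorem integral_logSum {ν : Measure Fading} {Pbar : Fin 2 → ℝ}
    (hν : IsAdmissible ν Pbar) {P : Policy} (hP : P ∈ allocations ν) (c : Coef) :
    ∫ h, logSum c h (powers P h) ∂ν = Real.log 2 * mixedRate ν c P := by
  unfold logSum mixedRate
  rw [integral_finsetSum _ fun j _ => integrable_finsetSum _ fun S _ =>
    (integrable_log_received hν hP j S).const_mul _, Finset.mul_sum]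
  refine Finset.sum_congr rfl fun j _ => ?_
  rw [integral_finsetSum _ fun S _ => (integrable_log_received hν hP j S).const_mul _,
    Finset.mul_sum]
  refine Finset.sum_congr rfl fun S _ => ?_
  rw [integral_const_mul, rate_eq]
  field_simp [log_two_pos.ne']

theorem log_le_tangent {a b : ℝ} (ha : 0 < a) (hb : 0 < b) :
    Real.log a ≤ Real.log b + (a - b) / b := by
  have := Real.log_le_sub_one_of_pos (div_pos ha hb)
  rw [Real.log_div ha.ne' hb.ne'] at this
  rw [sub_div, div_self hb.ne']
  linarith

theorem eq_of_log_eq_tangent {a b : ℝ} (ha : 0 < a) (hb : 0 < b)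
    (h : Real.log b + (a - b) / b ≤ Real.log a) : a = b := by
  by_contra hne
  have := Real.log_lt_sub_one_of_pos (div_pos ha hb)
    (fun h => hne (by rwa [div_eq_one_iff_eq hb.ne'] at h))
  rw [Real.log_div ha.ne' hb.ne'] at this
  rw [sub_div, div_self hb.ne'] at h
  linarith

theorem sum_slope_mul (c : Coef) (h : Fading) (p d : Fin 2 → ℝ) :
    ∑ k, slope c h p k * d k =
      ∑ j, ∑ S, c j S * (received j S h d / (1 + received j S h p)) := by
  unfold slope
  simp_rw [Finset.sum_mul]
  rw [Finset.sum_comm]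
  refine Finset.sum_congr rfl fun j _ => ?_
  rw [Finset.sum_comm]
  refine Finset.sum_congr rfl fun S _ => ?_
  simp_rw [ite_mul, zero_mul]
  rw [Finset.sum_ite_mem, Finset.univ_inter]
  nth_rewrite 2 [received]
  rw [Finset.sum_div, Finset.mul_sum]
  exact Finset.sum_congr rfl fun k _ => by ring

theorem received_sub (j : Fin 2) (S : Finset (Fin 2)) (h : Fading) (p q : Fin 2 → ℝ) :
    received j S h (fun k => q k - p k) = received j S h q - received j S h p := by
  unfold received
  rw [← Finset.sum_sub_distrib]
  exact Finset.sum_congr rfl fun k _ => by ring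

theorem coef_mul_log_le_tangent {c : Coef} (hc : ∀ j S, 0 ≤ c j S) (h : Fading)
    {p q : Fin 2 → ℝ} (hp : ∀ k, 0 ≤ p k) (hq : ∀ k, 0 ≤ q k) (j : Fin 2)
    (S : Finset (Fin 2)) :
    c j S * Real.log (1 + received j S h q) ≤
      c j S * Real.log (1 + received j S h p) +
        c j S * (received j S h (fun k => q k - p k) / (1 + received j S h p)) := by
  rw [← mul_add]
  refine mul_le_mul_of_nonneg_left ?_ (hc j S)
  have h1 := received_nonneg j S h hp
  have h2 := received_nonneg j S h hq
  rw [received_sub]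
  have := log_le_tangent (a := 1 + received j S h q) (b := 1 + received j S h p)
    (by linarith) (by linarith)
  rwa [add_sub_add_left_eq_sub] at this

/-- The tangent inequality for the concave function `logSum c h`. -/
theorem logSum_le_tangent {c : Coef} (hc : ∀ j S, 0 ≤ c j S) (h : Fading) {p q : Fin 2 → ℝ}
    (hp : ∀ k, 0 ≤ p k) (hq : ∀ k, 0 ≤ q k) :
    logSum c h q ≤ logSum c h p + ∑ k, slope c h p k * (q k - p k) := by
  rw [sum_slope_mul, logSum, logSum, ← Finset.sum_add_distrib]
  refine Finset.sum_le_sum fun j _ => ?_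
  rw [← Finset.sum_add_distrib]
  exact Finset.sum_le_sum fun S _ => coef_mul_log_le_tangent hc h hp hq j S

/-- Equality in the tangent inequality forces all received powers that matter to agree. -/
theorem received_eq_of_tangent_le {c : Coef} (hc : ∀ j S, 0 ≤ c j S) (h : Fading)
    {p q : Fin 2 → ℝ} (hp : ∀ k, 0 ≤ p k) (hq : ∀ k, 0 ≤ q k)
    (heq : logSum c h p + ∑ k, slope c h p k * (q k - p k) ≤ logSum c h q)
    {j : Fin 2} {S : Finset (Fin 2)} (hjS : 0 < c j S) :
    received j S h q = received j S h p := by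
  have key := coef_mul_log_le_tangent hc h hp hq
  have h1 := received_nonneg j S h hp
  have h2 := received_nonneg j S h hq
  have hstep : Real.log (1 + received j S h p) +
      (1 + received j S h q - (1 + received j S h p)) / (1 + received j S h p) ≤
        Real.log (1 + received j S h q) := by
    by_contra! hlt
    have hlt' := mul_lt_mul_of_pos_left hlt hjS
    rw [sum_slope_mul, logSum, logSum, ← Finset.sum_add_distrib] at heq
    refine absurd heq (not_le.2 ?_)
    refine Finset.sum_lt_sum (fun i _ => ?_) ⟨j, Finset.mem_univ j, ?_⟩
    · rw [← Finset.sum_add_distrib]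
      exact Finset.sum_le_sum fun T _ => key i T
    · rw [← Finset.sum_add_distrib]
      refine Finset.sum_lt_sum (fun T _ => key j T) ⟨S, Finset.mem_univ S, ?_⟩
      rw [received_sub, ← mul_add]
      rwa [add_sub_add_left_eq_sub] at hlt'
  have := eq_of_log_eq_tangent (by linarith) (by linarith) hstep
  linarith

/-! ### Concavity -/

theorem convex_allocations (ν : Measure Fading) : Convex ℝ (allocations ν) := by
  intro P hP Q hQ a b ha hb _ k
  refine ⟨((hP k).1.const_mul a).add ((hQ k).1.const_mul b), fun h => ?_,
    ((hP k).2.2.const_mul a).add ((hQ k).2.2.const_mul b)⟩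
  exact add_nonneg (mul_nonneg ha ((hP k).2.1 h)) (mul_nonneg hb ((hQ k).2.1 h))

theorem convex_policies (ν : Measure Fading) (Pbar : Fin 2 → ℝ) :
    Convex ℝ (policies ν Pbar) := by
  intro P hP Q hQ a b ha hb hab k
  obtain ⟨h1, h2, h3⟩ := convex_allocations ν (policies_subset_allocations hP)
    (policies_subset_allocations hQ) ha hb hab k
  refine ⟨h1, h2, h3, ?_⟩
  have : ∫ h, (a • P + b • Q) k h ∂ν = a * ∫ h, P k h ∂ν + b * ∫ h, Q k h ∂ν := by
    rw [← integral_const_mul, ← integral_const_mul,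
      ← integral_add ((hP k).2.2.1.const_mul a) ((hQ k).2.2.1.const_mul b)]
    rfl
  rw [this]
  calc a * ∫ h, P k h ∂ν + b * ∫ h, Q k h ∂ν ≤ a * Pbar k + b * Pbar k := by
        gcongr
        · exact (hP k).2.2.2
        · exact (hQ k).2.2.2
    _ = Pbar k := by rw [← add_mul, hab, one_mul]

theorem received_combo (j : Fin 2) (S : Finset (Fin 2)) (h : Fading) (P Q : Policy) (a b : ℝ) :
    received j S h (powers (a • P + b • Q) h) =
      a * received j S h (powers P h) + b * received j S h (powers Q h) := by
  simp only [received, powers, Finset.mul_sum, ← Finset.sum_add_distrib, Pi.add_apply,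
    Pi.smul_apply, smul_eq_mul]
  exact Finset.sum_congr rfl fun k _ => by ring

theorem rate_concaveOn {ν : Measure Fading} {Pbar : Fin 2 → ℝ} (hν : IsAdmissible ν Pbar)
    (j : Fin 2) (S : Finset (Fin 2)) :
    ConcaveOn ℝ (allocations ν) fun P => rate ν P j S := by
  refine ⟨convex_allocations ν, fun P hP Q hQ a b ha hb hab => ?_⟩
  have hPQ := convex_allocations ν hP hQ ha hb hab
  simp only [rate_eq, smul_eq_mul, ← mul_div_assoc, ← add_div]
  refine div_le_div_of_nonneg_right ?_ log_two_pos.le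
  rw [← integral_const_mul, ← integral_const_mul, ← integral_add
    ((integrable_log_received hν hP j S).const_mul a)
    ((integrable_log_received hν hQ j S).const_mul b)]
  refine integral_mono (((integrable_log_received hν hP j S).const_mul a).add
    ((integrable_log_received hν hQ j S).const_mul b)) (integrable_log_received hν hPQ j S)
    fun h => ?_
  have h1 := received_nonneg j S h (p := powers P h) fun k => (hP k).2.1 h
  have h2 := received_nonneg j S h (p := powers Q h) fun k => (hQ k).2.1 h
  have := strictConcaveOn_log_Ioi.concaveOn.2 (x := 1 + received j S h (powers P h))
    (Set.mem_Ioi.2 (by linarith)) (y := 1 + received j S h (powers Q h))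
    (Set.mem_Ioi.2 (by linarith)) ha hb hab
  simp only [smul_eq_mul] at this
  refine this.trans (le_of_eq ?_)
  rw [received_combo]
  congr 1
  linear_combination hab

theorem mixedRate_concaveOn {ν : Measure Fading} {Pbar : Fin 2 → ℝ} (hν : IsAdmissible ν Pbar)
    {c : Coef} (hc : ∀ j S, 0 ≤ c j S) :
    ConcaveOn ℝ (allocations ν) (mixedRate ν c) := by
  refine ⟨convex_allocations ν, fun P hP Q hQ a b ha hb hab => ?_⟩
  simp only [mixedRate, smul_eq_mul, Finset.mul_sum, ← Finset.sum_add_distrib]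
  refine Finset.sum_le_sum fun j _ => Finset.sum_le_sum fun S _ => ?_
  have := (rate_concaveOn hν j S).2 hP hQ ha hb hab
  simp only [smul_eq_mul] at this
  calc _ = c j S * (a * rate ν P j S + b * rate ν Q j S) := by ring
    _ ≤ _ := mul_le_mul_of_nonneg_left this (hc j S)

/-- Every rate is bounded over the feasible policies. -/
theorem rate_le {ν : Measure Fading} {Pbar : Fin 2 → ℝ} (hν : IsAdmissible ν Pbar)
    {P : Policy} (hP : P ∈ policies ν Pbar) (j : Fin 2) (S : Finset (Fin 2)) :
    rate ν P j S ≤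
      (∑ k, ((∫ h, Real.log (1 + gain j k h) ∂ν) + Pbar k)) / Real.log 2 := by
  rw [rate_eq]
  refine div_le_div_of_nonneg_right ?_ log_two_pos.le
  have hb : ∀ k, Integrable (fun h => Real.log (1 + gain j k h) + P k h) ν :=
    fun k => (hν.log_integrable j k).add (hP k).2.2.1
  refine (integral_mono (integrable_log_received hν (policies_subset_allocations hP) j S)
    (integrable_finsetSum _ fun k _ => hb k)
    fun h => log_received_le j S h (p := powers P h) fun k => (hP k).2.1 h).trans ?_
  rw [integral_finsetSum _ fun k _ => hb k]
  refine Finset.sum_le_sum fun k _ => ?_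
  rw [integral_add (hν.log_integrable j k) (hP k).2.2.1]
  gcongr
  exact (hP k).2.2.2

theorem rate_nonneg {ν : Measure Fading} {P : Policy} (hP : P ∈ allocations ν)
    (j : Fin 2) (S : Finset (Fin 2)) : 0 ≤ rate ν P j S := by
  rw [rate_eq]
  refine div_nonneg (integral_nonneg fun h => Real.log_nonneg ?_) log_two_pos.le
  linarith [received_nonneg j S h (p := powers P h) fun k => (hP k).2.1 h]

theorem zero_mem_policies {ν : Measure Fading} {Pbar : Fin 2 → ℝ} (hν : IsAdmissible ν Pbar) :
    (0 : Policy) ∈ policies ν Pbar := by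
  intro k
  refine ⟨measurable_zero, fun _ => le_rfl, integrable_zero _ _ _, ?_⟩
  simpa using (hν.power_pos k).le

/-! ### Existence of optimal policies -/

/-- A bounded sequence that is Cauchy in mean square has a subsequence that converges almost
surely. -/
theorem exists_subseq_tendsto_of_integral_sq_le {Ω E : Type*} [MeasurableSpace Ω]
    {μ : Measure Ω} [IsFiniteMeasure μ] [NormedAddCommGroup E] [InnerProductSpace ℝ E]
    [CompleteSpace E] {f : ℕ → Ω → E} (hf : ∀ n, AEStronglyMeasurable (f n) μ) {C : ℝ}
    (hC : ∀ n ω, ‖f n ω‖ ≤ C) {B : ℕ → ℝ} (hB : Tendsto B atTop (𝓝 0))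
    (hfB : ∀ n m, n ≤ m → ∫ ω, ‖f n ω - f m ω‖ ^ 2 ∂μ ≤ B n) :
    ∃ (g : Ω → E) (ns : ℕ → ℕ), StronglyMeasurable g ∧ StrictMono ns ∧
      ∀ᵐ ω ∂μ, Tendsto (fun i => f (ns i) ω) atTop (𝓝 (g ω)) := by
  have hL : ∀ n, MemLp (f n) 2 μ := fun n => .of_bound (hf n) C (ae_of_all _ (hC n))
  have hdist : ∀ n m, n ≤ m → dist ((hL n).toLp (f n)) ((hL m).toLp (f m)) ≤ √(B n) := by
    intro n m hnm
    refine Real.le_sqrt_of_sq_le (le_trans (le_of_eq ?_) (hfB n m hnm))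
    rw [dist_eq_norm, ← real_inner_self_eq_norm_sq, ← MemLp.toLp_sub, L2.inner_def]
    refine integral_congr_ae ?_
    filter_upwards [((hL n).sub (hL m)).coeFn_toLp] with ω hω
    rw [hω, real_inner_self_eq_norm_sq]
    rfl
  have hB' : Tendsto (fun n => √(B n)) atTop (𝓝 0) := by
    have := (Real.continuous_sqrt.tendsto 0).comp hB
    rwa [Real.sqrt_zero] at this
  obtain ⟨G, hG⟩ := cauchySeq_tendsto_of_complete (cauchySeq_of_le_tendsto_0' _ hdist hB')
  have hm := (tendstoInMeasure_of_tendsto_Lp hG).congr_left fun n => (hL n).coeFn_toLp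
  obtain ⟨ns, hns, hlim⟩ := hm.exists_seq_tendsto_ae
  exact ⟨G, ns, Lp.stronglyMeasurable G, hns, hlim⟩

/-- The uniform strict convexity of `x ↦ 1 / (1 + x)`, measured in the variable `1 / (1 + x)`. -/
theorem one_div_one_add_midpoint_le {x y : ℝ} (hx : 0 ≤ x) (hy : 0 ≤ y) :
    1 / (1 + (x / 2 + y / 2)) + (1 / (1 + x) - 1 / (1 + y)) ^ 2 / 4 ≤
      (1 / (1 + x) + 1 / (1 + y)) / 2 := by
  rw [← sub_nonneg]
  have : (1 / (1 + x) + 1 / (1 + y)) / 2 -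
      (1 / (1 + (x / 2 + y / 2)) + (1 / (1 + x) - 1 / (1 + y)) ^ 2 / 4) =
      (x - y) ^ 2 * (x + y + 2 * x * y) / (4 * (1 + x) ^ 2 * (1 + y) ^ 2 * (2 + x + y)) := by
    have h1 : (1 + x) ≠ 0 := by positivity
    have h2 : (1 + y) ≠ 0 := by positivity
    have h3 : (2 + x + y) ≠ 0 := by positivity
    have h4 : (1 + (x / 2 + y / 2)) ≠ 0 := by positivity
    field_simp
    ring
  rw [this]
  positivity

theorem integrable_one_div_one_add {ν : Measure Fading} [IsFiniteMeasure ν] {P : Policy}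
    (hP : P ∈ allocations ν) (k : Fin 2) : Integrable (fun h => 1 / (1 + P k h)) ν := by
  refine Integrable.of_bound
    ((measurable_const.div ((hP k).1.const_add 1)).aestronglyMeasurable) 1 (ae_of_all _ fun h => ?_)
  have := (hP k).2.1 h
  rw [Real.norm_of_nonneg (by positivity), div_le_one (by positivity)]
  linarith

/-- Decreasing convex sets of feasible policies have elements that converge almost surely to a
feasible policy. The elements nearly minimize the convex functional `∑ k, E[1 / (1 + P_k)]`. -/
theorem exists_tendsto_mem_policies {ν : Measure Fading} {Pbar : Fin 2 → ℝ}
    (hν : IsAdmissible ν Pbar) {D : ℕ → Set Policy} (hanti : Antitone D)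
    (hconv : ∀ n, Convex ℝ (D n)) (hne : ∀ n, (D n).Nonempty)
    (hsub : ∀ n, D n ⊆ policies ν Pbar) :
    ∃ (Q : ℕ → Policy), ∃ P ∈ policies ν Pbar, (∀ n, Q n ∈ D n) ∧
      ∀ᵐ h ∂ν, ∀ k, Tendsto (fun n => Q n k h) atTop (𝓝 (P k h)) := by
  have := hν.isProb
  have hA : ∀ n, D n ⊆ allocations ν := fun n => (hsub n).trans policies_subset_allocations
  let ψ : Policy → ℝ := fun P => ∑ k, ∫ h, 1 / (1 + P k h) ∂ν
  have hψ0 : ∀ n, ∀ P ∈ D n, 0 ≤ ψ P := fun n P hP =>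
    Finset.sum_nonneg fun k _ => integral_nonneg fun h => by
      have := (hA n hP k).2.1 h
      positivity
  have hψ2 : ∀ n, ∀ P ∈ D n, ψ P ≤ 2 := by
    intro n P hP
    have : ∀ k, ∫ h, 1 / (1 + P k h) ∂ν ≤ 1 := by
      intro k
      calc ∫ h, 1 / (1 + P k h) ∂ν ≤ ∫ _, (1 : ℝ) ∂ν := by
            refine integral_mono (integrable_one_div_one_add (hA n hP) k)
              (integrable_const _) fun h => ?_
            have := (hA n hP k).2.1 h
            exact div_le_one_of_le₀ (by linarith) (by linarith)
        _ = 1 := by simp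
    calc ψ P ≤ ∑ _k : Fin 2, (1 : ℝ) := Finset.sum_le_sum fun k _ => this k
      _ = 2 := by simp
  -- near-minimizers over smaller and smaller sets form a Cauchy sequence, because the infima `m n`
  -- increase to a limit and the functional is uniformly convex in the variables `1 / (1 + P_k)`
  let m : ℕ → ℝ := fun n => sInf (ψ '' D n)
  have hbdd : ∀ n, BddBelow (ψ '' D n) := fun n => ⟨0, by
    rintro _ ⟨P, hP, rfl⟩
    exact hψ0 n P hP⟩
  have hm_mono : Monotone m := fun a b hab =>
    csInf_le_csInf (hbdd a) ((hne b).image ψ) (Set.image_mono (hanti hab))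
  have hm_bdd : BddAbove (Set.range m) := by
    refine ⟨2, ?_⟩
    rintro _ ⟨n, rfl⟩
    obtain ⟨P, hP⟩ := hne n
    exact (csInf_le (hbdd n) ⟨P, hP, rfl⟩).trans (hψ2 n P hP)
  have hm_lim := tendsto_atTop_ciSup hm_mono hm_bdd
  have hQ : ∀ n : ℕ, ∃ P ∈ D n, ψ P < m n + 1 / ((n : ℝ) + 1) := by
    intro n
    obtain ⟨_, ⟨P, hP, rfl⟩, hlt⟩ := exists_lt_of_csInf_lt ((hne n).image ψ)
      (show sInf (ψ '' D n) < m n + 1 / ((n : ℝ) + 1) from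
        lt_add_of_pos_right _ Nat.one_div_pos_of_nat)
    exact ⟨P, hP, hlt⟩
  choose Q hQD hQψ using hQ
  let f : ℕ → Fading → EuclideanSpace ℝ (Fin 2) :=
    fun n h => WithLp.toLp 2 fun k => 1 / (1 + Q n k h)
  have hQm : ∀ n k, Measurable (Q n k) := fun n k => (hA n (hQD n) k).1
  have hQ0 : ∀ n k h, 0 ≤ Q n k h := fun n k h => (hA n (hQD n) k).2.1 h
  have hfm : ∀ n, AEStronglyMeasurable (f n) ν := by
    intro n
    refine Measurable.aestronglyMeasurable ?_
    refine (WithLp.measurable_toLp 2 (Fin 2 → ℝ)).comp (measurable_pi_lambda _ fun k => ?_)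
    exact measurable_const.div ((hQm n k).const_add 1)
  have hfC : ∀ n h, ‖f n h‖ ≤ 2 := by
    intro n h
    rw [EuclideanSpace.norm_eq, Real.sqrt_le_left (by norm_num), Fin.sum_univ_two]
    have hk : ∀ k, ‖(f n h) k‖ ^ 2 ≤ 1 := by
      intro k
      have h0 := hQ0 n k h
      have h1 : ‖(f n h) k‖ ≤ 1 := by
        change ‖1 / (1 + Q n k h)‖ ≤ 1
        rw [Real.norm_of_nonneg (by positivity), div_le_one (by positivity)]
        linarith
      exact pow_le_one₀ (norm_nonneg _) h1
    linarith [hk 0, hk 1]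
  have hfB : ∀ a b, a ≤ b → ∫ h, ‖f a h - f b h‖ ^ 2 ∂ν ≤
      2 * ((⨆ n, m n) - m a) + 4 * (1 / ((a : ℝ) + 1)) := by
    intro a b hab
    have hmid : (1 / 2 : ℝ) • Q a + (1 / 2 : ℝ) • Q b ∈ D a :=
      hconv a (hQD a) (hanti hab (hQD b)) (by norm_num) (by norm_num) (by norm_num)
    set R := (1 / 2 : ℝ) • Q a + (1 / 2 : ℝ) • Q b with hR
    have hRk : ∀ k h, R k h = Q a k h / 2 + Q b k h / 2 := by
      intro k h
      simp only [hR, Pi.add_apply, Pi.smul_apply, smul_eq_mul]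
      ring
    have hI : ∀ k, Integrable (fun h => (1 / (1 + Q a k h) - 1 / (1 + Q b k h)) ^ 2) ν := by
      intro k
      refine Integrable.of_bound (Measurable.aestronglyMeasurable ?_) 1 (ae_of_all _ fun h => ?_)
      · exact ((measurable_const.div ((hQm a k).const_add 1)).sub
          (measurable_const.div ((hQm b k).const_add 1))).pow_const 2
      · have h1 : 0 ≤ 1 / (1 + Q a k h) := by have := hQ0 a k h; positivity
        have h2 : 0 ≤ 1 / (1 + Q b k h) := by have := hQ0 b k h; positivity
        have h3 : 1 / (1 + Q a k h) ≤ 1 :=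
          div_le_one_of_le₀ (by linarith [hQ0 a k h]) (by linarith [hQ0 a k h])
        have h4 : 1 / (1 + Q b k h) ≤ 1 :=
          div_le_one_of_le₀ (by linarith [hQ0 b k h]) (by linarith [hQ0 b k h])
        rw [Real.norm_of_nonneg (sq_nonneg _), sq_le_one_iff_abs_le_one, abs_le]
        constructor <;> linarith
    have hk : ∀ k, ∫ h, (1 / (1 + Q a k h) - 1 / (1 + Q b k h)) ^ 2 ∂ν ≤
        2 * ∫ h, 1 / (1 + Q a k h) ∂ν + 2 * ∫ h, 1 / (1 + Q b k h) ∂ν -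
          4 * ∫ h, 1 / (1 + R k h) ∂ν := by
      intro k
      have ia := integrable_one_div_one_add (hA a (hQD a)) k
      have ib := integrable_one_div_one_add (hA b (hQD b)) k
      have ir := integrable_one_div_one_add (hA a hmid) k
      rw [← integral_const_mul, ← integral_const_mul, ← integral_const_mul,
        ← integral_add' (ia.const_mul 2) (ib.const_mul 2),
        ← integral_sub' ((ia.const_mul 2).add (ib.const_mul 2)) (ir.const_mul 4)]
      refine integral_mono (hI k) (((ia.const_mul 2).add (ib.const_mul 2)).sub (ir.const_mul 4))
        fun h => ?_
      have := one_div_one_add_midpoint_le (hQ0 a k h) (hQ0 b k h)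
      simp only [Pi.add_apply, Pi.sub_apply, hRk]
      linarith
    have hsum : ∫ h, ‖f a h - f b h‖ ^ 2 ∂ν =
        ∑ k, ∫ h, (1 / (1 + Q a k h) - 1 / (1 + Q b k h)) ^ 2 ∂ν := by
      rw [← integral_finsetSum _ fun k _ => hI k]
      refine integral_congr_ae (ae_of_all _ fun h => ?_)
      simp only [EuclideanSpace.norm_sq_eq]
      refine Finset.sum_congr rfl fun k _ => ?_
      rw [Real.norm_eq_abs, sq_abs]
      rfl
    have h1 : ∑ k, ∫ h, (1 / (1 + Q a k h) - 1 / (1 + Q b k h)) ^ 2 ∂ν ≤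
        2 * ψ (Q a) + 2 * ψ (Q b) - 4 * ψ R := by
      simp only [ψ, Finset.mul_sum, ← Finset.sum_add_distrib, ← Finset.sum_sub_distrib]
      exact Finset.sum_le_sum fun k _ => hk k
    have h2 : m a ≤ ψ R := csInf_le (hbdd a) ⟨R, hmid, rfl⟩
    have h3 : m b ≤ ⨆ n, m n := le_ciSup hm_bdd b
    have h4 : 1 / ((b : ℝ) + 1) ≤ 1 / ((a : ℝ) + 1) := Nat.one_div_le_one_div hab
    rw [hsum]
    linarith [hQψ a, hQψ b]
  have hB : Tendsto (fun a : ℕ => 2 * ((⨆ n, m n) - m a) + 4 * (1 / ((a : ℝ) + 1))) atTop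
      (𝓝 0) := by
    have := ((tendsto_const_nhds (x := ⨆ n, m n)).sub hm_lim).const_mul 2
    have h2 := (tendsto_one_div_add_atTop_nhds_zero_nat (𝕜 := ℝ)).const_mul 4
    simpa using this.add h2
  obtain ⟨g, ns, hg, hns, hlim⟩ := exists_subseq_tendsto_of_integral_sq_le hfm hfC hB hfB
  have hgk : ∀ k, Measurable fun h => g h k := fun k =>
    (measurable_pi_apply k).comp ((WithLp.measurable_ofLp 2 (Fin 2 → ℝ)).comp hg.measurable)
  have hlimk : ∀ᵐ h ∂ν, ∀ k,
      Tendsto (fun i => 1 / (1 + Q (ns i) k h)) atTop (𝓝 (g h k)) := by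
    filter_upwards [hlim] with h hh k
    exact (((EuclideanSpace.proj (𝕜 := ℝ) k).continuous.tendsto (g h)).comp hh)
  -- where `1 / (1 + P_k)` tends to zero the powers explode, which Fatou's lemma forbids
  have hfatou : ∀ k, ∫⁻ h, liminf (fun i => ENNReal.ofReal (Q (ns i) k h)) atTop ∂ν ≤
      ENNReal.ofReal (Pbar k) := by
    intro k
    refine (lintegral_liminf_le fun i => (hQm (ns i) k).ennreal_ofReal).trans ?_
    refine (liminf_le_liminf (v := fun _ => ENNReal.ofReal (Pbar k))
      (Eventually.of_forall fun i => ?_)).trans (le_of_eq (liminf_const _))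
    have hi := hsub _ (hQD (ns i)) k
    change ∫⁻ h, ENNReal.ofReal (Q (ns i) k h) ∂ν ≤ _
    rw [← ofReal_integral_eq_lintegral_ofReal hi.2.2.1 (ae_of_all _ hi.2.1)]
    exact ENNReal.ofReal_le_ofReal hi.2.2.2
  have hfin : ∀ᵐ h ∂ν, ∀ k, liminf (fun i => ENNReal.ofReal (Q (ns i) k h)) atTop < ⊤ := by
    rw [ae_all_iff]
    intro k
    exact ae_lt_top (Measurable.liminf fun i => (hQm (ns i) k).ennreal_ofReal)
      ((hfatou k).trans_lt ENNReal.ofReal_lt_top).ne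
  let P : Policy := fun k h => max (1 / g h k - 1) 0
  have hPlim : ∀ᵐ h ∂ν, ∀ k, Tendsto (fun i => Q (ns i) k h) atTop (𝓝 (P k h)) := by
    filter_upwards [hlimk, hfin] with h h1 h2 k
    have hinv : ∀ i, 1 / (1 / (1 + Q (ns i) k h)) - 1 = Q (ns i) k h := by
      intro i
      rw [one_div_one_div]
      ring
    have hge : 0 ≤ g h k := ge_of_tendsto' (h1 k) fun i => by
      have := hQ0 (ns i) k h
      positivity
    rcases hge.eq_or_lt with h0 | hpos
    · exfalso
      have ht : Tendsto (fun i => Q (ns i) k h) atTop atTop := by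
        have h3 : Tendsto (fun i => 1 / (1 + Q (ns i) k h)) atTop (𝓝[>] 0) := by
          refine tendsto_nhdsWithin_iff.2 ⟨by rw [h0]; exact h1 k, Eventually.of_forall fun i => ?_⟩
          have := hQ0 (ns i) k h
          exact Set.mem_Ioi.2 (by positivity)
        have h4 := tendsto_atTop_add_const_right _ (-1 : ℝ) h3.inv_tendsto_nhdsGT_zero
        refine h4.congr fun i => ?_
        simp
      have := (ENNReal.tendsto_ofReal_atTop.comp ht).liminf_eq
      exact (h2 k).ne this
    · have h3 : Tendsto (fun i => Q (ns i) k h) atTop (𝓝 (1 / g h k - 1)) := by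
        have := ((tendsto_const_nhds (x := (1 : ℝ))).div (h1 k) hpos.ne').sub_const 1
        exact this.congr hinv
      have h4 : 0 ≤ 1 / g h k - 1 := ge_of_tendsto' h3 fun i => hQ0 (ns i) k h
      change Tendsto _ _ (𝓝 (max (1 / g h k - 1) 0))
      rwa [max_eq_left h4]
  refine ⟨fun n => Q (ns n), P, fun k => ?_, fun n => hanti (hns.id_le n) (hQD (ns n)), hPlim⟩
  have hPm : Measurable (P k) := ((measurable_const.div (hgk k)).sub_const 1).max measurable_const
  have hP0 : ∀ h, 0 ≤ P k h := fun h => le_max_right _ _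
  have hPint : ∫⁻ h, ENNReal.ofReal (P k h) ∂ν ≤ ENNReal.ofReal (Pbar k) := by
    refine le_trans (le_of_eq (lintegral_congr_ae ?_)) (hfatou k)
    filter_upwards [hPlim] with h hh
    exact ((ENNReal.tendsto_ofReal (hh k)).liminf_eq).symm
  have hPi : Integrable (P k) ν :=
    ⟨hPm.aestronglyMeasurable, (hasFiniteIntegral_iff_ofReal (ae_of_all _ hP0)).2
      (hPint.trans_lt ENNReal.ofReal_lt_top)⟩
  refine ⟨hPm, hP0, hPi, ?_⟩
  rw [← ofReal_integral_eq_lintegral_ofReal hPi (ae_of_all _ hP0)] at hPint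
  exact (ENNReal.ofReal_le_ofReal_iff (hν.power_pos k).le).1 hPint

/-- The policy `P` with its powers cut off at `M`. -/
def truncate (M : ℝ) (P : Policy) : Policy := fun k h => min (P k h) M

theorem truncate_mem {ν : Measure Fading} {P : Policy} (hP : P ∈ allocations ν) {M : ℝ}
    (hM : 0 ≤ M) : truncate M P ∈ allocations ν := by
  intro k
  have hm : Measurable (truncate M P k) := (hP k).1.min measurable_const
  have h0 : ∀ h, 0 ≤ truncate M P k h := fun h => le_min ((hP k).2.1 h) hM
  refine ⟨hm, h0, (hP k).2.2.mono' hm.aestronglyMeasurable (ae_of_all _ fun h => ?_)⟩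
  rw [Real.norm_of_nonneg (h0 h)]
  exact min_le_left _ _

/-- Cutting off the powers at `M` costs at most `(P₁ + P₂) / M`, because
`log (x / M) ≤ x / M`. -/
theorem log_received_le_truncate (j : Fin 2) (S : Finset (Fin 2)) (h : Fading) {P : Policy}
    (hP : ∀ k, 0 ≤ P k h) {M : ℝ} (hM : 0 < M) :
    Real.log (1 + received j S h (powers P h)) ≤
      Real.log (1 + received j S h (powers (truncate M P) h)) + (P 0 h + P 1 h) / M := by
  have hT : ∀ k, 0 ≤ powers (truncate M P) h k := fun k => le_min (hP k) hM.le
  have hr := received_nonneg j S h hT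
  set t := 1 + (P 0 h + P 1 h) / M with ht
  have h01 : 0 ≤ (P 0 h + P 1 h) / M := div_nonneg (add_nonneg (hP 0) (hP 1)) hM.le
  have hsum : ∀ k, P k h ≤ P 0 h + P 1 h :=
    Fin.forall_fin_two.2 ⟨by linarith [hP 1], by linarith [hP 0]⟩
  have htk : ∀ k, P k h ≤ t * min (P k h) M := by
    intro k
    have hk := hsum k
    rcases le_total (P k h) M with h1 | h1
    · rw [min_eq_left h1, ht]
      nlinarith [hP k]
    · rw [min_eq_right h1, ht, add_mul, div_mul_cancel₀ _ hM.ne']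
      linarith
  have hle : 1 + received j S h (powers P h) ≤
      t * (1 + received j S h (powers (truncate M P) h)) := by
    have h2 : received j S h (powers P h) ≤
        t * received j S h (powers (truncate M P) h) := by
      unfold received
      rw [Finset.mul_sum]
      refine Finset.sum_le_sum fun k _ => ?_
      calc gain j k h * powers P h k ≤ gain j k h * (t * min (P k h) M) :=
            mul_le_mul_of_nonneg_left (htk k) (gain_nonneg j k h)
        _ = t * (gain j k h * powers (truncate M P) h k) := by
            simp only [powers, truncate]
            ring
    linarith
  have h0 := received_nonneg j S h (p := powers P h) hP
  calc _ ≤ Real.log (t * (1 + received j S h (powers (truncate M P) h))) :=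
        Real.log_le_log (by linarith) hle
    _ = Real.log t + Real.log (1 + received j S h (powers (truncate M P) h)) :=
        Real.log_mul (by positivity) (by positivity)
    _ ≤ _ := by linarith [Real.log_le_sub_one_of_pos (show 0 < t by positivity)]

theorem rate_le_truncate {ν : Measure Fading} {Pbar : Fin 2 → ℝ} (hν : IsAdmissible ν Pbar)
    {P : Policy} (hP : P ∈ policies ν Pbar) (j : Fin 2) (S : Finset (Fin 2)) {M : ℝ}
    (hM : 0 < M) :
    rate ν P j S ≤
      rate ν (truncate M P) j S + (Pbar 0 + Pbar 1) / Real.log 2 / M := by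
  have hPa := policies_subset_allocations hP
  have hi := integrable_log_received hν (truncate_mem hPa hM.le) j S
  have hi2 : Integrable (fun h => (P 0 h + P 1 h) / M) ν :=
    ((hP 0).2.2.1.add (hP 1).2.2.1).div_const M
  rw [rate_eq, rate_eq, div_right_comm, ← add_div]
  refine div_le_div_of_nonneg_right ?_ log_two_pos.le
  calc _ ≤ ∫ h, (Real.log (1 + received j S h (powers (truncate M P) h)) +
          (P 0 h + P 1 h) / M) ∂ν :=
        integral_mono (integrable_log_received hν hPa j S) (hi.add hi2)
          fun h => log_received_le_truncate j S h (fun k => (hP k).2.1 h) hM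
    _ = _ := integral_add hi hi2
    _ ≤ _ := by
        rw [integral_div, integral_add (hP 0).2.2.1 (hP 1).2.2.1]
        have h0 := (hP 0).2.2.2
        have h1 := (hP 1).2.2.2
        gcongr

theorem rate_mono {ν : Measure Fading} {Pbar : Fin 2 → ℝ} (hν : IsAdmissible ν Pbar)
    {P Q : Policy} (hP : P ∈ allocations ν) (hQ : Q ∈ allocations ν)
    (hPQ : ∀ k h, P k h ≤ Q k h) (j : Fin 2) (S : Finset (Fin 2)) :
    rate ν P j S ≤ rate ν Q j S := by
  rw [rate_eq, rate_eq]
  refine div_le_div_of_nonneg_right ?_ log_two_pos.le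
  refine integral_mono (integrable_log_received hν hP j S) (integrable_log_received hν hQ j S)
    fun h => ?_
  have h0 := received_nonneg j S h (p := powers P h) fun k => (hP k).2.1 h
  refine Real.log_le_log (by linarith) ?_
  gcongr
  exact Finset.sum_le_sum fun k _ => mul_le_mul_of_nonneg_left (hPQ k h) (gain_nonneg j k h)

/-- The rates are upper semicontinuous along almost surely convergent feasible policies. The powers
need not be uniformly integrable, so the limit is taken for the truncated policies first, whose loss
is uniformly small. -/
theorem le_mixedRate_of_tendsto {ν : Measure Fading} {Pbar : Fin 2 → ℝ}
    (hν : IsAdmissible ν Pbar) {Q : ℕ → Policy} {P : Policy}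
    (hQ : ∀ n, Q n ∈ policies ν Pbar) (hP : P ∈ policies ν Pbar)
    (hlim : ∀ᵐ h ∂ν, ∀ k, Tendsto (fun n => Q n k h) atTop (𝓝 (P k h)))
    {c : Coef} (hc : ∀ j S, 0 ≤ c j S) {s : ℕ → ℝ} {v : ℝ} (hs : Tendsto s atTop (𝓝 v))
    (hsQ : ∀ n, s n ≤ mixedRate ν c (Q n)) : v ≤ mixedRate ν c P := by
  have := hν.isProb
  have hQa : ∀ n, Q n ∈ allocations ν := fun n => policies_subset_allocations (hQ n)
  have hPa := policies_subset_allocations hP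
  have htr : ∀ M : ℝ, 0 < M → ∀ j S,
      Tendsto (fun n => rate ν (truncate M (Q n)) j S) atTop (𝓝 (rate ν (truncate M P) j S)) := by
    intro M hM j S
    simp only [rate_eq]
    refine Tendsto.div_const ?_ _
    refine tendsto_integral_of_dominated_convergence
      (fun h => ∑ k, (Real.log (1 + gain j k h) + M))
      (fun n => (integrable_log_received hν (truncate_mem (hQa n) hM.le) j S).1)
      (integrable_finsetSum _ fun k _ => (hν.log_integrable j k).add (integrable_const M))
      (fun n => ae_of_all _ fun h => ?_) ?_
    · have hT : ∀ k, 0 ≤ powers (truncate M (Q n)) h k := fun k => le_min ((hQ n k).2.1 h) hM.le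
      have h0 := received_nonneg j S h hT
      rw [Real.norm_of_nonneg (Real.log_nonneg (by linarith))]
      refine (log_received_le j S h hT).trans (Finset.sum_le_sum fun k _ => ?_)
      gcongr
      exact min_le_right _ _
    · filter_upwards [hlim] with h hh
      have h0 := received_nonneg j S h (p := powers (truncate M P) h)
        fun k => le_min ((hP k).2.1 h) hM.le
      refine Tendsto.log (Tendsto.const_add 1 ?_) (by linarith)
      refine tendsto_finsetSum _ fun k _ => Tendsto.const_mul _ ?_
      exact (hh k).min tendsto_const_nhds
  set K := (∑ j, ∑ S, c j S) * ((Pbar 0 + Pbar 1) / Real.log 2) with hK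
  have hM : ∀ M : ℝ, 0 < M → v ≤ mixedRate ν c P + K / M := by
    intro M hM
    have hle : ∀ n, s n ≤ mixedRate ν c (truncate M (Q n)) + K / M := by
      intro n
      refine (hsQ n).trans ?_
      rw [hK, Finset.sum_mul, Finset.sum_div, mixedRate, mixedRate, ← Finset.sum_add_distrib]
      refine Finset.sum_le_sum fun j _ => ?_
      rw [Finset.sum_mul, Finset.sum_div, ← Finset.sum_add_distrib]
      refine Finset.sum_le_sum fun S _ => ?_
      rw [mul_div_assoc, ← mul_add]
      exact mul_le_mul_of_nonneg_left (rate_le_truncate hν (hQ n) j S hM) (hc j S)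
    have hl : Tendsto (fun n => mixedRate ν c (truncate M (Q n)) + K / M) atTop
        (𝓝 (mixedRate ν c (truncate M P) + K / M)) := by
      refine Tendsto.add_const _ ?_
      exact tendsto_finsetSum _ fun j _ => tendsto_finsetSum _ fun S _ =>
        (htr M hM j S).const_mul _
    refine (le_of_tendsto_of_tendsto' hs hl hle).trans ?_
    gcongr
    refine Finset.sum_le_sum fun j _ => Finset.sum_le_sum fun S _ => ?_
    refine mul_le_mul_of_nonneg_left ?_ (hc j S)
    exact rate_mono hν (truncate_mem hPa hM.le) hPa (fun k h => min_le_left _ _) j S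
  have hlimM : Tendsto (fun M : ℝ => mixedRate ν c P + K / M) atTop (𝓝 (mixedRate ν c P)) := by
    simpa using (tendsto_const_nhds (x := mixedRate ν c P)).add (tendsto_const_nhds.div_atTop
      tendsto_id)
  exact ge_of_tendsto hlimM ((eventually_gt_atTop 0).mono hM)

/-- The smallest of finitely many mixtures of rates attains its maximum over the feasible
policies: the superlevel sets of the minimum are convex and decreasing, so that
`exists_tendsto_mem_policies` provides a convergent maximizing sequence. -/
theorem exists_forall_inf_mixedRate_le {ν : Measure Fading} {Pbar : Fin 2 → ℝ}
    (hν : IsAdmissible ν Pbar) {ι : Type*} {s : Finset ι} (hs : s.Nonempty) {C : ι → Coef}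
    (hC : ∀ i j S, 0 ≤ C i j S) :
    ∃ P ∈ policies ν Pbar, ∀ Q ∈ policies ν Pbar,
      s.inf' hs (fun i => mixedRate ν (C i) Q) ≤ s.inf' hs (fun i => mixedRate ν (C i) P) := by
  set F : Policy → ℝ := fun Q => s.inf' hs fun i => mixedRate ν (C i) Q with hF
  have hbdd : BddAbove (F '' policies ν Pbar) := by
    obtain ⟨i, hi⟩ := hs
    refine ⟨∑ j, ∑ S, C i j S *
      ((∑ k, ((∫ h, Real.log (1 + gain j k h) ∂ν) + Pbar k)) / Real.log 2), ?_⟩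
    rintro _ ⟨Q, hQ, rfl⟩
    refine (Finset.inf'_le _ hi).trans ?_
    exact Finset.sum_le_sum fun j _ => Finset.sum_le_sum fun S _ =>
      mul_le_mul_of_nonneg_left (rate_le hν hQ j S) (hC i j S)
  have hne : (F '' policies ν Pbar).Nonempty := ⟨_, 0, zero_mem_policies hν, rfl⟩
  set v := sSup (F '' policies ν Pbar) with hv
  let D : ℕ → Set Policy := fun n =>
    {Q | Q ∈ policies ν Pbar ∧ ∀ i ∈ s, v - 1 / ((n : ℝ) + 1) ≤ mixedRate ν (C i) Q}
  have hDanti : Antitone D := fun a b hab Q hQ => ⟨hQ.1, fun i hi =>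
    le_trans (sub_le_sub_left (Nat.one_div_le_one_div hab) v) (hQ.2 i hi)⟩
  have hDconv : ∀ n, Convex ℝ (D n) := by
    intro n P hP Q hQ a b ha hb hab
    refine ⟨convex_policies ν Pbar hP.1 hQ.1 ha hb hab, fun i hi => ?_⟩
    have := (mixedRate_concaveOn hν (hC i)).2 (policies_subset_allocations hP.1)
      (policies_subset_allocations hQ.1) ha hb hab
    refine le_trans ?_ this
    simp only [smul_eq_mul]
    calc v - 1 / ((n : ℝ) + 1) = a * (v - 1 / ((n : ℝ) + 1)) + b * (v - 1 / ((n : ℝ) + 1)) := by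
          rw [← add_mul, hab, one_mul]
      _ ≤ _ := by
          have h1 := hP.2 i hi
          have h2 := hQ.2 i hi
          gcongr
  have hDne : ∀ n, (D n).Nonempty := by
    intro n
    obtain ⟨_, ⟨Q, hQ, rfl⟩, hlt⟩ := exists_lt_of_lt_csSup hne
      (show v - 1 / ((n : ℝ) + 1) < v from sub_lt_self _ Nat.one_div_pos_of_nat)
    exact ⟨Q, hQ, fun i hi => hlt.le.trans (Finset.inf'_le _ hi)⟩
  obtain ⟨Q, P, hP, hQ, hlim⟩ :=
    exists_tendsto_mem_policies hν hDanti hDconv hDne fun n _ hQ => hQ.1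
  refine ⟨P, hP, fun R hR => (le_csSup hbdd ⟨R, hR, rfl⟩).trans ?_⟩
  refine Finset.le_inf' _ _ fun i hi => ?_
  refine le_mixedRate_of_tendsto hν (fun n => (hQ n).1) hP hlim (hC i)
    (s := fun n : ℕ => v - 1 / ((n : ℝ) + 1)) ?_ fun n => (hQ n).2 i hi
  simpa using (tendsto_const_nhds (x := v)).sub
    (tendsto_one_div_add_atTop_nhds_zero_nat (𝕜 := ℝ))

/-! ### Lagrange multipliers -/

/-- The theorem of the alternative for concave functions: if at no point of `X` all the functions
`Φ a`, `a ∈ s`, are positive, then some convex combination of them is nowhere positive. -/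
theorem exists_weights_of_forall_exists_nonpos {E κ : Type*} [AddCommGroup E] [Module ℝ E]
    [Fintype κ] {X : Set E} (hX : X.Nonempty) {Φ : κ → E → ℝ} (hΦ : ∀ a, ConcaveOn ℝ X (Φ a))
    {s : Finset κ} (h : ∀ x ∈ X, ∃ a ∈ s, Φ a x ≤ 0) :
    ∃ θ : κ → ℝ, (∀ a, 0 ≤ θ a) ∧ (∀ a, a ∉ s → θ a = 0) ∧ ∑ a, θ a = 1 ∧
      ∀ x ∈ X, ∑ a, θ a * Φ a x ≤ 0 := by
  classical
  -- separate the origin from the open convex set of vectors that lie below some `Φ · x` on `s`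
  let C : Set (κ → ℝ) := {v | ∃ x ∈ X, ∀ a ∈ s, v a < Φ a x}
  have hCopen : IsOpen C := by
    have : C = ⋃ x ∈ X, ⋂ a ∈ s, {v : κ → ℝ | v a < Φ a x} := by
      ext v
      simp [C]
    rw [this]
    refine isOpen_biUnion fun x _ => isOpen_biInter_finset fun a _ => ?_
    exact isOpen_lt (continuous_apply a) continuous_const
  have hCconv : Convex ℝ C := by
    rintro v ⟨x, hx, hv⟩ w ⟨y, hy, hw⟩ a b ha hb hab
    obtain ⟨a₀, ha₀, -⟩ := h x hx
    refine ⟨a • x + b • y, (hΦ a₀).1 hx hy ha hb hab, fun i hi => ?_⟩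
    refine lt_of_lt_of_le ?_ ((hΦ i).2 hx hy ha hb hab)
    simp only [Pi.add_apply, Pi.smul_apply, smul_eq_mul]
    rcases ha.eq_or_lt with rfl | ha'
    · rw [zero_add] at hab
      simpa [hab] using hw i hi
    · have := mul_lt_mul_of_pos_left (hv i hi) ha'
      have := mul_le_mul_of_nonneg_left (hw i hi).le hb
      linarith
  have h0 : (0 : κ → ℝ) ∉ C := by
    rintro ⟨x, hx, hv⟩
    obtain ⟨a, ha, hle⟩ := h x hx
    exact absurd (hv a ha) (not_lt.2 hle)
  obtain ⟨f, hf⟩ := geometric_hahn_banach_open_point hCconv hCopen h0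
  rw [map_zero] at hf
  let η : κ → ℝ := fun a => f (Pi.single a 1)
  have hfη : ∀ v : κ → ℝ, f v = ∑ a, η a * v a := by
    intro v
    conv_lhs => rw [← Finset.univ_sum_single v]
    rw [map_sum]
    refine Finset.sum_congr rfl fun a _ => ?_
    have : (Pi.single a (v a) : κ → ℝ) = v a • Pi.single a 1 := by
      rw [← Pi.single_smul, smul_eq_mul, mul_one]
    rw [this, map_smul, smul_eq_mul, mul_comm]
  obtain ⟨x₀, hx₀⟩ := hX
  let v₀ : κ → ℝ := fun a => Φ a x₀ - 1
  have hmove : ∀ a t, (a ∈ s → 0 ≤ t) → f v₀ - t * η a < 0 := by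
    intro a t hat
    have hmem : v₀ - t • Pi.single a 1 ∈ C := by
      refine ⟨x₀, hx₀, fun b hb => ?_⟩
      by_cases hba : b = a
      · subst hba
        have := hat hb
        simp only [v₀, Pi.sub_apply, Pi.smul_apply, Pi.single_eq_same, smul_eq_mul]
        linarith
      · simp [v₀, hba]
    have := hf _ hmem
    rwa [map_sub, map_smul, smul_eq_mul] at this
  have hv₀ : f v₀ < 0 := by
    have := hf v₀ ⟨x₀, hx₀, fun a _ => by simp [v₀]⟩
    exact this
  have hη : ∀ a, 0 ≤ η a := by
    intro a
    by_contra! hneg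
    have := hmove a (f v₀ / η a) fun _ => (div_pos_of_neg_of_neg hv₀ hneg).le
    rw [div_mul_cancel₀ _ hneg.ne] at this
    linarith
  have hηs : ∀ a, a ∉ s → η a = 0 := by
    intro a ha
    by_contra hne
    have := hmove a (f v₀ / η a) fun h => absurd h ha
    rw [div_mul_cancel₀ _ hne] at this
    linarith
  have hηpos : 0 < ∑ a, η a := by
    refine (Finset.sum_nonneg fun a _ => hη a).lt_of_ne fun h0 => ?_
    have h1 := (Finset.sum_eq_zero_iff_of_nonneg fun a _ => hη a).1 h0.symm
    rw [hfη] at hv₀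
    have : ∑ a, η a * v₀ a = 0 := Finset.sum_eq_zero fun a ha => by rw [h1 a ha, zero_mul]
    linarith
  have hηX : ∀ x ∈ X, ∑ a, η a * Φ a x ≤ 0 := by
    intro x hx
    refine le_of_forall_pos_le_add fun ε hε => ?_
    have hmem : (fun a => Φ a x - ε / ∑ a, η a) ∈ C :=
      ⟨x, hx, fun a _ => sub_lt_self _ (div_pos hε hηpos)⟩
    have := hf _ hmem
    rw [hfη] at this
    simp only [mul_sub, Finset.sum_sub_distrib, ← Finset.sum_mul] at this
    rw [mul_div_cancel₀ _ hηpos.ne'] at this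
    linarith
  refine ⟨fun a => η a / ∑ a, η a, fun a => div_nonneg (hη a) hηpos.le,
    fun a ha => by simp [hηs a ha], ?_, fun x hx => ?_⟩
  · rw [← Finset.sum_div, div_self hηpos.ne']
  · have : ∑ a, η a / (∑ a, η a) * Φ a x = (∑ a, η a * Φ a x) / ∑ a, η a := by
      rw [Finset.sum_div]
      exact Finset.sum_congr rfl fun a _ => by ring
    rw [this]
    exact div_nonpos_of_nonpos_of_nonneg (hηX x hx) hηpos.le

/-! ### Stationary policies -/

/-- The stationarity conditions for the mixture of rates with coefficients `c` and the power
prices `l`. -/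
def IsStationary (ν : Measure Fading) (c : Coef) (l : Fin 2 → ℝ) (P : Policy) : Prop :=
  ∀ᵐ h ∂ν, ∀ k, slope c h (powers P h) k ≤ l k ∧
    (0 < P k h → slope c h (powers P h) k = l k)

theorem measurable_slope (c : Coef) {P : Policy} (hP : ∀ k, Measurable (P k)) (k : Fin 2) :
    Measurable fun h => slope c h (powers P h) k := by
  unfold slope
  refine Finset.measurable_sum _ fun j _ => Finset.measurable_sum _ fun S _ => ?_
  split_ifs
  · exact ((measurable_gain j k).div ((measurable_received j S hP).const_add 1)).const_mul _
  · exact measurable_const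

theorem continuousAt_slope (c : Coef) (h : Fading) {p : Fin 2 → ℝ} (hp : ∀ k, 0 ≤ p k)
    (k : Fin 2) : ContinuousAt (fun q => slope c h q k) p := by
  unfold slope
  refine tendsto_finsetSum _ fun j _ => tendsto_finsetSum _ fun S _ => ?_
  split_ifs
  · have hr : Continuous fun q : Fin 2 → ℝ => received j S h q := by
      unfold received
      fun_prop
    have := received_nonneg j S h hp
    exact ((tendsto_const_nhds).div ((hr.tendsto p).const_add 1) (by linarith)).const_mul _
  · exact tendsto_const_nhds

theorem powers_update (P : Policy) (k : Fin 2) (f : Fading → ℝ) (h : Fading) :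
    powers (Function.update P k f) h = Function.update (powers P h) k (f h) := by
  funext i
  by_cases hi : i = k
  · subst hi
    simp [powers]
  · simp [powers, hi]

/-- A maximizer of the Lagrangian is stationary: otherwise changing the power of one user by a
small constant on a set of positive measure would increase the Lagrangian. -/
theorem isStationary_of_forall_lagrangian_le {ν : Measure Fading} {Pbar : Fin 2 → ℝ}
    (hν : IsAdmissible ν Pbar) {c : Coef} (hc : ∀ j S, 0 ≤ c j S) {l : Fin 2 → ℝ} {P : Policy}
    (hP : P ∈ allocations ν)
    (hmax : ∀ Q ∈ allocations ν, mixedRate ν c Q - ∑ k, l k * ∫ h, Q k h ∂ν ≤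
      mixedRate ν c P - ∑ k, l k * ∫ h, P k h ∂ν) :
    IsStationary ν c (fun k => Real.log 2 * l k) P := by
  have := hν.isProb
  -- the slope at the changed power bounds the gain from below, by concavity
  have key : ∀ k (δ : ℝ), ∀ᵐ h ∂ν, 0 ≤ P k h + δ →
      (slope c h (Function.update (powers P h) k (P k h + δ)) k - Real.log 2 * l k) * δ ≤ 0 := by
    intro k δ
    have hRm : ∀ i, Measurable (Function.update P k (fun h => P k h + δ) i) := by
      intro i
      by_cases hi : i = k
      · subst hi
        simpa using (hP i).1.add_const δ
      · simpa [hi] using (hP i).1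
    set s : Fading → ℝ :=
      fun h => slope c h (Function.update (powers P h) k (P k h + δ)) k with hs
    have hsm : Measurable s := by
      have := measurable_slope c hRm k
      simpa only [powers_update] using this
    set E : Set Fading := {h | 0 ≤ P k h + δ ∧ 0 < (s h - Real.log 2 * l k) * δ} with hE
    have hEm : MeasurableSet E :=
      (measurableSet_le measurable_const ((hP k).1.add_const δ)).inter
        (measurableSet_lt measurable_const ((hsm.sub_const _).mul_const δ))
    set f : Fading → ℝ := fun h => P k h + E.indicator (fun _ => δ) h with hf
    set Q : Policy := Function.update P k f with hQ
    have hfi : Integrable f ν := (hP k).2.2.add ((integrable_const δ).indicator hEm)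
    have hf0 : ∀ h, 0 ≤ f h := by
      intro h
      by_cases hh : h ∈ E
      · simpa [hf, hh] using hh.1
      · simpa [hf, hh] using (hP k).2.1 h
    have hQk : Q k = f := by simp [hQ]
    have hQi : ∀ i, i ≠ k → Q i = P i := fun i hi => by simp [hQ, hi]
    have hQmem : Q ∈ allocations ν := by
      intro i
      by_cases hi : i = k
      · subst hi
        rw [hQk]
        exact ⟨(hP i).1.add (measurable_const.indicator hEm), hf0, hfi⟩
      · rw [hQi i hi]
        exact hP i
    set D : Fading → ℝ := fun h => logSum c h (powers Q h) - logSum c h (powers P h) -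
      Real.log 2 * l k * E.indicator (fun _ => δ) h with hD
    have hDE : ∀ h ∈ E, 0 < D h := by
      intro h hh
      have hpow : powers Q h = Function.update (powers P h) k (P k h + δ) := by
        rw [hQ, powers_update]
        simp [hf, hh]
      have ht := logSum_le_tangent hc h (p := powers Q h) (q := powers P h)
        (fun i => (hQmem i).2.1 h) (fun i => (hP i).2.1 h)
      rw [Finset.sum_eq_single k] at ht
      · have h1 : slope c h (powers Q h) k = s h := by rw [hs, hpow]
        have h2 : powers P h k - powers Q h k = -δ := by
          rw [hpow, Function.update_self]
          simp [powers]
        rw [h1, h2] at ht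
        simp only [hD, Set.indicator_of_mem hh]
        have := hh.2
        linarith
      · intro i _ hi
        rw [hpow, Function.update_of_ne hi]
        simp
      · simp
    have hDn : ∀ h, h ∉ E → D h = 0 := by
      intro h hh
      have hpow : powers Q h = powers P h := by
        rw [hQ, powers_update]
        have : f h = powers P h k := by simp [hf, hh, powers]
        rw [this, Function.update_eq_self]
      simp [hD, hpow, hh]
    have hD0 : ∀ h, 0 ≤ D h := fun h => by
      by_cases hh : h ∈ E
      · exact (hDE h hh).le
      · exact (hDn h hh).ge
    have iQ := integrable_logSum hν hQmem c
    have iP := integrable_logSum hν hP c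
    have iE : Integrable (fun h => Real.log 2 * l k * E.indicator (fun _ => δ) h) ν :=
      ((integrable_const δ).indicator hEm).const_mul _
    have hDi : Integrable D ν := (iQ.sub iP).sub iE
    have hDint : ∫ h, D h ∂ν ≤ 0 := by
      have h1 : ∫ h, D h ∂ν = Real.log 2 * mixedRate ν c Q - Real.log 2 * mixedRate ν c P -
          Real.log 2 * l k * ∫ h, E.indicator (fun _ => δ) h ∂ν := by
        rw [← integral_logSum hν hQmem, ← integral_logSum hν hP, ← integral_const_mul,
          ← integral_sub' iQ iP, ← integral_sub' (iQ.sub iP) iE]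
        rfl
      have h2 : ∫ h, Q k h ∂ν = ∫ h, P k h ∂ν + ∫ h, E.indicator (fun _ => δ) h ∂ν := by
        rw [hQk, ← integral_add (hP k).2.2 ((integrable_const δ).indicator hEm)]
      have h3 := hmax Q hQmem
      have h4 : ∑ i, l i * ∫ h, Q i h ∂ν - ∑ i, l i * ∫ h, P i h ∂ν =
          l k * ∫ h, E.indicator (fun _ => δ) h ∂ν := by
        rw [← Finset.sum_sub_distrib, Finset.sum_eq_single k]
        · rw [h2]
          ring
        · intro i _ hi
          rw [hQi i hi]
          ring
        · simp
      rw [h1]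
      nlinarith [log_two_pos]
    have hDz : D =ᵐ[ν] 0 := (integral_eq_zero_iff_of_nonneg hD0 hDi).1
      (le_antisymm hDint (integral_nonneg hD0))
    filter_upwards [hDz] with h hh h0
    by_contra! hpos
    exact (hDE h ⟨h0, hpos⟩).ne' hh
  -- let the change `δ` tend to zero from both sides along countably many values
  have hplus : ∀ᵐ h ∂ν, ∀ k (n : ℕ), 0 ≤ P k h + 1 / ((n : ℝ) + 1) →
      (slope c h (Function.update (powers P h) k (P k h + 1 / ((n : ℝ) + 1))) k -
        Real.log 2 * l k) * (1 / ((n : ℝ) + 1)) ≤ 0 := by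
    rw [ae_all_iff]
    intro k
    rw [ae_all_iff]
    exact fun n => key k _
  have hminus : ∀ᵐ h ∂ν, ∀ k (n : ℕ), 0 ≤ P k h + -(1 / ((n : ℝ) + 1)) →
      (slope c h (Function.update (powers P h) k (P k h + -(1 / ((n : ℝ) + 1)))) k -
        Real.log 2 * l k) * -(1 / ((n : ℝ) + 1)) ≤ 0 := by
    rw [ae_all_iff]
    intro k
    rw [ae_all_iff]
    exact fun n => key k _
  filter_upwards [hplus, hminus] with h h1 h2 k
  have hcont : Tendsto (fun t => slope c h (Function.update (powers P h) k t) k)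
      (𝓝 (P k h)) (𝓝 (slope c h (powers P h) k)) := by
    have hu : Continuous fun t : ℝ => Function.update (powers P h) k t :=
      continuous_const.update k continuous_id
    have h3 : Function.update (powers P h) k (P k h) = powers P h :=
      Function.update_eq_self k (powers P h)
    have h4 := hu.tendsto (P k h)
    rw [h3] at h4
    exact (continuousAt_slope c h (fun i => (hP i).2.1 h) k).tendsto.comp h4
  have hz := tendsto_one_div_add_atTop_nhds_zero_nat (𝕜 := ℝ)
  have hle : slope c h (powers P h) k ≤ Real.log 2 * l k := by
    have ht : Tendsto (fun n : ℕ => P k h + 1 / ((n : ℝ) + 1)) atTop (𝓝 (P k h)) := by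
      simpa using hz.const_add (P k h)
    refine le_of_tendsto' (hcont.comp ht) fun n => ?_
    have hn : 0 < 1 / ((n : ℝ) + 1) := Nat.one_div_pos_of_nat
    have := h1 k n (by have := (hP k).2.1 h; linarith)
    exact sub_nonpos.1 (nonpos_of_mul_nonpos_left this hn)
  refine ⟨hle, fun hpos => le_antisymm hle ?_⟩
  have ht : Tendsto (fun n : ℕ => P k h + -(1 / ((n : ℝ) + 1))) atTop (𝓝 (P k h)) := by
    simpa using hz.neg.const_add (P k h)
  refine ge_of_tendsto (hcont.comp ht) ?_
  filter_upwards [ht.eventually (lt_mem_nhds hpos)] with n hn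
  have hn' : 0 < 1 / ((n : ℝ) + 1) := Nat.one_div_pos_of_nat
  have := h2 k n hn.le
  rw [mul_neg, neg_nonpos] at this
  exact sub_nonneg.1 ((mul_nonneg_iff_of_pos_right hn').1 this)

/-- In one state, powers that are stationary for the prices `l` maximize `logSum` minus the price of
the power. The first inequality is kept for the case of equality. -/
theorem logSum_le_of_stationary {c : Coef} (hc : ∀ j S, 0 ≤ c j S) {l : Fin 2 → ℝ} {h : Fading}
    {p q : Fin 2 → ℝ} (hp : ∀ k, 0 ≤ p k) (hq : ∀ k, 0 ≤ q k)
    (hst : ∀ k, slope c h p k ≤ l k ∧ (0 < p k → slope c h p k = l k)) :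
    logSum c h p + ∑ k, slope c h p k * (q k - p k) ≤
      logSum c h p + ∑ k, l k * (q k - p k) ∧
    logSum c h q ≤ logSum c h p + ∑ k, l k * (q k - p k) := by
  have h1 : logSum c h p + ∑ k, slope c h p k * (q k - p k) ≤
      logSum c h p + ∑ k, l k * (q k - p k) := by
    refine add_le_add_right (Finset.sum_le_sum fun k _ => ?_) _
    rcases (hp k).eq_or_lt with h0 | hpos
    · rw [← h0, sub_zero]
      exact mul_le_mul_of_nonneg_right (hst k).1 (hq k)
    · rw [(hst k).2 hpos]
  exact ⟨h1, (logSum_le_tangent hc h hp hq).trans h1⟩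

theorem integral_price {ν : Measure Fading} {P Q : Policy} (hP : P ∈ allocations ν)
    (hQ : Q ∈ allocations ν) (l : Fin 2 → ℝ) :
    Integrable (fun h => ∑ k, l k * (Q k h - P k h)) ν ∧
      ∫ h, ∑ k, l k * (Q k h - P k h) ∂ν =
        ∑ k, l k * (∫ h, Q k h ∂ν - ∫ h, P k h ∂ν) := by
  have hi : ∀ k, Integrable (fun h => l k * (Q k h - P k h)) ν :=
    fun k => ((hQ k).2.2.sub (hP k).2.2).const_mul _
  refine ⟨integrable_finsetSum _ fun k _ => hi k, ?_⟩
  rw [integral_finsetSum _ fun k _ => hi k]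
  refine Finset.sum_congr rfl fun k _ => ?_
  rw [integral_const_mul, integral_sub (hQ k).2.2 (hP k).2.2]

/-- Stationary policies maximize the Lagrangian. -/
theorem IsStationary.mixedRate_le {ν : Measure Fading} {Pbar : Fin 2 → ℝ}
    (hν : IsAdmissible ν Pbar) {c : Coef} (hc : ∀ j S, 0 ≤ c j S) {l : Fin 2 → ℝ}
    {P Q : Policy} (hP : P ∈ allocations ν) (hQ : Q ∈ allocations ν)
    (hst : IsStationary ν c l P) :
    Real.log 2 * mixedRate ν c Q ≤ Real.log 2 * mixedRate ν c P +
      ∑ k, l k * (∫ h, Q k h ∂ν - ∫ h, P k h ∂ν) := by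
  obtain ⟨hi, he⟩ := integral_price hP hQ l
  rw [← integral_logSum hν hQ, ← integral_logSum hν hP, ← he,
    ← integral_add (integrable_logSum hν hP c) hi]
  refine integral_mono_ae (integrable_logSum hν hQ c) ((integrable_logSum hν hP c).add hi) ?_
  filter_upwards [hst] with h hh
  exact (logSum_le_of_stationary hc (fun k => (hP k).2.1 h) (fun k => (hQ k).2.1 h) hh).2

/-- Two maximizers of the Lagrangian, one of which is stationary, induce the same received powers
wherever the mixture of rates depends on them. -/
theorem IsStationary.received_eq {ν : Measure Fading} {Pbar : Fin 2 → ℝ}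
    (hν : IsAdmissible ν Pbar) {c : Coef} (hc : ∀ j S, 0 ≤ c j S) {l : Fin 2 → ℝ}
    {P Q : Policy} (hP : P ∈ allocations ν) (hQ : Q ∈ allocations ν)
    (hst : IsStationary ν c l P)
    (hle : Real.log 2 * mixedRate ν c P +
      ∑ k, l k * (∫ h, Q k h ∂ν - ∫ h, P k h ∂ν) ≤ Real.log 2 * mixedRate ν c Q) :
    ∀ᵐ h ∂ν, ∀ j S, 0 < c j S →
      received j S h (powers Q h) = received j S h (powers P h) := by
  obtain ⟨hi, he⟩ := integral_price hP hQ l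
  have iP := integrable_logSum hν hP c
  have iQ := integrable_logSum hν hQ c
  set D : Fading → ℝ := fun h => logSum c h (powers P h) + ∑ k, l k * (Q k h - P k h) -
    logSum c h (powers Q h) with hD
  have hD0 : 0 ≤ᵐ[ν] D := by
    filter_upwards [hst] with h hh
    exact sub_nonneg.2 (logSum_le_of_stationary hc (fun k => (hP k).2.1 h)
      (fun k => (hQ k).2.1 h) hh).2
  have hDi : Integrable D ν := (iP.add hi).sub iQ
  have hDint : ∫ h, D h ∂ν ≤ 0 := by
    have : ∫ h, D h ∂ν = Real.log 2 * mixedRate ν c P +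
        ∑ k, l k * (∫ h, Q k h ∂ν - ∫ h, P k h ∂ν) - Real.log 2 * mixedRate ν c Q := by
      rw [← integral_logSum hν hQ, ← integral_logSum hν hP, ← he, ← integral_add' iP hi,
        ← integral_sub' (iP.add hi) iQ]
      rfl
    linarith
  have hDz := (integral_eq_zero_iff_of_nonneg_ae hD0 hDi).1
    (le_antisymm hDint (integral_nonneg_of_ae hD0))
  filter_upwards [hst, hDz] with h hh hz j S hjS
  have hp : ∀ k, 0 ≤ powers P h k := fun k => (hP k).2.1 h
  have hq : ∀ k, 0 ≤ powers Q h k := fun k => (hQ k).2.1 h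
  refine received_eq_of_tangent_le hc h hp hq ?_ hjS
  refine (logSum_le_of_stationary hc hp hq hh).1.trans (le_of_eq ?_)
  exact sub_eq_zero.1 hz

/-! ### The rate expressions as minima of mixtures -/

theorem sum_finset_fin_two (f : Finset (Fin 2) → ℝ) :
    ∑ S, f S = f ∅ + f {0} + f {1} + f Finset.univ := by
  have : (Finset.univ : Finset (Finset (Fin 2))) = {∅, {0}, {1}, Finset.univ} := by decide
  rw [this, Finset.sum_insert (by decide), Finset.sum_insert (by decide),
    Finset.sum_insert (by decide), Finset.sum_singleton]
  ring

theorem sum_basic (f : Basic → ℝ) : ∑ a, f a = f .b1 + f .b2 + f .b3a + f .b3b := by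
  have : (Finset.univ : Finset Basic) = {.b1, .b2, .b3a, .b3b} := rfl
  rw [this, Finset.sum_insert (by decide), Finset.sum_insert (by decide),
    Finset.sum_insert (by decide), Finset.sum_singleton]
  ring

/-- Coefficients of the mixtures whose minimum over the receivers `i` is the weighted rate of `a`:
the minimum of the two single-user rates of user `2` is replaced by that at receiver `i`. -/
def coef (μ : Fin 2 → ℝ) : Basic → Fin 2 → Coef
  | .b1, _ => fun j S => if S = {j} then μ j else 0
  | .b2, _ => fun j S => if S = {other j} then μ (other j) else 0
  | .b3a, i => fun j S => (if j = 1 then if S = Finset.univ then μ 0 else 0 else 0) +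
      if j = i then if S = {1} then μ 1 - μ 0 else 0 else 0
  | .b3b, i => fun j S => (if j = 0 then if S = Finset.univ then μ 0 else 0 else 0) +
      if j = i then if S = {1} then μ 1 - μ 0 else 0 else 0

@[simp] theorem other_zero : other 0 = 1 := rfl

@[simp] theorem other_one : other 1 = 0 := rfl

theorem coef_nonneg {μ : Fin 2 → ℝ} (h0 : 0 < μ 0) (h1 : μ 0 < μ 1) (a : Basic) (i j : Fin 2)
    (S : Finset (Fin 2)) : 0 ≤ coef μ a i j S := by
  have hμ : ∀ k, 0 ≤ μ k := Fin.forall_fin_two.2 ⟨h0.le, (h0.trans h1).le⟩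
  have hd : 0 ≤ μ 1 - μ 0 := by linarith
  cases a <;> simp only [coef]
  · split_ifs
    exacts [hμ _, le_rfl]
  · split_ifs
    exacts [hμ _, le_rfl]
  all_goals
    refine add_nonneg ?_ ?_ <;> split_ifs <;> first | exact hμ _ | exact hd | exact le_rfl

/-- Every mixture depends on the power of every user. -/
theorem exists_coef_pos {μ : Fin 2 → ℝ} (h0 : 0 < μ 0) (h1 : μ 0 < μ 1) (a : Basic)
    (i k : Fin 2) : ∃ j S, k ∈ S ∧ 0 < coef μ a i j S := by
  have hμ : ∀ k, 0 < μ k := Fin.forall_fin_two.2 ⟨h0, h0.trans h1⟩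
  have hd : 0 ≤ μ 1 - μ 0 := by linarith
  cases a
  · exact ⟨k, {k}, Finset.mem_singleton_self k, by simpa [coef] using hμ k⟩
  · refine ⟨other k, {k}, Finset.mem_singleton_self k, ?_⟩
    have : other (other k) = k := Fin.rev_rev k
    simpa [coef, this] using hμ k
  · refine ⟨1, Finset.univ, Finset.mem_univ k, ?_⟩
    simp only [coef, if_true]
    refine add_pos_of_pos_of_nonneg h0 ?_
    split_ifs <;> first | exact hd | exact le_rfl
  · refine ⟨0, Finset.univ, Finset.mem_univ k, ?_⟩
    simp only [coef, if_true]
    refine add_pos_of_pos_of_nonneg h0 ?_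
    split_ifs <;> first | exact hd | exact le_rfl

theorem mixedRate_coef_b1 (ν : Measure Fading) (μ : Fin 2 → ℝ) (P : Policy) (i : Fin 2) :
    mixedRate ν (coef μ .b1 i) P = weightedRate ν μ P .b1 := by
  simp [mixedRate, coef, weightedRate]

theorem mixedRate_coef_b2 (ν : Measure Fading) (μ : Fin 2 → ℝ) (P : Policy) (i : Fin 2) :
    mixedRate ν (coef μ .b2 i) P = weightedRate ν μ P .b2 := by
  simp [mixedRate, coef, weightedRate, add_comm]

theorem mixedRate_coef_b3a (ν : Measure Fading) (μ : Fin 2 → ℝ) (P : Policy) (i : Fin 2) :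
    mixedRate ν (coef μ .b3a i) P =
      μ 0 * sumRate ν P .b3a + (μ 1 - μ 0) * rate ν P i {1} := by
  revert i
  refine Fin.forall_fin_two.2 ⟨?_, ?_⟩ <;>
  simp [mixedRate, coef, sumRate, add_mul, Finset.sum_add_distrib]

theorem mixedRate_coef_b3b (ν : Measure Fading) (μ : Fin 2 → ℝ) (P : Policy) (i : Fin 2) :
    mixedRate ν (coef μ .b3b i) P =
      μ 0 * sumRate ν P .b3b + (μ 1 - μ 0) * rate ν P i {1} := by
  revert i
  refine Fin.forall_fin_two.2 ⟨?_, ?_⟩ <;>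
  simp [mixedRate, coef, sumRate, add_mul, Finset.sum_add_distrib]

theorem min_rate_le (ν : Measure Fading) (P : Policy) (i : Fin 2) :
    min (rate ν P 0 {1}) (rate ν P 1 {1}) ≤ rate ν P i {1} := by
  revert i
  exact Fin.forall_fin_two.2 ⟨min_le_left _ _, min_le_right _ _⟩

theorem weightedRate_le_mixedRate {ν : Measure Fading} {μ : Fin 2 → ℝ} (h1 : μ 0 < μ 1)
    (P : Policy) (a : Basic) (i : Fin 2) :
    weightedRate ν μ P a ≤ mixedRate ν (coef μ a i) P := by
  have hm := mul_le_mul_of_nonneg_left (min_rate_le ν P i) (sub_nonneg.2 h1.le)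
  cases a
  · rw [mixedRate_coef_b1]
  · rw [mixedRate_coef_b2]
  · rw [mixedRate_coef_b3a]
    simpa only [weightedRate] using add_le_add_right hm _
  · rw [mixedRate_coef_b3b]
    simpa only [weightedRate] using add_le_add_right hm _

theorem mixedRate_coef_eq_of_minimizer {ν : Measure Fading} {μ : Fin 2 → ℝ} {P : Policy}
    {i : Fin 2} (hi : ∀ j, rate ν P i {1} ≤ rate ν P j {1}) (a : Basic) :
    mixedRate ν (coef μ a i) P = weightedRate ν μ P a := by
  have : min (rate ν P 0 {1}) (rate ν P 1 {1}) = rate ν P i {1} :=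
    le_antisymm (min_rate_le ν P i) (le_min (hi 0) (hi 1))
  cases a
  · rw [mixedRate_coef_b1]
  · rw [mixedRate_coef_b2]
  · rw [mixedRate_coef_b3a, weightedRate, this]
  · rw [mixedRate_coef_b3b, weightedRate, this]

theorem minimizer_of_mixedRate_coef_eq {ν : Measure Fading} {μ : Fin 2 → ℝ} (h1 : μ 0 < μ 1)
    {P : Policy} {i : Fin 2} {a : Basic} (ha : a = .b3a ∨ a = .b3b)
    (h : mixedRate ν (coef μ a i) P = weightedRate ν μ P a) (j : Fin 2) :
    rate ν P i {1} ≤ rate ν P j {1} := by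
  have hd : 0 < μ 1 - μ 0 := sub_pos.2 h1
  have : rate ν P i {1} = min (rate ν P 0 {1}) (rate ν P 1 {1}) := by
    rcases ha with rfl | rfl
    · rw [mixedRate_coef_b3a, weightedRate] at h
      exact mul_left_cancel₀ hd.ne' (add_left_cancel h)
    · rw [mixedRate_coef_b3b, weightedRate] at h
      exact mul_left_cancel₀ hd.ne' (add_left_cancel h)
  rw [this]
  exact min_rate_le ν P j

theorem exists_minimizer (ν : Measure Fading) (P : Policy) :
    ∃ i : Fin 2, ∀ j, rate ν P i {1} ≤ rate ν P j {1} := by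
  rcases le_total (rate ν P 0 {1}) (rate ν P 1 {1}) with h | h
  · exact ⟨0, Fin.forall_fin_two.2 ⟨le_rfl, h⟩⟩
  · exact ⟨1, Fin.forall_fin_two.2 ⟨h, le_rfl⟩⟩

/-- Convex combinations of the coefficients `coef μ a i`. -/
def mixCoef (μ : Fin 2 → ℝ) (θ : Basic × Fin 2 → ℝ) : Coef :=
  fun j S => ∑ x, θ x * coef μ x.1 x.2 j S

theorem mixCoef_nonneg {μ : Fin 2 → ℝ} (h0 : 0 < μ 0) (h1 : μ 0 < μ 1)
    {θ : Basic × Fin 2 → ℝ} (hθ : ∀ x, 0 ≤ θ x) (j : Fin 2) (S : Finset (Fin 2)) :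
    0 ≤ mixCoef μ θ j S :=
  Finset.sum_nonneg fun x _ => mul_nonneg (hθ x) (coef_nonneg h0 h1 _ _ _ _)

theorem mixedRate_mixCoef (ν : Measure Fading) (μ : Fin 2 → ℝ) (θ : Basic × Fin 2 → ℝ)
    (P : Policy) : mixedRate ν (mixCoef μ θ) P = ∑ x, θ x * mixedRate ν (coef μ x.1 x.2) P := by
  simp only [mixedRate, mixCoef, Finset.sum_mul, Finset.mul_sum, mul_assoc]
  rw [Finset.sum_congr rfl fun j _ => Finset.sum_comm, Finset.sum_comm]

/-- The mixtures bound the smallest of the weighted rates that they mix. -/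
theorem inf_weightedRate_le_mixedRate {ν : Measure Fading} {μ : Fin 2 → ℝ} (h1 : μ 0 < μ 1)
    {I : Finset Basic} (hI : I.Nonempty) {θ : Basic × Fin 2 → ℝ} (hθ : ∀ x, 0 ≤ θ x)
    (hsum : ∑ x, θ x = 1) (hsupp : ∀ x, θ x ≠ 0 → x.1 ∈ I) (Q : Policy) :
    I.inf' hI (weightedRate ν μ Q) ≤ mixedRate ν (mixCoef μ θ) Q := by
  rw [mixedRate_mixCoef]
  calc I.inf' hI (weightedRate ν μ Q) = ∑ x, θ x * I.inf' hI (weightedRate ν μ Q) := by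
        rw [← Finset.sum_mul, hsum, one_mul]
    _ ≤ _ := by
        refine Finset.sum_le_sum fun x _ => ?_
        by_cases hx : θ x = 0
        · simp [hx]
        · exact mul_le_mul_of_nonneg_left ((Finset.inf'_le _ (hsupp x hx)).trans
            (weightedRate_le_mixedRate h1 Q x.1 x.2)) (hθ x)

theorem mixedRate_eq_of_support {ν : Measure Fading} {μ : Fin 2 → ℝ} {θ : Basic × Fin 2 → ℝ}
    (hsum : ∑ x, θ x = 1) {P : Policy} {v : ℝ}
    (hsupp : ∀ x, θ x ≠ 0 → mixedRate ν (coef μ x.1 x.2) P = v) :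
    mixedRate ν (mixCoef μ θ) P = v := by
  rw [mixedRate_mixCoef]
  calc _ = ∑ x, θ x * v := by
        refine Finset.sum_congr rfl fun x _ => ?_
        by_cases hx : θ x = 0
        · simp [hx]
        · rw [hsupp x hx]
    _ = v := by rw [← Finset.sum_mul, hsum, one_mul]

/-- Multipliers of a policy that maximizes the smallest of the weighted rates in `I`. The slack
variables of the power constraints enter the theorem of the alternative as further functions. -/
theorem exists_lagrangian {ν : Measure Fading} {Pbar μ : Fin 2 → ℝ} (hν : IsAdmissible ν Pbar)
    (h0 : 0 < μ 0) (h1 : μ 0 < μ 1) {I : Finset Basic} (hI : I.Nonempty) {P : Policy}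
    (hP : P ∈ policies ν Pbar)
    (hmax : ∀ Q ∈ policies ν Pbar,
      I.inf' hI (weightedRate ν μ Q) ≤ I.inf' hI (weightedRate ν μ P)) :
    ∃ (θ : Basic × Fin 2 → ℝ) (l : Fin 2 → ℝ), (∀ x, 0 ≤ θ x) ∧ ∑ x, θ x = 1 ∧
      (∀ x, θ x ≠ 0 → x.1 ∈ I ∧
        mixedRate ν (coef μ x.1 x.2) P = I.inf' hI (weightedRate ν μ P)) ∧
      (∀ k, 0 ≤ l k) ∧ (∀ k, l k * (Pbar k - ∫ h, P k h ∂ν) = 0) ∧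
      ∀ Q ∈ allocations ν, mixedRate ν (mixCoef μ θ) Q - ∑ k, l k * ∫ h, Q k h ∂ν ≤
        mixedRate ν (mixCoef μ θ) P - ∑ k, l k * ∫ h, P k h ∂ν := by
  classical
  set v := I.inf' hI (weightedRate ν μ P) with hv
  let Φ : (Basic × Fin 2) ⊕ Fin 2 → Policy → ℝ := Sum.elim
    (fun x Q => mixedRate ν (coef μ x.1 x.2) Q - v) fun k Q => Pbar k - ∫ h, Q k h ∂ν
  have hPa := policies_subset_allocations hP
  have hΦ : ∀ a, ConcaveOn ℝ (allocations ν) (Φ a) := by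
    rintro (x | k)
    · exact (mixedRate_concaveOn hν (coef_nonneg h0 h1 x.1 x.2)).sub
        (convexOn_const v (convex_allocations ν))
    · refine ⟨convex_allocations ν, fun Q hQ R hR a b _ _ hab => le_of_eq ?_⟩
      have : ∫ h, (a • Q + b • R) k h ∂ν = a * ∫ h, Q k h ∂ν + b * ∫ h, R k h ∂ν := by
        rw [← integral_const_mul, ← integral_const_mul,
          ← integral_add ((hQ k).2.2.const_mul a) ((hR k).2.2.const_mul b)]
        rfl
      simp only [Φ, Sum.elim_inr, this, smul_eq_mul]
      linear_combination (Pbar k) * hab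
  obtain ⟨θ', hθ0, hθs, hθ1, hθ⟩ := exists_weights_of_forall_exists_nonpos ⟨P, hPa⟩ hΦ
    (s := (I ×ˢ Finset.univ).disjSum Finset.univ) (by
      intro Q hQ
      by_contra! hpos
      have hQp : Q ∈ policies ν Pbar := fun k => ⟨(hQ k).1, (hQ k).2.1, (hQ k).2.2, by
        have := hpos (.inr k) (by simp)
        simp only [Φ, Sum.elim_inr] at this
        linarith⟩
      refine absurd (hmax Q hQp) (not_le.2 ?_)
      rw [Finset.lt_inf'_iff]
      intro a ha
      obtain ⟨i, hi⟩ := exists_minimizer ν Q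
      have := hpos (.inl (a, i)) (by simp [ha])
      simp only [Φ, Sum.elim_inl] at this
      rw [mixedRate_coef_eq_of_minimizer hi] at this
      linarith)
  simp only [Fintype.sum_sum_type, Φ, Sum.elim_inl, Sum.elim_inr] at hθ hθ1
  set θ : Basic × Fin 2 → ℝ := fun x => θ' (.inl x) with hθdef
  set l : Fin 2 → ℝ := fun k => θ' (.inr k) with hldef
  have hθsupp : ∀ x, θ x ≠ 0 → x.1 ∈ I := by
    intro x hx
    by_contra hxI
    exact hx (hθs (.inl x) (by simp [hxI]))
  have hl0 : ∀ k, 0 ≤ l k := fun k => hθ0 _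
  -- the zero policy is a Slater point
  have hΘ : 0 < ∑ x, θ x := by
    refine (Finset.sum_nonneg fun x _ => hθ0 (.inl x)).lt_of_ne fun hzero => ?_
    have hz := (Finset.sum_eq_zero_iff_of_nonneg fun x _ => hθ0 (.inl x)).1 hzero.symm
    have h3 := hθ 0 (policies_subset_allocations (zero_mem_policies hν))
    rw [Finset.sum_eq_zero fun x hx => by rw [hz x hx, zero_mul], zero_add] at h3
    have h4 : ∑ k, l k = 1 := by rw [← hzero, zero_add] at hθ1; exact hθ1
    simp only [Pi.zero_apply, integral_zero, sub_zero, Fin.sum_univ_two] at h3 h4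
    have p0 := hν.power_pos 0
    have p1 := hν.power_pos 1
    have q0 := hl0 0
    have q1 := hl0 1
    rcases q0.eq_or_lt with e | e
    · have : l 1 = 1 := by linarith
      simp only [hldef] at *
      nlinarith
    · have := mul_pos e p0
      have := mul_nonneg q1 p1.le
      simp only [hldef] at *
      linarith
  set T := ∑ x, θ x with hT
  -- at `P` all terms of the nonpositive combination are nonnegative, hence zero: this is
  -- complementary slackness
  have hge : ∀ x, θ x ≠ 0 → 0 ≤ mixedRate ν (coef μ x.1 x.2) P - v := fun x hx =>
    sub_nonneg.2 ((Finset.inf'_le _ (hθsupp x hx)).trans (weightedRate_le_mixedRate h1 P x.1 x.2))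
  have hge' : ∀ x, 0 ≤ θ x * (mixedRate ν (coef μ x.1 x.2) P - v) := by
    intro x
    by_cases hx : θ x = 0
    · simp [hx]
    · exact mul_nonneg (hθ0 _) (hge x hx)
  have hle' : ∀ k, 0 ≤ l k * (Pbar k - ∫ h, P k h ∂ν) := fun k =>
    mul_nonneg (hl0 k) (sub_nonneg.2 (hP k).2.2.2)
  have hPle := hθ P hPa
  have hs1 : ∑ x, θ x * (mixedRate ν (coef μ x.1 x.2) P - v) = 0 := le_antisymm
    (by linarith [Finset.sum_nonneg fun k (_ : k ∈ Finset.univ) => hle' k])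
    (Finset.sum_nonneg fun x _ => hge' x)
  have hs2 : ∑ k, l k * (Pbar k - ∫ h, P k h ∂ν) = 0 := le_antisymm
    (by linarith) (Finset.sum_nonneg fun x _ => hle' x)
  have hz1 := (Finset.sum_eq_zero_iff_of_nonneg fun x _ => hge' x).1 hs1
  have hz2 := (Finset.sum_eq_zero_iff_of_nonneg fun x _ => hle' x).1 hs2
  have hsum1 : ∑ x, θ x / T = 1 := by rw [← Finset.sum_div, div_self hΘ.ne']
  have hsupp : ∀ x, θ x / T ≠ 0 → x.1 ∈ I ∧ mixedRate ν (coef μ x.1 x.2) P = v := by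
    intro x hx
    have hx' : θ x ≠ 0 := fun h => hx (by rw [h, zero_div])
    refine ⟨hθsupp x hx', ?_⟩
    rcases mul_eq_zero.1 (hz1 x (Finset.mem_univ x)) with h | h
    · exact absurd h hx'
    · linarith
  refine ⟨fun x => θ x / T, fun k => l k / T, fun x => div_nonneg (hθ0 _) hΘ.le, hsum1, hsupp,
    fun k => div_nonneg (hl0 k) hΘ.le, fun k => ?_, fun Q hQ => ?_⟩
  · rw [div_mul_eq_mul_div, hz2 k (Finset.mem_univ k), zero_div]
  · have hPv := mixedRate_eq_of_support hsum1 fun x hx => (hsupp x hx).2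
    have hQ' := hθ Q hQ
    rw [hPv, mixedRate_mixCoef]
    have e1 : ∑ x, θ x / T * mixedRate ν (coef μ x.1 x.2) Q =
        (∑ x, θ x * (mixedRate ν (coef μ x.1 x.2) Q - v)) / T + v := by
      simp only [mul_sub, Finset.sum_sub_distrib, ← Finset.sum_mul]
      rw [← hT, sub_div, mul_div_cancel_left₀ _ hΘ.ne', Finset.sum_div, sub_add_cancel]
      exact Finset.sum_congr rfl fun x _ => by ring
    have e2 : ∑ k, l k / T * ∫ h, Q k h ∂ν - ∑ k, l k / T * ∫ h, P k h ∂ν =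
        -(∑ k, l k * (Pbar k - ∫ h, Q k h ∂ν)) / T := by
      have : ∑ k, l k * ∫ h, P k h ∂ν = ∑ k, l k * Pbar k := by
        simp only [mul_sub, Finset.sum_sub_distrib] at hs2
        linarith
      simp only [div_mul_eq_mul_div, ← Finset.sum_div]
      rw [this, ← sub_div]
      simp only [mul_sub, Finset.sum_sub_distrib]
      ring
    have e3 : ((∑ x, θ x * (mixedRate ν (coef μ x.1 x.2) Q - v)) +
        ∑ k, l k * (Pbar k - ∫ h, Q k h ∂ν)) / T ≤ 0 :=
      div_nonpos_of_nonpos_of_nonneg hQ' hΘ.le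
    rw [add_div] at e3
    rw [neg_div] at e2
    rw [e1]
    linarith

/-- A policy that maximizes the smallest of the weighted rates in `I` is stationary for a mixture of
the smallest expressions in `I`, with positive power prices, and uses all the power. -/
theorem exists_isStationary {ν : Measure Fading} {Pbar μ : Fin 2 → ℝ} (hν : IsAdmissible ν Pbar)
    (h0 : 0 < μ 0) (h1 : μ 0 < μ 1) {I : Finset Basic} (hI : I.Nonempty) {P : Policy}
    (hP : P ∈ policies ν Pbar)
    (hmax : ∀ Q ∈ policies ν Pbar,
      I.inf' hI (weightedRate ν μ Q) ≤ I.inf' hI (weightedRate ν μ P)) :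
    ∃ (θ : Basic × Fin 2 → ℝ) (l : Fin 2 → ℝ), (∀ x, 0 ≤ θ x) ∧ ∑ x, θ x = 1 ∧
      (∀ x, θ x ≠ 0 → x.1 ∈ I ∧
        mixedRate ν (coef μ x.1 x.2) P = I.inf' hI (weightedRate ν μ P)) ∧
      (∀ k, 0 < l k) ∧ IsStationary ν (mixCoef μ θ) l P ∧ ∀ k, ∫ h, P k h ∂ν = Pbar k := by
  obtain ⟨θ, l, hθ0, hθ1, hsupp, hl0, hcs, hlag⟩ := exists_lagrangian hν h0 h1 hI hP hmax
  have hc := mixCoef_nonneg h0 h1 hθ0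
  have hPa := policies_subset_allocations hP
  have hst := isStationary_of_forall_lagrangian_le hν hc hPa hlag
  -- a user with price zero would have slope zero almost surely, but none of its links is absent
  have hlpos : ∀ k, 0 < l k := by
    intro k
    refine (hl0 k).lt_of_ne fun hlk => ?_
    obtain ⟨x, hx⟩ : ∃ x, θ x ≠ 0 := by
      by_contra! hall
      simp [hall] at hθ1
    obtain ⟨j, S, hkS, hpos⟩ := exists_coef_pos h0 h1 x.1 x.2 k
    have hcjS : 0 < mixCoef μ θ j S :=
      Finset.sum_pos' (fun y _ => mul_nonneg (hθ0 y) (coef_nonneg h0 h1 _ _ _ _))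
        ⟨x, Finset.mem_univ x, mul_pos ((hθ0 x).lt_of_ne hx.symm) hpos⟩
    have hnull : ∀ᵐ h ∂ν, h j k = 0 := by
      filter_upwards [hst] with h hh
      by_contra hne
      have hg := gain_pos hne
      have hle := (hh k).1
      rw [← hlk, mul_zero] at hle
      refine absurd hle (not_le.2 ?_)
      have hden : ∀ i T, 0 ≤ gain i k h / (1 + received i T h (powers P h)) := fun i T =>
        div_nonneg (gain_nonneg _ _ _)
          (by linarith [received_nonneg i T h (p := powers P h) fun k => (hPa k).2.1 h])
      have hnn : ∀ i T, 0 ≤ if k ∈ T then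
          mixCoef μ θ i T * (gain i k h / (1 + received i T h (powers P h))) else 0 := by
        intro i T
        split_ifs
        · exact mul_nonneg (hc i T) (hden i T)
        · exact le_rfl
      refine Finset.sum_pos' (fun i _ => Finset.sum_nonneg fun T _ => hnn i T)
        ⟨j, Finset.mem_univ j, Finset.sum_pos' (fun T _ => hnn j T) ⟨S, Finset.mem_univ S, ?_⟩⟩
      rw [if_pos hkS]
      refine mul_pos hcjS (div_pos hg ?_)
      linarith [received_nonneg j S h (p := powers P h) fun k => (hPa k).2.1 h]
    exact (hν.link_present j k).ne' (ae_iff.1 hnull)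
  refine ⟨θ, fun k => Real.log 2 * l k, hθ0, hθ1, hsupp, fun k => mul_pos log_two_pos (hlpos k),
    hst, fun k => ?_⟩
  rcases mul_eq_zero.1 (hcs k) with h | h
  · exact absurd h (hlpos k).ne'
  · linarith

/-- Among feasible policies, a stationary policy that uses all the power maximizes its mixture of
rates. -/
theorem IsStationary.mixedRate_le_of_mem_policies {ν : Measure Fading} {Pbar : Fin 2 → ℝ}
    (hν : IsAdmissible ν Pbar) {c : Coef} (hc : ∀ j S, 0 ≤ c j S) {l : Fin 2 → ℝ}
    (hl : ∀ k, 0 < l k) {P Q : Policy} (hP : P ∈ policies ν Pbar) (hQ : Q ∈ policies ν Pbar)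
    (hst : IsStationary ν c l P) (hfull : ∀ k, ∫ h, P k h ∂ν = Pbar k) :
    mixedRate ν c Q ≤ mixedRate ν c P := by
  have h1 := hst.mixedRate_le hν hc (policies_subset_allocations hP)
    (policies_subset_allocations hQ)
  have h2 : ∑ k, l k * (∫ h, Q k h ∂ν - ∫ h, P k h ∂ν) ≤ 0 :=
    Finset.sum_nonpos fun k _ => mul_nonpos_of_nonneg_of_nonpos (hl k).le
      (by rw [hfull]; linarith [(hQ k).2.2.2])
  exact le_of_mul_le_mul_left (by linarith) log_two_pos

/-! ### The opportunistic form -/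

theorem single_one_nonneg {ι : Type*} [DecidableEq ι] (a i : ι) :
    0 ≤ (Pi.single a 1 : ι → ℝ) i := by
  by_cases h : i = a
  · subst h
    simp
  · simp [h]

theorem eq_of_single_one_ne_zero {ι : Type*} [DecidableEq ι] {a i : ι}
    (h : (Pi.single a 1 : ι → ℝ) i ≠ 0) : i = a := by
  by_contra hne
  exact h (by simp [hne])

theorem eq_single_one_of_sum_eq_one {ι : Type*} [Fintype ι] [DecidableEq ι] {w : ι → ℝ} {a : ι}
    (hw : ∑ i, w i = 1) (h : ∀ i, w i ≠ 0 → i = a) : w = Pi.single a 1 := by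
  have hz : ∀ i, i ≠ a → w i = 0 := fun i hi => by
    by_contra hne
    exact hi (h i hne)
  funext i
  by_cases hi : i = a
  · subst hi
    rw [Pi.single_eq_same, ← hw, Finset.sum_eq_single i (fun i _ hi => hz i hi) (by simp)]
  · rw [Pi.single_eq_of_ne hi, hz i hi]

/-- The weights `θ` enter the mixture only through their marginals on the rate expressions and,
for `3a` and `3b` together, on the receivers. -/
theorem mixCoef_eq_mul {μ : Fin 2 → ℝ} {θ : Basic × Fin 2 → ℝ} {w : Basic → ℝ}
    {b : Fin 2 → ℝ} (hb : ∑ i, b i = 1) (hw : ∀ a, w a = θ (a, 0) + θ (a, 1))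
    (hwb : ∀ i, (w .b3a + w .b3b) * b i = θ (.b3a, i) + θ (.b3b, i)) :
    mixCoef μ θ = mixCoef μ fun x => w x.1 * b x.2 := by
  funext j S
  rw [Fin.sum_univ_two] at hb
  simp only [mixCoef, Fintype.sum_prod_type, sum_basic, Fin.sum_univ_two, coef]
  set A := if S = {j} then μ j else 0
  set B := if S = {other j} then μ (other j) else 0
  set U := if j = 1 then if S = Finset.univ then μ 0 else 0 else 0
  set V := if j = 0 then if S = Finset.univ then μ 0 else 0 else 0
  set X := if j = 0 then if S = {1} then μ 1 - μ 0 else 0 else 0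
  set Y := if j = 1 then if S = {1} then μ 1 - μ 0 else 0 else 0
  linear_combination (-A) * hw .b1 - B * hw .b2 - U * hw .b3a - V * hw .b3b -
    X * hwb 0 - Y * hwb 1 - (w .b1 * A + w .b2 * B + w .b3a * U + w .b3b * V) * hb

/-- The marginal rewards are the slopes of the mixtures with product weights. -/
theorem marginal_eq_slope {μ : Fin 2 → ℝ} {w : Basic → ℝ} {b : Fin 2 → ℝ}
    (hb : ∑ i, b i = 1) (h : Fading) (p : Fin 2 → ℝ) (k : Fin 2) :
    marginal μ w b h p k = slope (mixCoef μ fun x => w x.1 * b x.2) h p k := by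
  have e1 : (Finset.univ : Finset (Fin 2)) ≠ {0} := by decide
  have e2 : (Finset.univ : Finset (Fin 2)) ≠ {1} := by decide
  rw [Fin.sum_univ_two] at hb
  revert k
  refine Fin.forall_fin_two.2 ⟨?_, ?_⟩
  · simp only [marginal, slope, mixCoef, Fintype.sum_prod_type, sum_basic, Fin.sum_univ_two,
      sum_finset_fin_two, coef, received]
    simp [e1, e2, e1.symm]
    linear_combination (-w .b1 * (μ 0 * gain 0 0 h / (1 + gain 0 0 h * p 0)) -
      w .b2 * (μ 0 * gain 1 0 h / (1 + gain 1 0 h * p 0)) -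
      w .b3a * (μ 0 * gain 1 0 h / (1 + (gain 1 0 h * p 0 + gain 1 1 h * p 1))) -
      w .b3b * (μ 0 * gain 0 0 h / (1 + (gain 0 0 h * p 0 + gain 0 1 h * p 1)))) * hb
  · simp only [marginal, slope, mixCoef, Fintype.sum_prod_type, sum_basic, Fin.sum_univ_two,
      sum_finset_fin_two, coef, received]
    simp [e1, e2, e2.symm]
    linear_combination (-w .b1 * (μ 1 * gain 1 1 h / (1 + gain 1 1 h * p 1)) -
      w .b2 * (μ 1 * gain 0 1 h / (1 + gain 0 1 h * p 1)) -
      w .b3a * (μ 0 * gain 1 1 h / (1 + (gain 1 0 h * p 0 + gain 1 1 h * p 1))) -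
      w .b3b * (μ 0 * gain 0 1 h / (1 + (gain 0 0 h * p 0 + gain 0 1 h * p 1)))) * hb

/-- A positive slope strictly decreases in the power of its own user. -/
theorem slope_lt_slope_update {c : Coef} (hc : ∀ j S, 0 ≤ c j S) (h : Fading) {p : Fin 2 → ℝ}
    (hp : ∀ k, 0 ≤ p k) {k : Fin 2} (hk : 0 < p k) (hs : 0 < slope c h p k) :
    slope c h p k < slope c h (Function.update p k 0) k := by
  have hp0 : ∀ i, 0 ≤ Function.update p k 0 i := by
    intro i
    by_cases hi : i = k
    · subst hi
      simp
    · simpa [hi] using hp i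
  have hrec : ∀ j S, k ∈ S →
      received j S h p = received j S h (Function.update p k 0) + gain j k h * p k := by
    intro j S hkS
    have : received j S h p - received j S h (Function.update p k 0) = gain j k h * p k := by
      unfold received
      rw [← Finset.sum_sub_distrib, Finset.sum_eq_single_of_mem k hkS]
      · simp
      · intro i _ hi
        simp [hi]
    linarith
  have hterm : ∀ j S, (if k ∈ S then c j S * (gain j k h / (1 + received j S h p)) else 0) ≤
      if k ∈ S then c j S * (gain j k h / (1 + received j S h (Function.update p k 0))) else 0 := by
    intro j S
    split_ifs with hkS
    · have h1 := received_nonneg j S h hp0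
      have h2 := mul_nonneg (gain_nonneg j k h) hk.le
      rw [hrec j S hkS]
      refine mul_le_mul_of_nonneg_left ?_ (hc j S)
      exact div_le_div_of_nonneg_left (gain_nonneg j k h) (by linarith) (by linarith)
    · exact le_rfl
  obtain ⟨j, -, hj⟩ := Finset.exists_lt_of_sum_lt
    (show ∑ _j : Fin 2, (0 : ℝ) < slope c h p k by simpa using hs)
  obtain ⟨S, -, hS⟩ := Finset.exists_lt_of_sum_lt
    (show ∑ _S : Finset (Fin 2), (0 : ℝ) < _ by simpa using hj)
  refine Finset.sum_lt_sum (fun i _ => Finset.sum_le_sum fun T _ => hterm i T)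
    ⟨j, Finset.mem_univ j, Finset.sum_lt_sum (fun T _ => hterm j T) ⟨S, Finset.mem_univ S, ?_⟩⟩
  by_cases hkS : k ∈ S
  · simp only [if_pos hkS] at hS ⊢
    have h1 := received_nonneg j S h hp0
    have h3 := received_nonneg j S h hp
    have hcS : 0 < c j S := (hc j S).lt_of_ne fun h0 => by simp [← h0] at hS
    have hg : 0 < gain j k h := (gain_nonneg j k h).lt_of_ne fun h0 => by simp [← h0] at hS
    rw [hrec j S hkS]
    have h2 := mul_pos hg hk
    exact mul_lt_mul_of_pos_left
      (div_lt_div_of_pos_left hg (by linarith) (by linarith)) hcS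
  · simp [hkS] at hS

/-- Stationarity at one state, in terms of the slope at zero power. -/
theorem stationary_iff_of_slope_at_zero {c : Coef} (hc : ∀ j S, 0 ≤ c j S) (h : Fading)
    {p : Fin 2 → ℝ} (hp : ∀ k, 0 ≤ p k) {k : Fin 2} {l : ℝ} (hl : 0 < l) :
    (slope c h p k ≤ l ∧ (0 < p k → slope c h p k = l)) ↔
      (slope c h (Function.update p k 0) k ≤ l → p k = 0) ∧
        (l < slope c h (Function.update p k 0) k → 0 < p k ∧ slope c h p k = l) := by
  have hupd : p k = 0 → Function.update p k 0 = p := fun h0 => by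
    rw [← h0, Function.update_eq_self]
  constructor
  · rintro ⟨hle, heq⟩
    refine ⟨fun h0 => ?_, fun hlt => ?_⟩
    · by_contra hne
      have hpos := (hp k).lt_of_ne' hne
      have := heq hpos
      have := slope_lt_slope_update hc h hp hpos (by linarith)
      linarith
    · have hpos : 0 < p k := (hp k).lt_of_ne' fun h0 => by
        rw [hupd h0] at hlt
        linarith
      exact ⟨hpos, heq hpos⟩
  · rintro ⟨h0, h1⟩
    rcases le_or_gt (slope c h (Function.update p k 0) k) l with hle | hlt
    · have hz := h0 hle
      rw [hupd hz] at hle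
      exact ⟨hle, fun hpos => absurd hz hpos.ne'⟩
    · exact ⟨(h1 hlt).2.le, fun _ => (h1 hlt).2⟩

/-- The state-wise condition in `IsOpportunistic` says that the policy is stationary. -/
theorem isStationary_iff_marginal {ν : Measure Fading} {μ : Fin 2 → ℝ} (h0 : 0 < μ 0)
    (h1 : μ 0 < μ 1) {w : Basic → ℝ} {b l : Fin 2 → ℝ} (hw : ∀ a, 0 ≤ w a) (hb : ∀ i, 0 ≤ b i)
    (hb1 : ∑ i, b i = 1) (hl : ∀ k, 0 < l k) {P : Policy} (hP : P ∈ allocations ν) :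
    IsStationary ν (mixCoef μ fun x => w x.1 * b x.2) l P ↔
      ∀ᵐ h ∂ν, ∀ k,
        (marginal μ w b h (Function.update (fun i => P i h) k 0) k ≤ l k → P k h = 0) ∧
        (l k < marginal μ w b h (Function.update (fun i => P i h) k 0) k →
          0 < P k h ∧ marginal μ w b h (fun i => P i h) k = l k) := by
  have hc := mixCoef_nonneg h0 h1 (θ := fun x => w x.1 * b x.2)
    fun x => mul_nonneg (hw x.1) (hb x.2)
  refine eventually_congr (Eventually.of_forall fun h => forall_congr' fun k => ?_)
  rw [marginal_eq_slope hb1, marginal_eq_slope hb1]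
  exact stationary_iff_of_slope_at_zero hc h (p := powers P h) (fun k => (hP k).2.1 h) (hl k)

/-- The solutions of a case problem are the opportunistic policies. The multipliers `θ` of a solution
have the marginals `w` on the expressions and, normalized on `3a` and `3b`, the marginals `b`
on the receivers. Conversely, a stationary policy maximizes a mixture that bounds the case rate and
agrees with it at the policy. -/
theorem isCaseOptimal_iff_isOpportunistic {ν : Measure Fading} {Pbar μ : Fin 2 → ℝ}
    (hν : IsAdmissible ν Pbar) (h0 : 0 < μ 0) (h1 : μ 0 < μ 1) {x : Case} {P : Policy}
    (hP : P ∈ policies ν Pbar) :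
    IsCaseOptimal ν Pbar μ x P ↔ IsOpportunistic ν Pbar μ x P := by
  have hPa := policies_subset_allocations hP
  constructor
  · rintro ⟨-, hmax⟩
    obtain ⟨θ, l, hθ0, hθ1, hsupp, hl, hst, hfull⟩ :=
      exists_isStationary hν h0 h1 x.parts_nonempty hP hmax
    set w : Basic → ℝ := fun a => θ (a, 0) + θ (a, 1) with hw
    have hw0 : ∀ a, 0 ≤ w a := fun a => add_nonneg (hθ0 _) (hθ0 _)
    have hwne : ∀ a, w a ≠ 0 → ∃ i, θ (a, i) ≠ 0 := by
      intro a ha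
      by_contra! hall
      exact ha (by simp [hw, hall])
    have hW : ∀ i, 0 ≤ θ (.b3a, i) + θ (.b3b, i) := fun i => add_nonneg (hθ0 _) (hθ0 _)
    have hsupp' : ∀ a i, θ (a, i) ≠ 0 →
        mixedRate ν (coef μ a i) P = weightedRate ν μ P a ∧
          weightedRate ν μ P a = caseRate ν μ x P := by
      intro a i hne
      obtain ⟨ha, he⟩ := hsupp (a, i) hne
      have h2 := weightedRate_le_mixedRate (ν := ν) h1 P a i
      have h3 : caseRate ν μ x P ≤ weightedRate ν μ P a := Finset.inf'_le _ ha
      simp only at he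
      change _ = caseRate ν μ x P at he
      constructor <;> linarith
    obtain ⟨b, hb0, hb1, hbmin, hbW⟩ : ∃ b : Fin 2 → ℝ, (∀ i, 0 ≤ b i) ∧ ∑ i, b i = 1 ∧
        (∀ j, b j ≠ 0 → ∀ i, rate ν P j {1} ≤ rate ν P i {1}) ∧
        ∀ i, (w .b3a + w .b3b) * b i = θ (.b3a, i) + θ (.b3b, i) := by
      -- if `3a` and `3b` carry no weight, then `b` is irrelevant to the mixture
      rcases eq_or_ne (w .b3a + w .b3b) 0 with hz | hz
      · obtain ⟨i₀, hi₀⟩ := exists_minimizer ν P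
        refine ⟨Pi.single i₀ 1, single_one_nonneg i₀, by simp,
          fun j hj => by rwa [eq_of_single_one_ne_zero hj], fun i => ?_⟩
        · rw [hz, zero_mul]
          have hsum : (θ (.b3a, 0) + θ (.b3b, 0)) + (θ (.b3a, 1) + θ (.b3b, 1)) = 0 := by
            simp only [hw] at hz
            linarith
          revert i
          exact Fin.forall_fin_two.2 ⟨by linarith [hW 0, hW 1], by linarith [hW 0, hW 1]⟩
      · have hpos : 0 < w .b3a + w .b3b := (add_nonneg (hw0 _) (hw0 _)).lt_of_ne' hz
        refine ⟨fun i => (θ (.b3a, i) + θ (.b3b, i)) / (w .b3a + w .b3b),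
          fun i => div_nonneg (hW i) hpos.le, ?_, fun j hj => ?_,
          fun i => mul_div_cancel₀ _ hz⟩
        · rw [← Finset.sum_div, Fin.sum_univ_two, div_eq_one_iff_eq hz]
          simp only [hw]
          ring
        · by_cases ha : θ (.b3a, j) = 0
          · have hbne : θ (.b3b, j) ≠ 0 := fun hb => hj (by simp [ha, hb])
            exact minimizer_of_mixedRate_coef_eq h1 (.inr rfl) (hsupp' _ _ hbne).1
          · exact minimizer_of_mixedRate_coef_eq h1 (.inl rfl) (hsupp' _ _ ha).1
    rw [mixCoef_eq_mul hb1 (fun _ => rfl) hbW] at hst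
    refine ⟨w, b, l, hw0, ?_, fun a ha => ?_, hb0, hb1, hbmin, hl,
      (isStationary_iff_marginal h0 h1 hw0 hb0 hb1 hl hPa).1 hst, hfull⟩
    · rw [← hθ1, Fintype.sum_prod_type]
      simp [hw]
    · obtain ⟨i, hi⟩ := hwne a ha
      exact ⟨(hsupp _ hi).1, (hsupp' a i hi).2⟩
  · rintro ⟨w, b, l, hw0, hw1, hwsupp, hb0, hb1, hbmin, hl, hst, hfull⟩
    refine ⟨hP, fun Q hQ => ?_⟩
    set θ : Basic × Fin 2 → ℝ := fun x => w x.1 * b x.2 with hθ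
    have hθ0 : ∀ x, 0 ≤ θ x := fun x => mul_nonneg (hw0 _) (hb0 _)
    have hθ1 : ∑ x, θ x = 1 := by
      simp only [hθ, Fintype.sum_prod_type, ← Finset.mul_sum, hb1, mul_one, hw1]
    have hst' := (isStationary_iff_marginal h0 h1 hw0 hb0 hb1 hl hPa).2 hst
    calc caseRate ν μ x Q ≤ mixedRate ν (mixCoef μ θ) Q :=
          inf_weightedRate_le_mixedRate h1 x.parts_nonempty hθ0 hθ1
            (fun y hy => (hwsupp y.1 (left_ne_zero_of_mul hy)).1) Q
      _ ≤ mixedRate ν (mixCoef μ θ) P :=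
          hst'.mixedRate_le_of_mem_policies hν (mixCoef_nonneg h0 h1 hθ0) hl hP hQ hfull
      _ = caseRate ν μ x P := mixedRate_eq_of_support hθ1 fun y hy => by
          rw [mixedRate_coef_eq_of_minimizer (hbmin y.2 (right_ne_zero_of_mul hy))]
          exact (hwsupp y.1 (left_ne_zero_of_mul hy)).2

/-! ### The weighted sum-rate achieved by a policy -/

theorem finset_fin_two_cases (S : Finset (Fin 2)) :
    S = ∅ ∨ S = {0} ∨ S = {1} ∨ S = Finset.univ := by
  revert S
  decide

theorem rate_empty (ν : Measure Fading) (P : Policy) (j : Fin 2) : rate ν P j ∅ = 0 := by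
  simp [rate, cap]

theorem rate_singleton_le_univ {ν : Measure Fading} {Pbar : Fin 2 → ℝ}
    (hν : IsAdmissible ν Pbar) {P : Policy} (hP : P ∈ allocations ν) (j k : Fin 2) :
    rate ν P j {k} ≤ rate ν P j Finset.univ := by
  rw [rate_eq, rate_eq]
  refine div_le_div_of_nonneg_right ?_ log_two_pos.le
  refine integral_mono (integrable_log_received hν hP j _) (integrable_log_received hν hP j _)
    fun h => ?_
  have h0 := received_nonneg j {k} h (p := powers P h) fun k => (hP k).2.1 h
  refine Real.log_le_log (by linarith) ?_
  gcongr
  exact Finset.sum_le_sum_of_subset_of_nonneg (Finset.subset_univ _) fun i _ _ =>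
    mul_nonneg (gain_nonneg j i h) ((hP i).2.1 h)

theorem rate_univ_le_add {ν : Measure Fading} {Pbar : Fin 2 → ℝ}
    (hν : IsAdmissible ν Pbar) {P : Policy} (hP : P ∈ allocations ν) (j : Fin 2) :
    rate ν P j Finset.univ ≤ rate ν P j {0} + rate ν P j {1} := by
  have i0 := integrable_log_received hν hP j {0}
  have i1 := integrable_log_received hν hP j {1}
  rw [rate_eq, rate_eq, rate_eq, ← add_div, ← integral_add i0 i1]
  refine div_le_div_of_nonneg_right ?_ log_two_pos.le
  refine integral_mono (integrable_log_received hν hP j _) (i0.add i1) fun h => ?_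
  have a0 := received_nonneg j {0} h (p := powers P h) fun k => (hP k).2.1 h
  have a1 := received_nonneg j {1} h (p := powers P h) fun k => (hP k).2.1 h
  have au : received j Finset.univ h (powers P h) =
      received j {0} h (powers P h) + received j {1} h (powers P h) := by
    simp [received]
  simp only [au]
  rw [← Real.log_mul (by linarith) (by linarith)]
  exact Real.log_le_log (by linarith) (by nlinarith)

theorem sumRate_b1 (ν : Measure Fading) (P : Policy) :
    sumRate ν P .b1 = rate ν P 0 {0} + rate ν P 1 {1} := by
  simp [sumRate]

theorem sumRate_b2 (ν : Measure Fading) (P : Policy) :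
    sumRate ν P .b2 = rate ν P 1 {0} + rate ν P 0 {1} := by
  simp [sumRate]

theorem sumRate_b3a_le {ν : Measure Fading} {Pbar : Fin 2 → ℝ} (hν : IsAdmissible ν Pbar)
    {P : Policy} (hP : P ∈ allocations ν) :
    sumRate ν P .b3a ≤ rate ν P 1 {0} + rate ν P 1 {1} :=
  rate_univ_le_add hν hP 1

theorem sumRate_b3b_le {ν : Measure Fading} {Pbar : Fin 2 → ℝ} (hν : IsAdmissible ν Pbar)
    {P : Policy} (hP : P ∈ allocations ν) :
    sumRate ν P .b3b ≤ rate ν P 0 {0} + rate ν P 0 {1} :=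
  rate_univ_le_add hν hP 0

theorem weightedRate_b1 (ν : Measure Fading) (μ : Fin 2 → ℝ) (P : Policy) :
    weightedRate ν μ P .b1 = μ 0 * sumRate ν P .b1 + (μ 1 - μ 0) * rate ν P 1 {1} := by
  simp only [weightedRate, sumRate, Fin.sum_univ_two]
  ring

theorem weightedRate_b2 (ν : Measure Fading) (μ : Fin 2 → ℝ) (P : Policy) :
    weightedRate ν μ P .b2 = μ 0 * sumRate ν P .b2 + (μ 1 - μ 0) * rate ν P 0 {1} := by
  simp only [weightedRate, sumRate, Fin.sum_univ_two, other_zero, other_one]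
  ring

/-- The largest weighted sum-rate that the policy `P` achieves. -/
def policyValue (ν : Measure Fading) (μ : Fin 2 → ℝ) (P : Policy) : ℝ :=
  (Finset.univ : Finset Basic).inf' ⟨.b1, Finset.mem_univ _⟩ (weightedRate ν μ P)

theorem policyValue_le (ν : Measure Fading) (μ : Fin 2 → ℝ) (P : Policy) (a : Basic) :
    policyValue ν μ P ≤ weightedRate ν μ P a :=
  Finset.inf'_le _ (Finset.mem_univ a)

theorem exists_weightedRate_eq_policyValue (ν : Measure Fading) (μ : Fin 2 → ℝ) (P : Policy) :
    ∃ a, policyValue ν μ P = weightedRate ν μ P a := by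
  obtain ⟨a, -, ha⟩ := Finset.exists_mem_eq_inf' (s := (Finset.univ : Finset Basic))
    ⟨.b1, Finset.mem_univ _⟩ (weightedRate ν μ P)
  exact ⟨a, ha⟩

/-- The bounds of the pentagons, applied to `μ₁ (R₁ + R₂) + (μ₂ - μ₁) R₂`. -/
theorem weighted_sum_le_weightedRate {ν : Measure Fading} {μ : Fin 2 → ℝ} (h0 : 0 < μ 0)
    (h1 : μ 0 < μ 1) {P : Policy} {R : Fin 2 → ℝ} (hR : R ∈ macRegion ν P 0 ∩ macRegion ν P 1)
    (a : Basic) : ∑ k, μ k * R k ≤ weightedRate ν μ P a := by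
  have hd : 0 < μ 1 - μ 0 := sub_pos.2 h1
  have hμ1 : 0 < μ 1 := h0.trans h1
  have s00 : R 0 ≤ rate ν P 0 {0} := by simpa using hR.1.2 {0}
  have s01 : R 1 ≤ rate ν P 0 {1} := by simpa using hR.1.2 {1}
  have s10 : R 0 ≤ rate ν P 1 {0} := by simpa using hR.2.2 {0}
  have s11 : R 1 ≤ rate ν P 1 {1} := by simpa using hR.2.2 {1}
  have b0 : R 0 + R 1 ≤ rate ν P 0 Finset.univ := by simpa using hR.1.2 Finset.univ
  have b1 : R 0 + R 1 ≤ rate ν P 1 Finset.univ := by simpa using hR.2.2 Finset.univ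
  have hsum : μ 0 * R 0 + μ 1 * R 1 = μ 0 * (R 0 + R 1) + (μ 1 - μ 0) * R 1 := by ring
  rw [Fin.sum_univ_two]
  cases a
  · simp only [weightedRate, Fin.sum_univ_two]
    gcongr
  · simp only [weightedRate, Fin.sum_univ_two, other_zero, other_one]
    gcongr
  · rw [hsum]
    simp only [weightedRate, sumRate]
    gcongr
    exact le_min s01 s11
  · rw [hsum]
    simp only [weightedRate, sumRate]
    gcongr
    exact le_min s01 s11

/-- The bound `policyValue` is attained: user `2` sends at its largest rate `m`, and user `1` adds
the largest rate `r` that its own bounds and the sum-rates allow. -/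
theorem exists_weighted_sum_eq_policyValue {ν : Measure Fading} {Pbar μ : Fin 2 → ℝ}
    (hν : IsAdmissible ν Pbar) (h0 : 0 < μ 0) (h1 : μ 0 < μ 1) {P : Policy}
    (hP : P ∈ allocations ν) :
    ∃ R ∈ macRegion ν P 0 ∩ macRegion ν P 1, ∑ k, μ k * R k = policyValue ν μ P := by
  set m := min (rate ν P 0 {1}) (rate ν P 1 {1}) with hm
  set B := min (rate ν P 0 Finset.univ) (rate ν P 1 Finset.univ) with hB
  set r := min (min (rate ν P 0 {0}) (rate ν P 1 {0})) (B - m) with hr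
  have hm0 : m ≤ rate ν P 0 {1} := min_le_left _ _
  have hm1 : m ≤ rate ν P 1 {1} := min_le_right _ _
  have hmB : m ≤ B := le_min (hm0.trans (rate_singleton_le_univ hν hP 0 1))
    (hm1.trans (rate_singleton_le_univ hν hP 1 1))
  have hmn : 0 ≤ m := le_min (rate_nonneg hP 0 _) (rate_nonneg hP 1 _)
  have hr0 : r ≤ rate ν P 0 {0} := (min_le_left _ _).trans (min_le_left _ _)
  have hr1 : r ≤ rate ν P 1 {0} := (min_le_left _ _).trans (min_le_right _ _)
  have hrB : r + m ≤ B := by linarith [min_le_right (min (rate ν P 0 {0}) (rate ν P 1 {0})) (B - m)]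
  have hrn : 0 ≤ r := le_min (le_min (rate_nonneg hP 0 _) (rate_nonneg hP 1 _)) (by linarith)
  have hB0 : B ≤ rate ν P 0 Finset.univ := min_le_left _ _
  have hB1 : B ≤ rate ν P 1 Finset.univ := min_le_right _ _
  have hmem : ![r, m] ∈ macRegion ν P 0 ∩ macRegion ν P 1 := by
    refine ⟨⟨Fin.forall_fin_two.2 ⟨hrn, hmn⟩, fun S => ?_⟩,
      ⟨Fin.forall_fin_two.2 ⟨hrn, hmn⟩, fun S => ?_⟩⟩ <;>
    · rcases finset_fin_two_cases S with rfl | rfl | rfl | rfl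
      · simp [rate_empty]
      · simpa using by assumption
      · simpa using by assumption
      · simp only [Fin.sum_univ_two, Matrix.cons_val_zero, Matrix.cons_val_one]
        linarith
  refine ⟨![r, m], hmem, le_antisymm ?_ ?_⟩
  · obtain ⟨a, ha⟩ := exists_weightedRate_eq_policyValue ν μ P
    rw [ha]
    exact weighted_sum_le_weightedRate h0 h1 hmem a
  · have hd : 0 < μ 1 - μ 0 := sub_pos.2 h1
    have p1 := policyValue_le ν μ P .b1
    have p2 := policyValue_le ν μ P .b2
    have pa := policyValue_le ν μ P .b3a
    have pb := policyValue_le ν μ P .b3b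
    have u0 := mul_le_mul_of_nonneg_left (rate_univ_le_add hν hP 0) h0.le
    have u1 := mul_le_mul_of_nonneg_left (rate_univ_le_add hν hP 1) h0.le
    simp only [weightedRate, sumRate, Fin.sum_univ_two, other_zero, other_one, ← hm]
      at p1 p2 pa pb
    simp only [Fin.sum_univ_two, Matrix.cons_val_zero, Matrix.cons_val_one]
    rcases min_choice (min (rate ν P 0 {0}) (rate ν P 1 {0})) (B - m) with e | e
    · rcases min_choice (rate ν P 0 {0}) (rate ν P 1 {0}) with e' | e' <;>
      rcases min_choice (rate ν P 0 {1}) (rate ν P 1 {1}) with e'' | e'' <;>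
      · have hrr := hr.trans (e.trans e')
        have hmm := hm.trans e''
        rw [hrr, hmm]
        rw [hmm] at pa pb
        linarith
    · have hrr : r = B - m := hr.trans e
      rcases min_choice (rate ν P 0 Finset.univ) (rate ν P 1 Finset.univ) with e' | e' <;>
      · have hBB := hB.trans e'
        rw [hrr, hBB]
        linarith

/-- The optimal policies are those with the largest minimum of the four weighted rates. -/
theorem isOptimal_iff_policyValue {ν : Measure Fading} {Pbar μ : Fin 2 → ℝ}
    (hν : IsAdmissible ν Pbar) (h0 : 0 < μ 0) (h1 : μ 0 < μ 1) {P : Policy} :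
    IsOptimal ν Pbar μ P ↔ P ∈ policies ν Pbar ∧
      ∀ Q ∈ policies ν Pbar, policyValue ν μ Q ≤ policyValue ν μ P := by
  constructor
  · rintro ⟨hP, R, hR, hmax⟩
    refine ⟨hP, fun Q hQ => ?_⟩
    obtain ⟨R', hR', he⟩ :=
      exists_weighted_sum_eq_policyValue hν h0 h1 (policies_subset_allocations hQ)
    obtain ⟨a, ha⟩ := exists_weightedRate_eq_policyValue ν μ P
    rw [← he, ha]
    exact (hmax R' (Set.mem_biUnion hQ hR')).trans (weighted_sum_le_weightedRate h0 h1 hR a)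
  · rintro ⟨hP, hmax⟩
    obtain ⟨R, hR, he⟩ :=
      exists_weighted_sum_eq_policyValue hν h0 h1 (policies_subset_allocations hP)
    refine ⟨hP, R, hR, fun R' hR' => ?_⟩
    obtain ⟨Q, hQ, hR''⟩ := Set.mem_iUnion₂.1 hR'
    obtain ⟨a, ha⟩ := exists_weightedRate_eq_policyValue ν μ Q
    rw [he]
    exact (weighted_sum_le_weightedRate h0 h1 hR'' a).trans (ha.symm.le.trans (hmax Q hQ))

theorem isGreatest_policyValue {ν : Measure Fading} {Pbar μ : Fin 2 → ℝ}
    (hν : IsAdmissible ν Pbar) (h0 : 0 < μ 0) (h1 : μ 0 < μ 1) {P : Policy}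
    (hP : P ∈ policies ν Pbar)
    (hmax : ∀ Q ∈ policies ν Pbar, policyValue ν μ Q ≤ policyValue ν μ P) :
    IsGreatest ((fun R : Fin 2 → ℝ => ∑ k, μ k * R k) '' capacityRegion ν Pbar)
      (policyValue ν μ P) := by
  obtain ⟨R, hR, he⟩ :=
    exists_weighted_sum_eq_policyValue hν h0 h1 (policies_subset_allocations hP)
  refine ⟨⟨R, Set.mem_biUnion hP hR, he⟩, ?_⟩
  rintro _ ⟨R', hR', rfl⟩
  obtain ⟨Q, hQ, hR''⟩ := Set.mem_iUnion₂.1 hR'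
  obtain ⟨a, ha⟩ := exists_weightedRate_eq_policyValue ν μ Q
  exact (weighted_sum_le_weightedRate h0 h1 hR'' a).trans (ha.symm.le.trans (hmax Q hQ))

/-- Every case problem, and the problem with all four expressions, has a solution. -/
theorem exists_forall_inf_weightedRate_le {ν : Measure Fading} {Pbar μ : Fin 2 → ℝ}
    (hν : IsAdmissible ν Pbar) (h0 : 0 < μ 0) (h1 : μ 0 < μ 1) {I : Finset Basic}
    (hI : I.Nonempty) :
    ∃ P ∈ policies ν Pbar, ∀ Q ∈ policies ν Pbar,
      I.inf' hI (weightedRate ν μ Q) ≤ I.inf' hI (weightedRate ν μ P) := by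
  have hs : (I ×ˢ (Finset.univ : Finset (Fin 2))).Nonempty := hI.product ⟨0, Finset.mem_univ 0⟩
  obtain ⟨P, hP, hmax⟩ := exists_forall_inf_mixedRate_le hν hs
    (C := fun x : Basic × Fin 2 => coef μ x.1 x.2) fun x => coef_nonneg h0 h1 x.1 x.2
  have heq : ∀ Q, (I ×ˢ (Finset.univ : Finset (Fin 2))).inf' hs
      (fun x => mixedRate ν (coef μ x.1 x.2) Q) = I.inf' hI (weightedRate ν μ Q) := by
    intro Q
    refine le_antisymm (Finset.le_inf' _ _ fun a ha => ?_) (Finset.le_inf' _ _ fun x hx => ?_)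
    · obtain ⟨i, hi⟩ := exists_minimizer ν Q
      rw [← mixedRate_coef_eq_of_minimizer hi a]
      exact Finset.inf'_le (fun x : Basic × Fin 2 => mixedRate ν (coef μ x.1 x.2) Q)
        (b := (a, i)) (by simp [ha])
    · exact (Finset.inf'_le _ (Finset.mem_product.1 hx).1).trans
        (weightedRate_le_mixedRate h1 Q x.1 x.2)
  refine ⟨P, hP, fun Q hQ => ?_⟩
  rw [← heq, ← heq]
  exact hmax Q hQ

/-! ### The conditions of the cases -/

/-- The conditions of the cases without the weights: in the inactive and boundary cases the binding
single-user rates are the smaller ones for both users, and equality of the binding weighted rates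
becomes equality of the sum-rates. -/
def ReducedCondition (ν : Measure Fading) (P : Policy) : Case → Prop
  | .c1 => (rate ν P 0 {0} < rate ν P 1 {0} ∧ rate ν P 1 {1} < rate ν P 0 {1}) ∧
      sumRate ν P .b1 < sumRate ν P .b3a ∧ sumRate ν P .b1 < sumRate ν P .b3b
  | .c2 => (rate ν P 1 {0} < rate ν P 0 {0} ∧ rate ν P 0 {1} < rate ν P 1 {1}) ∧
      sumRate ν P .b2 < sumRate ν P .b3a ∧ sumRate ν P .b2 < sumRate ν P .b3b
  | .c3a => sumRate ν P .b3a < sumRate ν P .b3b ∧ sumRate ν P .b3a < sumRate ν P .b1 ∧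
      sumRate ν P .b3a < sumRate ν P .b2
  | .c3b => sumRate ν P .b3b < sumRate ν P .b3a ∧ sumRate ν P .b3b < sumRate ν P .b1 ∧
      sumRate ν P .b3b < sumRate ν P .b2
  | .c3c => sumRate ν P .b3a = sumRate ν P .b3b ∧ sumRate ν P .b3b < sumRate ν P .b1 ∧
      sumRate ν P .b3b < sumRate ν P .b2
  | .c13a => (rate ν P 0 {0} ≤ rate ν P 1 {0} ∧ rate ν P 1 {1} ≤ rate ν P 0 {1}) ∧
      sumRate ν P .b1 = sumRate ν P .b3a ∧ sumRate ν P .b3a < sumRate ν P .b3b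
  | .c23a => (rate ν P 1 {0} ≤ rate ν P 0 {0} ∧ rate ν P 0 {1} ≤ rate ν P 1 {1}) ∧
      sumRate ν P .b2 = sumRate ν P .b3a ∧ sumRate ν P .b3a < sumRate ν P .b3b
  | .c13b => (rate ν P 0 {0} ≤ rate ν P 1 {0} ∧ rate ν P 1 {1} ≤ rate ν P 0 {1}) ∧
      sumRate ν P .b1 = sumRate ν P .b3b ∧ sumRate ν P .b3b < sumRate ν P .b3a
  | .c23b => (rate ν P 1 {0} ≤ rate ν P 0 {0} ∧ rate ν P 0 {1} ≤ rate ν P 1 {1}) ∧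
      sumRate ν P .b2 = sumRate ν P .b3b ∧ sumRate ν P .b3b < sumRate ν P .b3a
  | .c13c => (rate ν P 0 {0} ≤ rate ν P 1 {0} ∧ rate ν P 1 {1} ≤ rate ν P 0 {1}) ∧
      sumRate ν P .b1 = sumRate ν P .b3a ∧ sumRate ν P .b3a = sumRate ν P .b3b
  | .c23c => (rate ν P 1 {0} ≤ rate ν P 0 {0} ∧ rate ν P 0 {1} ≤ rate ν P 1 {1}) ∧
      sumRate ν P .b2 = sumRate ν P .b3a ∧ sumRate ν P .b3a = sumRate ν P .b3b

theorem weighted_lt {a d s s' t t' : ℝ} (ha : 0 < a) (hd : 0 < d) (hs : s < s') (ht : t ≤ t') :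
    a * s + d * t < a * s' + d * t' :=
  add_lt_add_of_lt_of_le (mul_lt_mul_of_pos_left hs ha) (mul_le_mul_of_nonneg_left ht hd.le)

theorem weighted_le {a d s s' t t' : ℝ} (ha : 0 < a) (hd : 0 < d) (hs : s ≤ s') (ht : t ≤ t') :
    a * s + d * t ≤ a * s' + d * t' :=
  add_le_add (mul_le_mul_of_nonneg_left hs ha.le) (mul_le_mul_of_nonneg_left ht hd.le)

theorem weighted_cancel {a d s s' t t' : ℝ} (ha : 0 < a) (h : a * s + d * t = a * s' + d * t')
    (ht : t = t') : s = s' := by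
  subst ht
  exact mul_left_cancel₀ ha.ne' (add_right_cancel h)

theorem reducedCondition_of_caseCondition {ν : Measure Fading} {Pbar μ : Fin 2 → ℝ}
    (hν : IsAdmissible ν Pbar) (h0 : 0 < μ 0) (h1 : μ 0 < μ 1) {P : Policy}
    (hP : P ∈ allocations ν) {x : Case} (h : CaseCondition ν μ x P) :
    ReducedCondition ν P x := by
  obtain ⟨heq, hx⟩ := h
  have hd : 0 < μ 1 - μ 0 := sub_pos.2 h1
  have f1 := sumRate_b1 ν P
  have f2 := sumRate_b2 ν P
  have fa := sumRate_b3a_le hν hP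
  have fb := sumRate_b3b_le hν hP
  have w1 := weightedRate_b1 ν μ P
  have w2 := weightedRate_b2 ν μ P
  have wa : weightedRate ν μ P .b3a = μ 0 * sumRate ν P .b3a +
    (μ 1 - μ 0) * min (rate ν P 0 {1}) (rate ν P 1 {1}) := rfl
  have wb : weightedRate ν μ P .b3b = μ 0 * sumRate ν P .b3b +
    (μ 1 - μ 0) * min (rate ν P 0 {1}) (rate ν P 1 {1}) := rfl
  cases x <;> simp only [SumRateCondition, lt_min_iff] at hx <;> simp only [ReducedCondition]
  case c1 => exact ⟨⟨by linarith, by linarith⟩, hx⟩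
  case c2 => exact ⟨⟨by linarith, by linarith⟩, hx⟩
  case c3a => exact hx
  case c3b => exact hx
  case c3c => exact hx
  case c13a =>
    have e := heq .b1 (by simp [Case.parts]) .b3a (by simp [Case.parts])
    rw [w1, wa, min_eq_right (by linarith)] at e
    have := weighted_cancel h0 e rfl
    exact ⟨⟨by linarith, by linarith⟩, this, hx.1⟩
  case c23a =>
    have e := heq .b2 (by simp [Case.parts]) .b3a (by simp [Case.parts])
    rw [w2, wa] at e
    rcases le_or_gt (rate ν P 0 {1}) (rate ν P 1 {1}) with hle | hlt
    · rw [min_eq_left hle] at e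
      have := weighted_cancel h0 e rfl
      exact ⟨⟨by linarith, hle⟩, this, hx.1⟩
    · have := weighted_lt h0 hd (s := sumRate ν P .b3a) (s' := sumRate ν P .b2)
        (by linarith) (min_le_left (rate ν P 0 {1}) (rate ν P 1 {1}))
      linarith
  case c13b =>
    have e := heq .b1 (by simp [Case.parts]) .b3b (by simp [Case.parts])
    rw [w1, wb] at e
    rcases le_or_gt (rate ν P 1 {1}) (rate ν P 0 {1}) with hle | hlt
    · rw [min_eq_right hle] at e
      have := weighted_cancel h0 e rfl
      exact ⟨⟨by linarith, hle⟩, this, hx.1⟩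
    · have := weighted_lt h0 hd (s := sumRate ν P .b3b) (s' := sumRate ν P .b1)
        (by linarith) (min_le_right (rate ν P 0 {1}) (rate ν P 1 {1}))
      linarith
  case c23b =>
    have e := heq .b2 (by simp [Case.parts]) .b3b (by simp [Case.parts])
    rw [w2, wb, min_eq_left (by linarith)] at e
    have := weighted_cancel h0 e rfl
    exact ⟨⟨by linarith, by linarith⟩, this, hx.1⟩
  case c13c => exact ⟨⟨by linarith, by linarith⟩, by linarith, hx.1⟩
  case c23c => exact ⟨⟨by linarith, by linarith⟩, by linarith, hx.1⟩

/-- The binding weighted rates of a case are the smallest ones. -/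
theorem weightedRate_le_of_reducedCondition {ν : Measure Fading} {μ : Fin 2 → ℝ}
    (h0 : 0 < μ 0) (h1 : μ 0 < μ 1) {P : Policy} {x : Case} (h : ReducedCondition ν P x)
    {a : Basic} (ha : a ∈ x.parts) (b : Basic) :
    weightedRate ν μ P a ≤ weightedRate ν μ P b := by
  have hd : 0 < μ 1 - μ 0 := sub_pos.2 h1
  have f1 := sumRate_b1 ν P
  have f2 := sumRate_b2 ν P
  have wa : weightedRate ν μ P .b3a = μ 0 * sumRate ν P .b3a +
    (μ 1 - μ 0) * min (rate ν P 0 {1}) (rate ν P 1 {1}) := rfl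
  have wb : weightedRate ν μ P .b3b = μ 0 * sumRate ν P .b3b +
    (μ 1 - μ 0) * min (rate ν P 0 {1}) (rate ν P 1 {1}) := rfl
  have m0 := min_le_left (rate ν P 0 {1}) (rate ν P 1 {1})
  have m1 := min_le_right (rate ν P 0 {1}) (rate ν P 1 {1})
  have mr : rate ν P 1 {1} ≤ rate ν P 0 {1} →
    rate ν P 1 {1} ≤ min (rate ν P 0 {1}) (rate ν P 1 {1}) := fun h => le_min h le_rfl
  have ml : rate ν P 0 {1} ≤ rate ν P 1 {1} →
    rate ν P 0 {1} ≤ min (rate ν P 0 {1}) (rate ν P 1 {1}) := fun h => le_min le_rfl h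
  cases x <;> simp only [ReducedCondition] at h <;>
    simp only [Case.parts, Finset.mem_insert, Finset.mem_singleton] at ha
  case c1 | c13a | c13b | c13c =>
    have := mr (by linarith)
    rcases ha with rfl | rfl | rfl <;> cases b <;>
      simp only [weightedRate_b1, weightedRate_b2, wa, wb] <;>
      exact weighted_le h0 hd (by linarith) (by linarith)
  case c2 | c23a | c23b | c23c =>
    have := ml (by linarith)
    rcases ha with rfl | rfl | rfl <;> cases b <;>
      simp only [weightedRate_b1, weightedRate_b2, wa, wb] <;>
      exact weighted_le h0 hd (by linarith) (by linarith)
  all_goals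
    rcases ha with rfl | rfl <;> cases b <;>
      simp only [weightedRate_b1, weightedRate_b2, wa, wb] <;>
      exact weighted_le h0 hd (by linarith) (by linarith)

theorem caseCondition_of_reducedCondition {ν : Measure Fading} {Pbar μ : Fin 2 → ℝ}
    (hν : IsAdmissible ν Pbar) (h0 : 0 < μ 0) (h1 : μ 0 < μ 1) {P : Policy}
    (hP : P ∈ allocations ν) {x : Case} (h : ReducedCondition ν P x) :
    CaseCondition ν μ x P := by
  refine ⟨fun a ha b hb => le_antisymm (weightedRate_le_of_reducedCondition h0 h1 h ha b)
    (weightedRate_le_of_reducedCondition h0 h1 h hb a), ?_⟩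
  have f1 := sumRate_b1 ν P
  have f2 := sumRate_b2 ν P
  have fa := sumRate_b3a_le hν hP
  have fb := sumRate_b3b_le hν hP
  cases x <;> simp only [ReducedCondition] at h <;> simp only [SumRateCondition, lt_min_iff]
  case c1 | c2 => exact h.2
  case c3a | c3b | c3c => exact h
  case c13c | c23c => exact ⟨h.2.2, by linarith, by linarith⟩
  all_goals exact ⟨h.2.2, by linarith⟩

theorem caseRate_eq_policyValue {ν : Measure Fading} {μ : Fin 2 → ℝ}
    (h0 : 0 < μ 0) (h1 : μ 0 < μ 1) {P : Policy} {x : Case} (h : ReducedCondition ν P x) :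
    caseRate ν μ x P = policyValue ν μ P := by
  refine le_antisymm (Finset.le_inf' _ _ fun b _ => ?_)
    (Finset.le_inf' _ _ fun a _ => policyValue_le ν μ P a)
  obtain ⟨a, ha⟩ := x.parts_nonempty
  exact (Finset.inf'_le _ ha).trans (weightedRate_le_of_reducedCondition h0 h1 h ha b)

theorem policyValue_le_caseRate (ν : Measure Fading) (μ : Fin 2 → ℝ) (x : Case) (P : Policy) :
    policyValue ν μ P ≤ caseRate ν μ x P :=
  Finset.le_inf' _ _ fun a _ => policyValue_le ν μ P a

/-- The conditions of two different cases exclude each other, unless all sum-rates agree. -/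
theorem eq_or_sumRate_eq_of_reducedCondition {ν : Measure Fading} {Pbar : Fin 2 → ℝ}
    (hν : IsAdmissible ν Pbar) {P : Policy} (hP : P ∈ allocations ν) {x y : Case}
    (hx : ReducedCondition ν P x) (hy : ReducedCondition ν P y) :
    x = y ∨ ∀ a b, sumRate ν P a = sumRate ν P b := by
  have f1 := sumRate_b1 ν P
  have f2 := sumRate_b2 ν P
  have fa := sumRate_b3a_le hν hP
  have fb := sumRate_b3b_le hν hP
  by_cases hxy : x = y
  · exact .inl hxy
  refine .inr ?_
  cases x <;> cases y <;> first
    | exact absurd rfl hxy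
    | (simp only [ReducedCondition] at hx hy
       exfalso
       linarith)
    | (simp only [ReducedCondition] at hx hy
       intro a b
       cases a <;> cases b <;> linarith)

/-- A case rate is a minimum of fewer weighted rates than `policyValue`, so it is an upper bound for
the latter, and under the conditions of the case this bound is tight. -/
theorem selects_imp_policyValue_max {ν : Measure Fading} {Pbar μ : Fin 2 → ℝ}
    (hν : IsAdmissible ν Pbar) (h0 : 0 < μ 0) (h1 : μ 0 < μ 1) {x : Case} {P : Policy}
    (h : Selects ν Pbar μ x P) :
    caseRate ν μ x P = policyValue ν μ P ∧
      ∀ Q ∈ policies ν Pbar, policyValue ν μ Q ≤ policyValue ν μ P := by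
  obtain ⟨⟨hP, hmax⟩, hcond⟩ := h
  have he := caseRate_eq_policyValue h0 h1
    (reducedCondition_of_caseCondition hν h0 h1 (policies_subset_allocations hP) hcond)
  exact ⟨he, fun Q hQ => he ▸ (policyValue_le_caseRate ν μ x Q).trans (hmax Q hQ)⟩

/-! ### Every optimal policy is selected by a case -/

/-- An optimal policy solves the problem of every case that contains all its smallest expressions,
since its multipliers are carried by these. -/
theorem isCaseOptimal_of_binding_subset {ν : Measure Fading} {Pbar μ : Fin 2 → ℝ}
    (hν : IsAdmissible ν Pbar) (h0 : 0 < μ 0) (h1 : μ 0 < μ 1) {x : Case} {P : Policy}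
    (hP : P ∈ policies ν Pbar)
    (hmax : ∀ Q ∈ policies ν Pbar, policyValue ν μ Q ≤ policyValue ν μ P)
    (hx : ∀ a, weightedRate ν μ P a ≤ policyValue ν μ P → a ∈ x.parts) :
    IsCaseOptimal ν Pbar μ x P := by
  obtain ⟨θ, l, hθ0, hθ1, hsupp, hl, hst, hfull⟩ :=
    exists_isStationary hν h0 h1 ⟨.b1, Finset.mem_univ _⟩ hP hmax
  refine ⟨hP, fun Q hQ => ?_⟩
  calc caseRate ν μ x Q ≤ mixedRate ν (mixCoef μ θ) Q :=
        inf_weightedRate_le_mixedRate h1 x.parts_nonempty hθ0 hθ1 (fun y hy => hx _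
          ((weightedRate_le_mixedRate h1 P y.1 y.2).trans (hsupp y hy).2.le)) Q
    _ ≤ mixedRate ν (mixCoef μ θ) P :=
        hst.mixedRate_le_of_mem_policies hν (mixCoef_nonneg h0 h1 hθ0) hl hP hQ hfull
    _ = policyValue ν μ P := mixedRate_eq_of_support hθ1 fun y hy => (hsupp y hy).2
    _ ≤ caseRate ν μ x P := policyValue_le_caseRate ν μ x P

/-- If all expressions tie at an optimal policy, then the policy solves the problem of `(1,3c)` or
that of `(2,3c)`. The reason is that `S^{(3a)} + S^{(3b)}` with the single-user rates at receivers
`1` and `2` is at most `S^{(1)} + S^{(2)}`, so that the same weight can be moved from `1` and `2`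
to `3a` and `3b` until one of `1` and `2` has none left. -/
theorem isCaseOptimal_of_tie {ν : Measure Fading} {Pbar μ : Fin 2 → ℝ}
    (hν : IsAdmissible ν Pbar) (h0 : 0 < μ 0) (h1 : μ 0 < μ 1) {P : Policy}
    (hP : P ∈ policies ν Pbar)
    (hmax : ∀ Q ∈ policies ν Pbar, policyValue ν μ Q ≤ policyValue ν μ P) :
    IsCaseOptimal ν Pbar μ .c13c P ∨ IsCaseOptimal ν Pbar μ .c23c P := by
  obtain ⟨θ, l, hθ0, hθ1, hsupp, hl, hst, hfull⟩ :=
    exists_isStationary hν h0 h1 ⟨.b1, Finset.mem_univ _⟩ hP hmax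
  have hle : ∀ Q ∈ policies ν Pbar, mixedRate ν (mixCoef μ θ) Q ≤ policyValue ν μ P := by
    intro Q hQ
    refine (hst.mixedRate_le_of_mem_policies hν (mixCoef_nonneg h0 h1 hθ0) hl hP hQ hfull).trans
      (le_of_eq ?_)
    exact mixedRate_eq_of_support hθ1 fun y hy => (hsupp y hy).2
  have hsum := hθ1
  simp only [Fintype.sum_prod_type, sum_basic, Fin.sum_univ_two] at hsum
  have hexp : ∀ Q, mixedRate ν (mixCoef μ θ) Q =
      (θ (.b1, 0) + θ (.b1, 1)) * weightedRate ν μ Q .b1 +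
      (θ (.b2, 0) + θ (.b2, 1)) * weightedRate ν μ Q .b2 +
      (θ (.b3a, 0) * mixedRate ν (coef μ .b3a 0) Q +
        θ (.b3a, 1) * mixedRate ν (coef μ .b3a 1) Q) +
      (θ (.b3b, 0) * mixedRate ν (coef μ .b3b 0) Q +
        θ (.b3b, 1) * mixedRate ν (coef μ .b3b 1) Q) := by
    intro Q
    rw [mixedRate_mixCoef]
    simp only [Fintype.sum_prod_type, sum_basic, Fin.sum_univ_two, mixedRate_coef_b1,
      mixedRate_coef_b2]
    ring
  have hswap : ∀ Q ∈ policies ν Pbar,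
      mixedRate ν (coef μ .b3a 1) Q + mixedRate ν (coef μ .b3b 0) Q ≤
        weightedRate ν μ Q .b1 + weightedRate ν μ Q .b2 := by
    intro Q hQ
    have hQa := policies_subset_allocations hQ
    rw [mixedRate_coef_b3a, mixedRate_coef_b3b, weightedRate_b1, weightedRate_b2]
    have := mul_le_mul_of_nonneg_left (add_le_add (sumRate_b3a_le hν hQa)
      (sumRate_b3b_le hν hQa)) h0.le
    rw [sumRate_b1, sumRate_b2]
    linarith
  set u := θ (.b1, 0) + θ (.b1, 1) with hu
  set v := θ (.b2, 0) + θ (.b2, 1) with hv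
  have hu0 : 0 ≤ u := add_nonneg (hθ0 _) (hθ0 _)
  have hv0 : 0 ≤ v := add_nonneg (hθ0 _) (hθ0 _)
  have t1 := hθ0 (.b3a, 0)
  have t2 := hθ0 (.b3a, 1)
  have t3 := hθ0 (.b3b, 0)
  have t4 := hθ0 (.b3b, 1)
  rcases le_total v u with huv | huv
  · refine .inl ⟨hP, fun Q hQ => (?_ : _ ≤ policyValue ν μ P).trans
      (policyValue_le_caseRate ν μ _ P)⟩
    set r := caseRate ν μ .c13c Q with hr
    have hra : ∀ a ∈ Case.c13c.parts, r ≤ weightedRate ν μ Q a := fun a ha => Finset.inf'_le _ ha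
    have r1 := hra .b1 (by simp [Case.parts])
    have ra := fun i => (hra .b3a (by simp [Case.parts])).trans
      (weightedRate_le_mixedRate h1 Q .b3a i)
    have rb := fun i => (hra .b3b (by simp [Case.parts])).trans
      (weightedRate_le_mixedRate h1 Q .b3b i)
    refine le_trans ?_ (hle Q hQ)
    rw [hexp]
    linear_combination v * hswap Q hQ + (u - v) * r1 + v * ra 1 + v * rb 0 +
      θ (.b3a, 0) * ra 0 + θ (.b3a, 1) * ra 1 + θ (.b3b, 0) * rb 0 + θ (.b3b, 1) * rb 1 -
      r * hsum
  · refine .inr ⟨hP, fun Q hQ => (?_ : _ ≤ policyValue ν μ P).trans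
      (policyValue_le_caseRate ν μ _ P)⟩
    set r := caseRate ν μ .c23c Q with hr
    have hra : ∀ a ∈ Case.c23c.parts, r ≤ weightedRate ν μ Q a := fun a ha => Finset.inf'_le _ ha
    have r1 := hra .b2 (by simp [Case.parts])
    have ra := fun i => (hra .b3a (by simp [Case.parts])).trans
      (weightedRate_le_mixedRate h1 Q .b3a i)
    have rb := fun i => (hra .b3b (by simp [Case.parts])).trans
      (weightedRate_le_mixedRate h1 Q .b3b i)
    refine le_trans ?_ (hle Q hQ)
    rw [hexp]
    linear_combination u * hswap Q hQ + (v - u) * r1 + u * ra 1 + u * rb 0 +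
      θ (.b3a, 0) * ra 0 + θ (.b3a, 1) * ra 1 + θ (.b3b, 0) * rb 0 + θ (.b3b, 1) * rb 1 -
      r * hsum

/-- Every policy satisfies the conditions of a case that contains all its smallest expressions,
unless all expressions tie, when it satisfies the conditions of both `(1,3c)` and `(2,3c)`. -/
theorem exists_reducedCondition {ν : Measure Fading} {Pbar μ : Fin 2 → ℝ}
    (hν : IsAdmissible ν Pbar) (h0 : 0 < μ 0) (h1 : μ 0 < μ 1) {P : Policy}
    (hP : P ∈ allocations ν) :
    (∃ x, ReducedCondition ν P x ∧
      ∀ a, weightedRate ν μ P a ≤ policyValue ν μ P → a ∈ x.parts) ∨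
    (ReducedCondition ν P .c13c ∧ ReducedCondition ν P .c23c) := by
  have hd : 0 < μ 1 - μ 0 := sub_pos.2 h1
  have f1 := sumRate_b1 ν P
  have f2 := sumRate_b2 ν P
  have fa := sumRate_b3a_le hν hP
  have fb := sumRate_b3b_le hν hP
  have w1 := weightedRate_b1 ν μ P
  have w2 := weightedRate_b2 ν μ P
  have wa : weightedRate ν μ P .b3a = μ 0 * sumRate ν P .b3a +
    (μ 1 - μ 0) * min (rate ν P 0 {1}) (rate ν P 1 {1}) := rfl
  have wb : weightedRate ν μ P .b3b = μ 0 * sumRate ν P .b3b +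
    (μ 1 - μ 0) * min (rate ν P 0 {1}) (rate ν P 1 {1}) := rfl
  have m0 := min_le_left (rate ν P 0 {1}) (rate ν P 1 {1})
  have m1 := min_le_right (rate ν P 0 {1}) (rate ν P 1 {1})
  have p1 := policyValue_le ν μ P .b1
  have p2 := policyValue_le ν μ P .b2
  have pa := policyValue_le ν μ P .b3a
  have pb := policyValue_le ν μ P .b3b
  set v := policyValue ν μ P with hv
  set A00 := rate ν P 0 {0}
  set A01 := rate ν P 0 {1}
  set A10 := rate ν P 1 {0}
  set A11 := rate ν P 1 {1}
  set m := min A01 A11 with hm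
  set S1 := sumRate ν P .b1
  set S2 := sumRate ν P .b2
  set Sa := sumRate ν P .b3a
  set Sb := sumRate ν P .b3b
  have hsub : ∀ x : Case, (∀ a, a ∉ x.parts → v < weightedRate ν μ P a) →
      ∀ a, weightedRate ν μ P a ≤ v → a ∈ x.parts := fun x hx a ha => by
    by_contra hna
    exact absurd (hx a hna) (not_lt.2 ha)
  -- if `1` is smallest, then comparison with `3b` and `3a` shows that both users have their smaller
  -- single-user rate in `1`
  by_cases hv1 : weightedRate ν μ P .b1 = v
  · have o1 : A11 ≤ A01 := by
      by_contra! hlt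
      have := weighted_lt h0 hd (s := Sb) (s' := S1) (t := m) (t' := A11) (by linarith) m1
      linarith
    have hmA : m = A11 := min_eq_right o1
    have o2 : A00 ≤ A10 := by
      by_contra! hlt
      have := weighted_lt h0 hd (s := Sa) (s' := S1) (t := m) (t' := A11) (by linarith) m1
      linarith
    rw [hmA] at wa wb
    have o3 : S1 ≤ Sa := by
      by_contra! hlt
      have := weighted_lt h0 hd hlt (le_refl A11)
      linarith
    have o4 : S1 ≤ Sb := by
      by_contra! hlt
      have := weighted_lt h0 hd hlt (le_refl A11)
      linarith
    have ha : S1 < Sa → v < weightedRate ν μ P .b3a := fun h => by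
      have := weighted_lt h0 hd h (le_refl A11)
      linarith
    have hb : S1 < Sb → v < weightedRate ν μ P .b3b := fun h => by
      have := weighted_lt h0 hd h (le_refl A11)
      linarith
    have h2 : S1 < S2 → v < weightedRate ν μ P .b2 := fun h => by
      have := weighted_lt h0 hd h o1
      linarith
    rcases o3.eq_or_lt with e3 | l3 <;> rcases o4.eq_or_lt with e4 | l4
    · by_cases ht : A10 ≤ A00 ∧ A01 ≤ A11
      · exact .inr ⟨⟨⟨o2, o1⟩, e3, by linarith⟩, ⟨ht, by linarith, by linarith⟩⟩
      · have hlt : S1 < S2 := by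
          by_contra! hle
          exact ht ⟨by linarith, by linarith⟩
        refine .inl ⟨.c13c, ⟨⟨o2, o1⟩, e3, by linarith⟩, hsub _ fun a hna => ?_⟩
        cases a
        case b2 => exact h2 hlt
        all_goals exact absurd (by simp [Case.parts]) hna
    · refine .inl ⟨.c13a, ⟨⟨o2, o1⟩, e3, by linarith⟩, hsub _ fun a hna => ?_⟩
      cases a
      case b2 => exact h2 (by linarith)
      case b3b => exact hb l4
      all_goals exact absurd (by simp [Case.parts]) hna
    · refine .inl ⟨.c13b, ⟨⟨o2, o1⟩, e4, by linarith⟩, hsub _ fun a hna => ?_⟩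
      cases a
      case b2 => exact h2 (by linarith)
      case b3a => exact ha l3
      all_goals exact absurd (by simp [Case.parts]) hna
    · refine .inl ⟨.c1, ⟨⟨by linarith, by linarith⟩, l3, l4⟩, hsub _ fun a hna => ?_⟩
      cases a
      case b1 => exact absurd (by simp [Case.parts]) hna
      case b2 => exact h2 (by linarith)
      case b3a => exact ha l3
      case b3b => exact hb l4
  have l1 : v < weightedRate ν μ P .b1 := p1.lt_of_ne' hv1
  by_cases hv2 : weightedRate ν μ P .b2 = v
  · have o1 : A01 ≤ A11 := by
      by_contra! hlt
      have := weighted_lt h0 hd (s := Sa) (s' := S2) (t := m) (t' := A01) (by linarith) m0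
      linarith
    have hmA : m = A01 := min_eq_left o1
    have o2 : A10 ≤ A00 := by
      by_contra! hlt
      have := weighted_lt h0 hd (s := Sb) (s' := S2) (t := m) (t' := A01) (by linarith) m0
      linarith
    rw [hmA] at wa wb
    have o3 : S2 ≤ Sa := by
      by_contra! hlt
      have := weighted_lt h0 hd hlt (le_refl A01)
      linarith
    have o4 : S2 ≤ Sb := by
      by_contra! hlt
      have := weighted_lt h0 hd hlt (le_refl A01)
      linarith
    have ha : S2 < Sa → v < weightedRate ν μ P .b3a := fun h => by
      have := weighted_lt h0 hd h (le_refl A01)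
      linarith
    have hb : S2 < Sb → v < weightedRate ν μ P .b3b := fun h => by
      have := weighted_lt h0 hd h (le_refl A01)
      linarith
    rcases o3.eq_or_lt with e3 | l3 <;> rcases o4.eq_or_lt with e4 | l4
    · refine .inl ⟨.c23c, ⟨⟨o2, o1⟩, e3, by linarith⟩, hsub _ fun a hna => ?_⟩
      cases a
      case b1 => exact l1
      all_goals exact absurd (by simp [Case.parts]) hna
    · refine .inl ⟨.c23a, ⟨⟨o2, o1⟩, e3, by linarith⟩, hsub _ fun a hna => ?_⟩
      cases a
      case b1 => exact l1
      case b3b => exact hb l4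
      all_goals exact absurd (by simp [Case.parts]) hna
    · refine .inl ⟨.c23b, ⟨⟨o2, o1⟩, e4, by linarith⟩, hsub _ fun a hna => ?_⟩
      cases a
      case b1 => exact l1
      case b3a => exact ha l3
      all_goals exact absurd (by simp [Case.parts]) hna
    · refine .inl ⟨.c2, ⟨⟨by linarith, by linarith⟩, l3, l4⟩, hsub _ fun a hna => ?_⟩
      cases a
      case b1 => exact l1
      case b2 => exact absurd (by simp [Case.parts]) hna
      case b3a => exact ha l3
      case b3b => exact hb l4
  have l2 : v < weightedRate ν μ P .b2 := p2.lt_of_ne' hv2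
  -- an expression `3a` or `3b` that is smaller than `1` and `2` also has the smaller sum-rate:
  -- otherwise the minimum `m` would be strictly smaller than the single-user rate in `1` or `2`
  have key1 : ∀ s, s ≤ Sb → μ 0 * s + (μ 1 - μ 0) * m < weightedRate ν μ P .b1 → s < S1 := by
    intro s hs hlt
    by_contra! hle
    rcases le_or_gt A11 A01 with h | h
    · have := weighted_le h0 hd hle (min_eq_right h : m = A11).ge
      linarith
    · linarith
  have key2 : ∀ s, s ≤ Sa → μ 0 * s + (μ 1 - μ 0) * m < weightedRate ν μ P .b2 → s < S2 := by
    intro s hs hlt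
    by_contra! hle
    rcases le_or_gt A01 A11 with h | h
    · have := weighted_le h0 hd hle (min_eq_left h : m = A01).ge
      linarith
    · linarith
  have hab : weightedRate ν μ P .b3a = v ∨ weightedRate ν μ P .b3b = v := by
    obtain ⟨a, ha⟩ := exists_weightedRate_eq_policyValue ν μ P
    cases a
    · exact absurd ha.symm hv1
    · exact absurd ha.symm hv2
    · exact .inl ha.symm
    · exact .inr ha.symm
  refine .inl ?_
  rcases lt_trichotomy Sa Sb with hlt | heq | hlt
  · have hlt' := weighted_lt h0 hd hlt (le_refl m)
    have hva : weightedRate ν μ P .b3a = v := by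
      rcases hab with h | h
      · exact h
      · linarith
    refine ⟨.c3a, ⟨hlt, key1 _ hlt.le (by linarith), key2 _ le_rfl (by linarith)⟩,
      hsub _ fun a hna => ?_⟩
    cases a
    case b1 => exact l1
    case b2 => exact l2
    case b3a => exact absurd (by simp [Case.parts]) hna
    case b3b => linarith
  · have hvb : weightedRate ν μ P .b3b = v := by
      rcases hab with h | h
      · rw [← h, wa, wb, heq]
      · exact h
    refine ⟨.c3c, ⟨heq, key1 _ le_rfl (by linarith), key2 _ heq.ge (by linarith)⟩,
      hsub _ fun a hna => ?_⟩
    cases a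
    case b1 => exact l1
    case b2 => exact l2
    all_goals exact absurd (by simp [Case.parts]) hna
  · have hlt' := weighted_lt h0 hd hlt (le_refl m)
    have hvb : weightedRate ν μ P .b3b = v := by
      rcases hab with h | h
      · linarith
      · exact h
    refine ⟨.c3b, ⟨hlt, key1 _ le_rfl (by linarith), key2 _ hlt.le (by linarith)⟩,
      hsub _ fun a hna => ?_⟩
    cases a
    case b1 => exact l1
    case b2 => exact l2
    case b3a => linarith
    case b3b => exact absurd (by simp [Case.parts]) hna

theorem exists_selects_of_isOptimal {ν : Measure Fading} {Pbar μ : Fin 2 → ℝ}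
    (hν : IsAdmissible ν Pbar) (h0 : 0 < μ 0) (h1 : μ 0 < μ 1) {P : Policy}
    (hP : IsOptimal ν Pbar μ P) : ∃ x, Selects ν Pbar μ x P := by
  obtain ⟨hPp, hmax⟩ := (isOptimal_iff_policyValue hν h0 h1).1 hP
  have hPa := policies_subset_allocations hPp
  rcases exists_reducedCondition hν h0 h1 hPa with ⟨x, hx, hsub⟩ | ⟨hc1, hc2⟩
  · exact ⟨x, isCaseOptimal_of_binding_subset hν h0 h1 hPp hmax hsub,
      caseCondition_of_reducedCondition hν h0 h1 hPa hx⟩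
  · rcases isCaseOptimal_of_tie hν h0 h1 hPp hmax with h | h
    · exact ⟨_, h, caseCondition_of_reducedCondition hν h0 h1 hPa hc1⟩
    · exact ⟨_, h, caseCondition_of_reducedCondition hν h0 h1 hPa hc2⟩

theorem exists_isOptimal {ν : Measure Fading} {Pbar μ : Fin 2 → ℝ}
    (hν : IsAdmissible ν Pbar) (h0 : 0 < μ 0) (h1 : μ 0 < μ 1) :
    ∃ P, IsOptimal ν Pbar μ P := by
  obtain ⟨P, hP, hmax⟩ := exists_forall_inf_weightedRate_le hν h0 h1
    (I := Finset.univ) ⟨.b1, Finset.mem_univ _⟩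
  exact ⟨P, (isOptimal_iff_policyValue hν h0 h1).2 ⟨hP, hmax⟩⟩

/-! ### Waterfilling -/

theorem eq_other_of_ne : ∀ {i j : Fin 2}, i ≠ j → i = other j := by decide

theorem div_one_add_lt {a y z : ℝ} (ha : 0 < a) (hy : 0 ≤ y) (hyz : y < z) :
    a / (1 + z) < a / (1 + y) :=
  div_lt_div_of_pos_left ha (by linarith) (by linarith)

theorem div_one_add_le {a y z : ℝ} (ha : 0 < a) (hy : 0 ≤ y) (hyz : y ≤ z) :
    a / (1 + z) ≤ a / (1 + y) :=
  div_le_div_of_nonneg_left ha.le (by linarith) (by linarith)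

/-- The stationarity condition of a single user is solved by waterfilling. -/
theorem stationary_single_iff {m c x : ℝ} (hc : 0 < c) (hx : 0 ≤ x) :
    (m / (1 + x) ≤ c ∧ (0 < x → m / (1 + x) = c)) ↔ x = max (m / c - 1) 0 := by
  have h1 : (0 : ℝ) < 1 + x := by linarith
  rw [div_le_iff₀ h1, div_eq_iff h1.ne']
  constructor
  · rintro ⟨hle, heq⟩
    rcases hx.eq_or_lt with h0 | hpos
    · rw [← h0, add_zero, mul_one] at hle
      rw [← h0, max_eq_right]
      rw [sub_nonpos]
      exact (div_le_one hc).2 hle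
    · rw [heq hpos, mul_div_cancel_left₀ _ hc.ne', add_sub_cancel_left, max_eq_left hx]
  · intro he
    rcases le_total (m / c - 1) 0 with h | h
    · rw [max_eq_right h] at he
      rw [he]
      rw [sub_nonpos, div_le_one hc] at h
      exact ⟨by linarith, fun h => absurd h (lt_irrefl 0)⟩
    · rw [max_eq_left h] at he
      have : m = c * (1 + x) := by
        rw [he]
        field_simp
        ring
      exact ⟨this.le, fun _ => this⟩

/-- Waterfilling over a link with gain `g`, rate weight `m` and power price `l`: the water level is
`m / l`, so `l / m` is the multiplier in `IsWaterfilling`. -/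
theorem waterfilling_iff_slope {g m l p : ℝ} (hg : 0 ≤ g) (hl : 0 < l)
    (hp : 0 ≤ p) :
    (m * g / (1 + g * p) ≤ l ∧ (0 < p → m * g / (1 + g * p) = l)) ↔
      p = if g = 0 then 0 else max (1 / (l / m) - 1 / g) 0 := by
  rcases hg.eq_or_lt with h0 | hg
  · rw [← h0, if_pos rfl, mul_zero, zero_div]
    refine ⟨fun h => ?_, fun h => ⟨hl.le, fun hp => absurd h hp.ne'⟩⟩
    by_contra hne
    exact hl.ne (h.2 (hp.lt_of_ne' hne))
  · rw [if_neg hg.ne']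
    have h1 := stationary_single_iff (m := m) (c := l / g) (x := g * p) (div_pos hl hg)
      (mul_nonneg hg.le hp)
    have h2 : 0 < 1 + g * p := by positivity
    have h3 : m / (1 + g * p) * g = m * g / (1 + g * p) := by ring
    rw [le_div_iff₀ hg, eq_div_iff hg.ne', h3, mul_pos_iff_of_pos_left hg] at h1
    rw [h1]
    have h4 : max (m / (l / g) - 1) 0 = g * max (1 / (l / m) - 1 / g) 0 := by
      rw [mul_max_of_nonneg _ _ hg.le, mul_zero]
      congr 1
      field_simp
    rw [h4]
    exact mul_right_inj' hg.ne'

/-- A case with one binding expression whose marginals are those of parallel single-user links is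
solved by waterfilling. -/
theorem isCaseOptimal_iff_isWaterfilling {ν : Measure Fading} {Pbar μ : Fin 2 → ℝ}
    (hν : IsAdmissible ν Pbar) (h0 : 0 < μ 0) (h1 : μ 0 < μ 1) {x : Case} {a : Basic}
    (hx : x.parts = {a}) (σ : Fin 2 → Fin 2)
    (hm : ∀ b h p k, marginal μ (Pi.single a 1) b h p k =
      μ k * gain (σ k) k h / (1 + gain (σ k) k h * p k))
    {P : Policy} (hP : P ∈ policies ν Pbar) :
    IsCaseOptimal ν Pbar μ x P ↔ ∀ k, IsWaterfilling ν Pbar (σ k) k (P k) := by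
  have hμ : ∀ k, 0 < μ k := Fin.forall_fin_two.2 ⟨h0, h0.trans h1⟩
  have hPa := policies_subset_allocations hP
  have hgz : ∀ h k, gain (σ k) k h = 0 ↔ h (σ k) k = 0 := by
    intro h k
    simp [gain]
  have hw0 := single_one_nonneg a
  have hstat : ∀ {b l : Fin 2 → ℝ}, (∀ i, 0 ≤ b i) → ∑ i, b i = 1 → (∀ k, 0 < l k) →
      (IsStationary ν (mixCoef μ fun y => (Pi.single a 1 : Basic → ℝ) y.1 * b y.2) l P ↔
        ∀ᵐ h ∂ν, ∀ k, P k h =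
          if h (σ k) k = 0 then 0 else max (1 / (l k / μ k) - 1 / gain (σ k) k h) 0) := by
    intro b l hb hb1 hl
    refine eventually_congr (Eventually.of_forall fun h => forall_congr' fun k => ?_)
    rw [← marginal_eq_slope hb1, hm]
    simp only [← hgz]
    exact waterfilling_iff_slope (gain_nonneg _ _ _) (hl k) ((hPa k).2.1 h)
  rw [isCaseOptimal_iff_isOpportunistic hν h0 h1 hP]
  constructor
  · rintro ⟨w, b, l, hw, hw1, hsupp, hb, hb1, hbmin, hl, hst, hfull⟩ k
    have hwa : w = Pi.single a 1 := eq_single_one_of_sum_eq_one hw1 fun a' ha' => by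
      simpa [hx] using (hsupp a' ha').1
    subst hwa
    have := (hstat hb hb1 hl).1 ((isStationary_iff_marginal h0 h1 hw hb hb1 hl hPa).2 hst)
    refine ⟨l k / μ k, div_pos (hl k) (hμ k), ?_, hfull k⟩
    filter_upwards [this] with h hh
    exact hh k
  · intro hwf
    choose l hl hform hfull using hwf
    obtain ⟨i₀, hi₀⟩ := exists_minimizer ν P
    have hb := single_one_nonneg i₀
    have hb1 : ∑ i, (Pi.single i₀ 1 : Fin 2 → ℝ) i = 1 := by simp
    have hl' : ∀ k, 0 < μ k * l k := fun k => mul_pos (hμ k) (hl k)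
    refine ⟨Pi.single a 1, Pi.single i₀ 1, fun k => μ k * l k, hw0, by simp, fun a' ha' => ?_,
      hb, hb1, fun j hj => ?_, hl', ?_, hfull⟩
    · obtain rfl := eq_of_single_one_ne_zero ha'
      refine ⟨by simp [hx], ?_⟩
      simp [caseRate, hx]
    · rwa [eq_of_single_one_ne_zero hj]
    · refine (isStationary_iff_marginal h0 h1 hw0 hb hb1 hl' hPa).1 ((hstat hb hb1 hl').2 ?_)
      filter_upwards [ae_all_iff.2 hform] with h hh k
      rw [hh k, mul_div_cancel_left₀ _ (hμ k).ne']

theorem isCaseOptimal_c1_iff {ν : Measure Fading} {Pbar μ : Fin 2 → ℝ}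
    (hν : IsAdmissible ν Pbar) (h0 : 0 < μ 0) (h1 : μ 0 < μ 1) {P : Policy}
    (hP : P ∈ policies ν Pbar) :
    IsCaseOptimal ν Pbar μ .c1 P ↔ ∀ k, IsWaterfilling ν Pbar k k (P k) :=
  isCaseOptimal_iff_isWaterfilling hν h0 h1 (a := .b1) rfl id
    (fun b h p k => by simp [marginal]) hP

theorem isCaseOptimal_c2_iff {ν : Measure Fading} {Pbar μ : Fin 2 → ℝ}
    (hν : IsAdmissible ν Pbar) (h0 : 0 < μ 0) (h1 : μ 0 < μ 1) {P : Policy}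
    (hP : P ∈ policies ν Pbar) :
    IsCaseOptimal ν Pbar μ .c2 P ↔ ∀ k, IsWaterfilling ν Pbar (other k) k (P k) :=
  isCaseOptimal_iff_isWaterfilling hν h0 h1 (a := .b2) rfl other
    (fun b h p k => by simp [marginal]) hP

theorem update_mem_policies {ν : Measure Fading} {Pbar : Fin 2 → ℝ} {P : Policy}
    (hP : P ∈ policies ν Pbar) {k : Fin 2} {p : Fading → ℝ} (hp : p ∈ userPolicies ν (Pbar k)) :
    Function.update P k p ∈ policies ν Pbar := by
  intro i
  by_cases hi : i = k
  · subst hi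
    simpa using hp
  · simpa [hi] using hP i

theorem rate_singleton (ν : Measure Fading) (P : Policy) (j k : Fin 2) :
    rate ν P j {k} = ∫ h, cap (gain j k h * P k h) ∂ν := by
  simp [rate]

theorem bddAbove_link_rates {ν : Measure Fading} {Pbar : Fin 2 → ℝ} (hν : IsAdmissible ν Pbar)
    (j k : Fin 2) : BddAbove ((fun p : Fading → ℝ => ∫ h, cap (gain j k h * p h) ∂ν) ''
      userPolicies ν (Pbar k)) := by
  refine ⟨(∑ i, ((∫ h, Real.log (1 + gain j i h) ∂ν) + Pbar i)) / Real.log 2, ?_⟩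
  rintro _ ⟨p, hp, rfl⟩
  have := rate_le hν (update_mem_policies (zero_mem_policies hν) hp) j {k}
  rwa [rate_singleton, Function.update_self] at this

theorem rate_le_linkCapacity {ν : Measure Fading} {Pbar : Fin 2 → ℝ} (hν : IsAdmissible ν Pbar)
    {P : Policy} (hP : P ∈ policies ν Pbar) (j k : Fin 2) :
    rate ν P j {k} ≤ linkCapacity ν Pbar j k := by
  rw [rate_singleton]
  exact le_csSup (bddAbove_link_rates hν j k) ⟨P k, hP k, rfl⟩

/-- If a case maximizes a weighted sum of two single-user rates, one for each user, then its
solutions attain the capacities of these links. -/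
theorem rate_eq_linkCapacity {ν : Measure Fading} {Pbar μ : Fin 2 → ℝ}
    (hν : IsAdmissible ν Pbar) (h0 : 0 < μ 0) (h1 : μ 0 < μ 1) {x : Case} {σ : Fin 2 → Fin 2}
    (hx : ∀ Q, caseRate ν μ x Q = ∑ k, μ k * rate ν Q (σ k) {k}) {P : Policy}
    (hP : IsCaseOptimal ν Pbar μ x P) (k : Fin 2) :
    rate ν P (σ k) {k} = linkCapacity ν Pbar (σ k) k := by
  have hμ : ∀ k, 0 < μ k := Fin.forall_fin_two.2 ⟨h0, h0.trans h1⟩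
  refine le_antisymm (rate_le_linkCapacity hν hP.1 _ _) (csSup_le ⟨_, P k, hP.1 k, rfl⟩ ?_)
  rintro _ ⟨p, hp, rfl⟩
  have hle := hP.2 _ (update_mem_policies hP.1 hp)
  rw [hx, hx, ← sub_nonneg, ← Finset.sum_sub_distrib, Finset.sum_eq_single k] at hle
  · rw [← mul_sub, mul_nonneg_iff_of_pos_left (hμ k), sub_nonneg, rate_singleton,
      Function.update_self] at hle
    exact hle
  · intro i _ hi
    rw [rate_singleton, rate_singleton, Function.update_of_ne hi, sub_self]
  · simp

theorem bottleneck_of_selects_c1 {ν : Measure Fading} {Pbar μ : Fin 2 → ℝ}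
    (hν : IsAdmissible ν Pbar) (h0 : 0 < μ 0) (h1 : μ 0 < μ 1) {P : Policy}
    (hP : Selects ν Pbar μ .c1 P) (k : Fin 2) :
    rate ν P k {k} = linkCapacity ν Pbar k k ∧
      linkCapacity ν Pbar k k < linkCapacity ν Pbar (other k) k := by
  have he := rate_eq_linkCapacity hν h0 h1 (σ := id)
    (fun Q => by simp [caseRate, Case.parts, weightedRate]) hP.1
  have hred := (reducedCondition_of_caseCondition hν h0 h1
    (policies_subset_allocations hP.1.1) hP.2).1
  have hlt : ∀ k, rate ν P k {k} < rate ν P (other k) {k} := Fin.forall_fin_two.2 hred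
  refine ⟨he k, ?_⟩
  rw [← show rate ν P k {k} = linkCapacity ν Pbar k k from he k]
  exact (hlt k).trans_le (rate_le_linkCapacity hν hP.1.1 _ _)

theorem bottleneck_of_selects_c2 {ν : Measure Fading} {Pbar μ : Fin 2 → ℝ}
    (hν : IsAdmissible ν Pbar) (h0 : 0 < μ 0) (h1 : μ 0 < μ 1) {P : Policy}
    (hP : Selects ν Pbar μ .c2 P) (k : Fin 2) :
    rate ν P (other k) {k} = linkCapacity ν Pbar (other k) k ∧
      linkCapacity ν Pbar (other k) k < linkCapacity ν Pbar k k := by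
  have he := rate_eq_linkCapacity hν h0 h1 (σ := other)
    (fun Q => by simp [caseRate, Case.parts, weightedRate]) hP.1
  have hred := (reducedCondition_of_caseCondition hν h0 h1
    (policies_subset_allocations hP.1.1) hP.2).1
  have hlt : ∀ k, rate ν P (other k) {k} < rate ν P k {k} := Fin.forall_fin_two.2 hred
  refine ⟨he k, ?_⟩
  rw [← he k]
  exact (hlt k).trans_le (rate_le_linkCapacity hν hP.1.1 _ _)

/-! ### Multiuser waterfilling -/

/-- At received powers `x₀, x₁` that are stationary for `a log (1 + x₀ + x₁) + d log (1 + x₁)` with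
prices `c₀, c₁`, user `2` is served at the levels below `x₁`, and user `1` at the levels between
`x₁` and `x₀ + x₁`. -/
theorem served_levels_of_stationary {a d c₀ c₁ x₀ x₁ : ℝ} (ha : 0 < a) (hd : 0 < d)
    (hx₀ : 0 ≤ x₀) (hx₁ : 0 ≤ x₁)
    (k₀ : a / (1 + (x₀ + x₁)) ≤ c₀) (e₀ : 0 < x₀ → a / (1 + (x₀ + x₁)) = c₀)
    (k₁ : a / (1 + (x₀ + x₁)) + d / (1 + x₁) ≤ c₁)
    (e₁ : 0 < x₁ → a / (1 + (x₀ + x₁)) + d / (1 + x₁) = c₁) :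
    {z | 0 < z ∧ 0 < a / (1 + z) - c₀ ∧ (a + d) / (1 + z) - c₁ < a / (1 + z) - c₀} =
      Set.Ioo x₁ (x₀ + x₁) ∧
    {z | 0 < z ∧ 0 < (a + d) / (1 + z) - c₁ ∧ a / (1 + z) - c₀ < (a + d) / (1 + z) - c₁} =
      Set.Ioo 0 x₁ := by
  have has : a / (1 + (x₀ + x₁)) ≤ a / (1 + x₁) := div_one_add_le ha hx₁ (by linarith)
  constructor
  · ext z
    simp only [Set.mem_ofPred_eq, Set.mem_Ioo, add_div]
    constructor
    · rintro ⟨hz, h2, h3⟩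
      constructor
      · by_contra! hle
        have := div_one_add_le hd hz.le hle
        have := e₁ (hz.trans_le hle)
        linarith
      · by_contra! hle
        have := div_one_add_le ha (by linarith) hle
        linarith
    · rintro ⟨h2, h3⟩
      have := e₀ (by linarith)
      have := div_one_add_lt ha (by linarith) h3
      have := div_one_add_lt hd hx₁ h2
      exact ⟨by linarith, by linarith, by linarith⟩
  · ext z
    simp only [Set.mem_ofPred_eq, Set.mem_Ioo, add_div]
    constructor
    · rintro ⟨hz, h2, h3⟩
      refine ⟨hz, ?_⟩
      by_contra! hle
      have h4 := div_one_add_le hd hx₁ hle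
      have h5 := div_one_add_le ha hx₁ hle
      rcases hx₀.eq_or_lt with h6 | h6
      · rw [← h6, zero_add] at k₁
        linarith
      · have := e₀ h6
        linarith
    · rintro ⟨hz, h2⟩
      have := e₁ (hz.trans h2)
      have := div_one_add_lt ha hz.le h2
      have := div_one_add_lt hd hz.le h2
      exact ⟨hz, by linarith, by linarith⟩

/-- Received powers as in `served_levels_of_stationary` exist. -/
theorem exists_stationary_pair {a d c₀ c₁ : ℝ} (ha : 0 < a) (hd : 0 < d) (hc₀ : 0 < c₀)
    (hc₁ : 0 < c₁) : ∃ x₀ x₁ : ℝ, 0 ≤ x₀ ∧ 0 ≤ x₁ ∧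
      (a / (1 + (x₀ + x₁)) ≤ c₀ ∧ (0 < x₀ → a / (1 + (x₀ + x₁)) = c₀)) ∧
      (a / (1 + (x₀ + x₁)) + d / (1 + x₁) ≤ c₁ ∧
        (0 < x₁ → a / (1 + (x₀ + x₁)) + d / (1 + x₁) = c₁)) := by
  -- at level zero user `2` is not preferred to user `1`
  rcases le_or_gt d (c₁ - c₀) with h | h
  · set x := max (a / c₀ - 1) 0 with hx
    have hx0 : 0 ≤ x := le_max_right _ _
    have := (stationary_single_iff hc₀ hx0).2 hx
    refine ⟨x, 0, hx0, le_rfl, by simpa using this, ?_, fun h => absurd h (lt_irrefl 0)⟩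
    have := this.1
    simp only [add_zero, div_one]
    linarith
  -- user `2` is too expensive at level zero
  rcases le_or_gt (a + d) c₁ with h' | h'
  · refine ⟨0, 0, le_rfl, le_rfl, ⟨?_, fun h => absurd h (lt_irrefl 0)⟩, ?_,
      fun h => absurd h (lt_irrefl 0)⟩ <;> simp only [add_zero, div_one] <;> linarith
  have had : 0 < a + d := by linarith
  -- the utility of user `1` is used up when that of user `2` is
  rcases le_or_gt (a * c₁) (c₀ * (a + d)) with h'' | h''
  · have e : 1 + ((a + d) / c₁ - 1) = (a + d) / c₁ := by ring
    have hx1 : 0 ≤ (a + d) / c₁ - 1 := by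
      rw [sub_nonneg, one_le_div hc₁]
      exact h'.le
    refine ⟨0, (a + d) / c₁ - 1, le_rfl, hx1, ⟨?_, fun h => absurd h (lt_irrefl 0)⟩, ?_⟩
    · rw [zero_add, e, div_div_eq_mul_div, div_le_iff₀ had]
      exact h''
    · have : a / (1 + (0 + ((a + d) / c₁ - 1))) + d / (1 + ((a + d) / c₁ - 1)) = c₁ := by
        rw [zero_add, e]
        field_simp
      exact ⟨this.le, fun _ => this⟩
  -- user `2` is served up to the level where the utilities agree, and then user `1`
  · have hcc : 0 < c₁ - c₀ := by
      by_contra! hle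
      nlinarith
    have e1 : 1 + (d / (c₁ - c₀) - 1) = d / (c₁ - c₀) := by ring
    have e2 : 1 + ((a / c₀ - d / (c₁ - c₀)) + (d / (c₁ - c₀) - 1)) = a / c₀ := by ring
    have hx1 : 0 ≤ d / (c₁ - c₀) - 1 := by
      rw [sub_nonneg, one_le_div hcc]
      exact h.le
    have hx0 : 0 ≤ a / c₀ - d / (c₁ - c₀) := by
      rw [sub_nonneg, div_le_div_iff₀ hcc hc₀]
      linarith
    have s0 : a / (a / c₀) = c₀ := by field_simp
    have s1 : a / (a / c₀) + d / (d / (c₁ - c₀)) = c₁ := by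
      rw [s0]
      field_simp
      ring
    refine ⟨a / c₀ - d / (c₁ - c₀), d / (c₁ - c₀) - 1, hx0, hx1, ?_, ?_⟩
    · rw [e2]
      exact ⟨s0.le, fun _ => s0⟩
    · rw [e1, e2]
      exact ⟨s1.le, fun _ => s1⟩

/-- The marginals of the weighted sum-rate of the multiaccess channel to receiver `j`. -/
def macSlope (μ : Fin 2 → ℝ) (j : Fin 2) (h : Fading) (p : Fin 2 → ℝ) (k : Fin 2) : ℝ :=
  μ 0 * gain j k h / (1 + ∑ i, gain j i h * p i) +
    if k = 1 then (μ 1 - μ 0) * (gain j 1 h / (1 + gain j 1 h * p 1)) else 0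

/-- The powers that multiuser waterfilling at receiver `j` allocates in the state `h`. -/
def servedPower (μ l : Fin 2 → ℝ) (j : Fin 2) (h : Fading) (k : Fin 2) : ℝ :=
  if h j k = 0 then 0 else (volume (servedLevels μ l j h k)).toReal / gain j k h

/-- Without the other user, multiuser waterfilling serves user `k` up to its own water level. -/
theorem servedLevels_of_absent {μ l : Fin 2 → ℝ} {j k : Fin 2} {h : Fading}
    (ho : h j (other k) = 0) {x : ℝ} (hμ : 0 < μ k) (hl : 0 < l k / gain j k h)
    (hx : x = max (μ k / (l k / gain j k h) - 1) 0) :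
    servedLevels μ l j h k = Set.Ioo 0 x := by
  have hx0 : 0 ≤ x := hx ▸ le_max_right _ _
  have hst := (stationary_single_iff hl hx0).2 hx
  ext z
  simp only [servedLevels, utility, ho, Set.mem_ofPred_eq, Set.mem_Ioo, ne_eq, not_true_eq_false,
    false_imp_iff, and_true, sub_pos]
  refine and_congr_right fun hz => ⟨fun h => ?_, fun h => ?_⟩
  · by_contra! hle
    have := div_one_add_le hμ hx0 hle
    linarith [hst.1]
  · have := div_one_add_lt hμ hz.le h
    linarith [hst.2 (hz.trans h)]

theorem toReal_volume_Ioo {x y : ℝ} (h : x ≤ y) : (volume (Set.Ioo x y)).toReal = y - x := by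
  rw [Real.volume_Ioo, ENNReal.toReal_ofReal (sub_nonneg.2 h)]

/-- Stationary powers are those of multiuser waterfilling. As the latter do not depend on `p`, the
stationary powers are unique. -/
theorem eq_servedPower_of_stationary {μ l : Fin 2 → ℝ} (h0 : 0 < μ 0) (h1 : μ 0 < μ 1)
    (hl : ∀ k, 0 < l k) (j : Fin 2) (h : Fading) {p : Fin 2 → ℝ} (hp : ∀ k, 0 ≤ p k)
    (hst : ∀ k, macSlope μ j h p k ≤ l k ∧ (0 < p k → macSlope μ j h p k = l k)) :
    ∀ k, p k = servedPower μ l j h k := by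
  have hμ1 : 0 < μ 1 := h0.trans h1
  obtain ⟨⟨k0, e0⟩, k1, e1⟩ := Fin.forall_fin_two.1 hst
  simp only [macSlope, Fin.sum_univ_two, zero_ne_one, if_false, if_true, add_zero] at k0 e0 k1 e1
  have hl0 := hl 0
  have hl1 := hl 1
  have hp0 := hp 0
  have hp1 := hp 1
  by_cases z0 : h j 0 = 0 <;> by_cases z1 : h j 1 = 0
  · have g0 := gain_eq_zero z0
    have g1 := gain_eq_zero z1
    simp only [g0, g1, mul_zero, zero_div, add_zero] at e0 e1
    refine Fin.forall_fin_two.2 ⟨?_, ?_⟩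
    · rw [servedPower, if_pos z0]
      by_contra hne
      exact hl0.ne (e0 (hp0.lt_of_ne' hne))
    · rw [servedPower, if_pos z1]
      by_contra hne
      exact hl1.ne (e1 (hp1.lt_of_ne' hne))
  · have g0 := gain_eq_zero z0
    have g1 := gain_pos z1
    simp only [g0, mul_zero, zero_div, zero_mul, zero_add] at e0 k1 e1
    have hs : μ 0 * gain j 1 h / (1 + gain j 1 h * p 1) +
        (μ 1 - μ 0) * (gain j 1 h / (1 + gain j 1 h * p 1)) =
        μ 1 * gain j 1 h / (1 + gain j 1 h * p 1) := by ring
    rw [hs] at k1 e1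
    refine Fin.forall_fin_two.2 ⟨?_, ?_⟩
    · rw [servedPower, if_pos z0]
      by_contra hne
      exact hl0.ne (e0 (hp0.lt_of_ne' hne))
    · have hw : gain j 1 h * p 1 = max (μ 1 / (l 1 / gain j 1 h) - 1) 0 := by
        refine (stationary_single_iff (div_pos hl1 g1) (mul_nonneg g1.le hp1)).1 ?_
        rw [le_div_iff₀ g1, eq_div_iff g1.ne', mul_pos_iff_of_pos_left g1, div_mul_eq_mul_div]
        exact ⟨k1, e1⟩
      rw [servedPower, if_neg z1,
        servedLevels_of_absent (k := 1) (by simpa using z0) hμ1 (div_pos hl1 g1) hw,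
        toReal_volume_Ioo (mul_nonneg g1.le hp1), sub_zero, mul_div_cancel_left₀ _ g1.ne']
  · have g0 := gain_pos z0
    have g1 := gain_eq_zero z1
    simp only [g1, mul_zero, zero_div, zero_mul, add_zero] at k0 e0 e1
    refine Fin.forall_fin_two.2 ⟨?_, ?_⟩
    · have hw : gain j 0 h * p 0 = max (μ 0 / (l 0 / gain j 0 h) - 1) 0 := by
        refine (stationary_single_iff (div_pos hl0 g0) (mul_nonneg g0.le hp0)).1 ?_
        rw [le_div_iff₀ g0, eq_div_iff g0.ne', mul_pos_iff_of_pos_left g0, div_mul_eq_mul_div]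
        exact ⟨k0, e0⟩
      rw [servedPower, if_neg z0,
        servedLevels_of_absent (k := 0) (by simpa using z1) h0 (div_pos hl0 g0) hw,
        toReal_volume_Ioo (mul_nonneg g0.le hp0), sub_zero, mul_div_cancel_left₀ _ g0.ne']
    · rw [servedPower, if_pos z1]
      by_contra hne
      exact hl1.ne (e1 (hp1.lt_of_ne' hne))
  · have g0 := gain_pos z0
    have g1 := gain_pos z1
    set x0 := gain j 0 h * p 0 with hx0
    set x1 := gain j 1 h * p 1 with hx1
    have hx0n : 0 ≤ x0 := mul_nonneg g0.le hp0
    have hx1n : 0 ≤ x1 := mul_nonneg g1.le hp1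
    have hs1 : μ 0 * gain j 1 h / (1 + (x0 + x1)) + (μ 1 - μ 0) * (gain j 1 h / (1 + x1)) =
        (μ 0 / (1 + (x0 + x1)) + (μ 1 - μ 0) / (1 + x1)) * gain j 1 h := by ring
    rw [hs1, ← le_div_iff₀ g1] at k1
    rw [hs1, ← eq_div_iff g1.ne'] at e1
    rw [mul_div_right_comm, ← le_div_iff₀ g0] at k0
    rw [mul_div_right_comm, ← eq_div_iff g0.ne'] at e0
    obtain ⟨s0, s1⟩ := served_levels_of_stationary h0 (sub_pos.2 h1) hx0n hx1n k0
      (fun h => e0 (pos_of_mul_pos_right (hx0 ▸ h) g0.le)) k1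
      (fun h => e1 (pos_of_mul_pos_right (hx1 ▸ h) g1.le))
    rw [add_sub_cancel] at s0 s1
    have v0 : servedLevels μ l j h 0 = Set.Ioo x1 (x0 + x1) := by
      rw [← s0]
      ext z
      simp [servedLevels, utility, z1]
    have v1 : servedLevels μ l j h 1 = Set.Ioo 0 x1 := by
      rw [← s1]
      ext z
      simp [servedLevels, utility, z0]
    refine Fin.forall_fin_two.2 ⟨?_, ?_⟩
    · rw [servedPower, if_neg z0, v0, toReal_volume_Ioo (by linarith), add_sub_cancel_right, hx0,
        mul_div_cancel_left₀ _ g0.ne']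
    · rw [servedPower, if_neg z1, v1, toReal_volume_Ioo hx1n, sub_zero, hx1,
        mul_div_cancel_left₀ _ g1.ne']

theorem exists_stationary_powers {μ l : Fin 2 → ℝ} (h0 : 0 < μ 0) (h1 : μ 0 < μ 1)
    (hl : ∀ k, 0 < l k) (j : Fin 2) (h : Fading) : ∃ p : Fin 2 → ℝ, (∀ k, 0 ≤ p k) ∧
      ∀ k, macSlope μ j h p k ≤ l k ∧ (0 < p k → macSlope μ j h p k = l k) := by
  have hμ1 : 0 < μ 1 := h0.trans h1
  have hl0 := hl 0
  have hl1 := hl 1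
  by_cases z0 : h j 0 = 0
  · -- only user `2` can be heard, and it fills up to its own water level
    have g0 := gain_eq_zero z0
    refine ⟨![0, if gain j 1 h = 0 then 0 else max (1 / (l 1 / μ 1) - 1 / gain j 1 h) 0],
      Fin.forall_fin_two.2 ⟨le_rfl, ?_⟩, Fin.forall_fin_two.2 ⟨?_, ?_⟩⟩
    · simp only [Matrix.cons_val_one]
      split_ifs
      exacts [le_rfl, le_max_right _ _]
    · simp [macSlope, g0, hl0.le]
    · set q := if gain j 1 h = 0 then 0 else max (1 / (l 1 / μ 1) - 1 / gain j 1 h) 0 with hq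
      have hq0 : 0 ≤ q := by
        rw [hq]
        split_ifs
        exacts [le_rfl, le_max_right _ _]
      have := (waterfilling_iff_slope (gain_nonneg j 1 h) hl1 hq0).2 hq
      have hs : macSlope μ j h ![0, q] 1 = μ 1 * gain j 1 h / (1 + gain j 1 h * q) := by
        simp only [macSlope, Fin.sum_univ_two, Matrix.cons_val_zero, Matrix.cons_val_one, if_true,
          mul_zero, zero_add]
        ring
      rw [hs]
      exact this
  by_cases z1 : h j 1 = 0
  · have g1 := gain_eq_zero z1
    have g0 := gain_pos z0
    set q := if gain j 0 h = 0 then 0 else max (1 / (l 0 / μ 0) - 1 / gain j 0 h) 0 with hq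
    have hq0 : 0 ≤ q := by
      rw [hq]
      split_ifs
      exacts [le_rfl, le_max_right _ _]
    refine ⟨![q, 0], Fin.forall_fin_two.2 ⟨hq0, le_rfl⟩, Fin.forall_fin_two.2 ⟨?_, ?_⟩⟩
    · have hs : macSlope μ j h ![q, 0] 0 = μ 0 * gain j 0 h / (1 + gain j 0 h * q) := by
        simp [macSlope]
      rw [hs]
      exact (waterfilling_iff_slope (gain_nonneg j 0 h) hl0 hq0).2 hq
    · simp [macSlope, g1, hl1.le]
  · have g0 := gain_pos z0
    have g1 := gain_pos z1
    obtain ⟨x0, x1, hx0, hx1, k0, k1⟩ := exists_stationary_pair h0 (sub_pos.2 h1)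
      (div_pos hl0 g0) (div_pos hl1 g1)
    have q0 : gain j 0 h * (x0 / gain j 0 h) = x0 := mul_div_cancel₀ _ g0.ne'
    have q1 : gain j 1 h * (x1 / gain j 1 h) = x1 := mul_div_cancel₀ _ g1.ne'
    refine ⟨![x0 / gain j 0 h, x1 / gain j 1 h],
      Fin.forall_fin_two.2 ⟨div_nonneg hx0 g0.le, div_nonneg hx1 g1.le⟩,
      Fin.forall_fin_two.2 ⟨?_, ?_⟩⟩
    · have hs : macSlope μ j h ![x0 / gain j 0 h, x1 / gain j 1 h] 0 =
          μ 0 / (1 + (x0 + x1)) * gain j 0 h := by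
        simp only [macSlope, Fin.sum_univ_two, Matrix.cons_val_zero, Matrix.cons_val_one, q0, q1,
          zero_ne_one, if_false]
        ring
      rw [hs, ← le_div_iff₀ g0, ← eq_div_iff g0.ne']
      simpa only [Matrix.cons_val_zero, div_pos_iff_of_pos_right g0] using k0
    · have hs : macSlope μ j h ![x0 / gain j 0 h, x1 / gain j 1 h] 1 =
          (μ 0 / (1 + (x0 + x1)) + (μ 1 - μ 0) / (1 + x1)) * gain j 1 h := by
        simp only [macSlope, Fin.sum_univ_two, Matrix.cons_val_zero, Matrix.cons_val_one, q0, q1,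
          if_true]
        ring
      rw [hs, ← le_div_iff₀ g1, ← eq_div_iff g1.ne']
      simpa only [Matrix.cons_val_one, Matrix.cons_val_fin_one, div_pos_iff_of_pos_right g1]
        using k1

theorem stationary_iff_servedPower {μ l : Fin 2 → ℝ} (h0 : 0 < μ 0) (h1 : μ 0 < μ 1)
    (hl : ∀ k, 0 < l k) (j : Fin 2) (h : Fading) {p : Fin 2 → ℝ} (hp : ∀ k, 0 ≤ p k) :
    (∀ k, macSlope μ j h p k ≤ l k ∧ (0 < p k → macSlope μ j h p k = l k)) ↔
      ∀ k, p k = servedPower μ l j h k := by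
  refine ⟨eq_servedPower_of_stationary h0 h1 hl j h hp, fun he => ?_⟩
  obtain ⟨q, hq, hst⟩ := exists_stationary_powers h0 h1 hl j h
  have : p = q := by
    funext k
    rw [he k, eq_servedPower_of_stationary h0 h1 hl j h hq hst k]
  rwa [this]

/-- If receiver `j` has the smaller rate of user `2`, then the case of the sum-rate at receiver `j`
is solved by multiuser waterfilling at `j`. -/
theorem isCaseOptimal_iff_isMultiuserWaterfilling {ν : Measure Fading} {Pbar μ : Fin 2 → ℝ}
    (hν : IsAdmissible ν Pbar) (h0 : 0 < μ 0) (h1 : μ 0 < μ 1) {x : Case} {a : Basic}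
    (hx : x.parts = {a}) {j : Fin 2}
    (hm : ∀ h p k, marginal μ (Pi.single a 1) (Pi.single j 1) h p k = macSlope μ j h p k)
    {P : Policy} (hP : P ∈ policies ν Pbar) (hj : rate ν P j {1} < rate ν P (other j) {1}) :
    IsCaseOptimal ν Pbar μ x P ↔ IsMultiuserWaterfilling ν Pbar μ j P := by
  have hPa := policies_subset_allocations hP
  have hw0 := single_one_nonneg a
  have hb := single_one_nonneg j
  have hb1 : ∑ i, (Pi.single j 1 : Fin 2 → ℝ) i = 1 := by simp
  have hmin : ∀ i, rate ν P j {1} ≤ rate ν P i {1} := by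
    intro i
    by_cases hi : i = j
    · rw [hi]
    · rw [eq_other_of_ne hi]
      exact hj.le
  have hstat : ∀ {l : Fin 2 → ℝ}, (∀ k, 0 < l k) →
      (IsStationary ν (mixCoef μ fun y => (Pi.single a 1 : Basic → ℝ) y.1 *
        (Pi.single j 1 : Fin 2 → ℝ) y.2) l P ↔
        ∀ᵐ h ∂ν, ∀ k, P k h = servedPower μ l j h k) := by
    intro l hl
    refine eventually_congr (Eventually.of_forall fun h => ?_)
    simp only [← marginal_eq_slope hb1, hm]
    exact stationary_iff_servedPower h0 h1 hl j h (p := powers P h) fun k => (hPa k).2.1 h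
  rw [isCaseOptimal_iff_isOpportunistic hν h0 h1 hP]
  constructor
  · rintro ⟨w, b, l, hw, hw1, hsupp, hb', hb1', hbmin, hl, hst, hfull⟩
    have hwa : w = Pi.single a 1 := eq_single_one_of_sum_eq_one hw1 fun a' ha' => by
      simpa [hx] using (hsupp a' ha').1
    have hba : b = Pi.single j 1 := eq_single_one_of_sum_eq_one hb1' fun i hi => by
      by_contra hne
      have := hbmin i hi j
      rw [eq_other_of_ne hne] at this
      linarith
    subst hwa hba
    exact ⟨l, hl, (hstat hl).1 ((isStationary_iff_marginal h0 h1 hw hb' hb1' hl hPa).2 hst), hfull⟩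
  · rintro ⟨l, hl, hform, hfull⟩
    refine ⟨Pi.single a 1, Pi.single j 1, l, hw0, by simp, fun a' ha' => ?_, hb, hb1,
      fun i hi => ?_, hl, ?_, hfull⟩
    · obtain rfl := eq_of_single_one_ne_zero ha'
      refine ⟨by simp [hx], ?_⟩
      simp [caseRate, hx]
    · rwa [eq_of_single_one_ne_zero hi]
    · exact (isStationary_iff_marginal h0 h1 hw0 hb hb1 hl hPa).1 ((hstat hl).2 hform)

theorem isCaseOptimal_c3a_iff {ν : Measure Fading} {Pbar μ : Fin 2 → ℝ}
    (hν : IsAdmissible ν Pbar) (h0 : 0 < μ 0) (h1 : μ 0 < μ 1) {P : Policy}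
    (hP : P ∈ policies ν Pbar) (hj : rate ν P 1 {1} < rate ν P 0 {1}) :
    IsCaseOptimal ν Pbar μ .c3a P ↔ IsMultiuserWaterfilling ν Pbar μ 1 P :=
  isCaseOptimal_iff_isMultiuserWaterfilling hν h0 h1 (a := .b3a) rfl
    (fun h p k => by simp [marginal, macSlope]) hP hj

theorem isCaseOptimal_c3b_iff {ν : Measure Fading} {Pbar μ : Fin 2 → ℝ}
    (hν : IsAdmissible ν Pbar) (h0 : 0 < μ 0) (h1 : μ 0 < μ 1) {P : Policy}
    (hP : P ∈ policies ν Pbar) (hj : rate ν P 0 {1} < rate ν P 1 {1}) :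
    IsCaseOptimal ν Pbar μ .c3b P ↔ IsMultiuserWaterfilling ν Pbar μ 0 P :=
  isCaseOptimal_iff_isMultiuserWaterfilling hν h0 h1 (a := .b3b) rfl
    (fun h p k => by simp [marginal, macSlope]) hP hj

/-! ### Finitely many equiprobable states -/

variable {n : ℕ}

/-- The real fading state with the power gains `g`. -/
def state (g : Fin 2 → Fin 2 → ℝ) : Fading := fun j k => (√(g j k) : ℂ)

theorem gain_state {g : Fin 2 → Fin 2 → ℝ} (hg : ∀ j k, 0 ≤ g j k) (j k : Fin 2) :
    gain j k (state g) = g j k := by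
  simp [gain, state, Real.sq_sqrt (hg j k)]

theorem state_eq_zero_iff {g : Fin 2 → Fin 2 → ℝ} (hg : ∀ j k, 0 ≤ g j k) (j k : Fin 2) :
    state g j k = 0 ↔ g j k = 0 := by
  simp [state, Real.sqrt_eq_zero (hg j k)]

theorem state_injective {g g' : Fin 2 → Fin 2 → ℝ} (hg : ∀ j k, 0 ≤ g j k)
    (hg' : ∀ j k, 0 ≤ g' j k) (h : state g = state g') : g = g' := by
  funext j k
  rw [← gain_state hg, h, gain_state hg']

/-- The uniform distribution on the states with the power gains `G s`. -/
def uniformLaw (G : Fin n → Fin 2 → Fin 2 → ℝ) : Measure Fading :=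
  ∑ s, (n : ENNReal)⁻¹ • Measure.dirac (state (G s))

/-- The policy with the powers `p s` in the state with the power gains `G s`. -/
def tablePolicy (G : Fin n → Fin 2 → Fin 2 → ℝ) (p : Fin n → Fin 2 → ℝ) : Policy :=
  fun k h => ∑ s, if h = state (G s) then p s k else 0

theorem ae_uniformLaw [NeZero n] (G : Fin n → Fin 2 → Fin 2 → ℝ) {q : Fading → Prop} :
    (∀ᵐ h ∂uniformLaw G, q h) ↔ ∀ s, q (state (G s)) := by
  have hc : (n : ENNReal)⁻¹ ≠ 0 := ENNReal.inv_ne_zero.2 (ENNReal.natCast_ne_top n)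
  unfold uniformLaw
  rw [ae_finsetSum_measure_iff]
  simp only [Finset.mem_univ, true_implies]
  refine forall_congr' fun s => ?_
  rw [ae_iff, Measure.smul_apply, smul_eq_mul, mul_eq_zero, or_iff_right hc, ← ae_iff,
    ae_dirac_eq]
  exact eventually_pure

theorem integrable_uniformLaw [NeZero n] (G : Fin n → Fin 2 → Fin 2 → ℝ) (f : Fading → ℝ) :
    Integrable f (uniformLaw G) :=
  integrable_finsetSum_measure.2 fun _ _ => (integrable_dirac (by simp)).smul_measure
    (ENNReal.inv_ne_top.2 (Nat.cast_ne_zero.2 (NeZero.ne n)))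

theorem integral_uniformLaw [NeZero n] (G : Fin n → Fin 2 → Fin 2 → ℝ) (f : Fading → ℝ) :
    ∫ h, f h ∂uniformLaw G = (∑ s, f (state (G s))) / n := by
  have hi := integrable_finsetSum_measure.1 (integrable_uniformLaw G f)
  unfold uniformLaw
  rw [integral_finsetSum_measure hi]
  simp only [integral_smul_measure, integral_dirac, ENNReal.toReal_inv, ENNReal.toReal_natCast,
    smul_eq_mul, ← Finset.mul_sum]
  rw [inv_mul_eq_div]

theorem isAdmissible_uniformLaw [NeZero n] {G : Fin n → Fin 2 → Fin 2 → ℝ}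
    (hG : ∀ s j k, 0 ≤ G s j k) (hlink : ∀ j k, ∃ s, G s j k ≠ 0) {Pbar : Fin 2 → ℝ}
    (hPbar : ∀ k, 0 < Pbar k) : IsAdmissible (uniformLaw G) Pbar where
  isProb := ⟨by
    simp [uniformLaw, ENNReal.mul_inv_cancel (Nat.cast_ne_zero.2 (NeZero.ne n))
      (ENNReal.natCast_ne_top n)]⟩
  power_pos := hPbar
  log_integrable _ _ := integrable_uniformLaw G _
  link_present j k := by
    rw [pos_iff_ne_zero]
    intro h
    have h' : ∀ᵐ h ∂uniformLaw G, h j k = 0 := by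
      rw [ae_iff]; exact h
    obtain ⟨s, hs⟩ := hlink j k
    exact hs ((state_eq_zero_iff (hG s) j k).1 ((ae_uniformLaw G).1 h' s))

section Table

variable {G : Fin n → Fin 2 → Fin 2 → ℝ} {p : Fin n → Fin 2 → ℝ}

theorem tablePolicy_state (hG : ∀ s j k, 0 ≤ G s j k) (hinj : Function.Injective G)
    (s : Fin n) (k : Fin 2) : tablePolicy G p k (state (G s)) = p s k := by
  unfold tablePolicy
  rw [Finset.sum_eq_single s]
  · simp
  · intro t _ ht
    exact if_neg fun h => ht (hinj (state_injective (hG s) (hG t) h)).symm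
  · simp

theorem tablePolicy_mem_policies [NeZero n] (hG : ∀ s j k, 0 ≤ G s j k)
    (hinj : Function.Injective G) (hp : ∀ s k, 0 ≤ p s k) :
    tablePolicy G p ∈ policies (uniformLaw G) fun k => (∑ s, p s k) / n := by
  refine fun k => ⟨Finset.measurable_sum _ fun s _ => Measurable.ite
    (measurableSet_singleton _) measurable_const measurable_const, fun h =>
    Finset.sum_nonneg fun s _ => ?_, integrable_uniformLaw G _, le_of_eq ?_⟩
  · split_ifs
    exacts [hp s k, le_rfl]
  · simp only [integral_uniformLaw, tablePolicy_state hG hinj]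

/-- `2 ^ (n r)` for the rate `r` at receiver `j` of the users in `S`. -/
def rateProd (G : Fin n → Fin 2 → Fin 2 → ℝ) (p : Fin n → Fin 2 → ℝ) (j : Fin 2)
    (S : Finset (Fin 2)) : ℝ :=
  ∏ s, (1 + ∑ k ∈ S, G s j k * p s k)

/-- `2 ^ (n r)` for the sum-rates `r`. -/
def sumRateProd (G : Fin n → Fin 2 → Fin 2 → ℝ) (p : Fin n → Fin 2 → ℝ) : Basic → ℝ
  | .b1 => rateProd G p 0 {0} * rateProd G p 1 {1}
  | .b2 => rateProd G p 1 {0} * rateProd G p 0 {1}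
  | .b3a => rateProd G p 1 Finset.univ
  | .b3b => rateProd G p 0 Finset.univ

theorem one_add_sum_pos (hG : ∀ s j k, 0 ≤ G s j k) (hp : ∀ s k, 0 ≤ p s k) (s : Fin n)
    (j : Fin 2) (S : Finset (Fin 2)) : 0 < 1 + ∑ k ∈ S, G s j k * p s k :=
  add_pos_of_pos_of_nonneg one_pos
    (Finset.sum_nonneg fun k _ => mul_nonneg (hG s j k) (hp s k))

theorem rateProd_pos (hG : ∀ s j k, 0 ≤ G s j k) (hp : ∀ s k, 0 ≤ p s k) (j : Fin 2)
    (S : Finset (Fin 2)) : 0 < rateProd G p j S :=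
  Finset.prod_pos fun s _ => one_add_sum_pos hG hp s j S

theorem sumRateProd_pos (hG : ∀ s j k, 0 ≤ G s j k) (hp : ∀ s k, 0 ≤ p s k) (a : Basic) :
    0 < sumRateProd G p a := by
  cases a
  exacts [mul_pos (rateProd_pos hG hp _ _) (rateProd_pos hG hp _ _),
    mul_pos (rateProd_pos hG hp _ _) (rateProd_pos hG hp _ _), rateProd_pos hG hp _ _,
    rateProd_pos hG hp _ _]

variable [NeZero n]

theorem rate_tablePolicy (hG : ∀ s j k, 0 ≤ G s j k) (hinj : Function.Injective G)
    (hp : ∀ s k, 0 ≤ p s k) (j : Fin 2) (S : Finset (Fin 2)) :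
    rate (uniformLaw G) (tablePolicy G p) j S = Real.logb 2 (rateProd G p j S) / n := by
  unfold rate rateProd
  rw [integral_uniformLaw, Real.logb_prod _ _ fun s _ => (one_add_sum_pos hG hp s j S).ne']
  simp only [tablePolicy_state hG hinj, gain_state (hG _), cap]

theorem sumRate_tablePolicy (hG : ∀ s j k, 0 ≤ G s j k) (hinj : Function.Injective G)
    (hp : ∀ s k, 0 ≤ p s k) (a : Basic) :
    sumRate (uniformLaw G) (tablePolicy G p) a = Real.logb 2 (sumRateProd G p a) / n := by
  have hr := fun j S => (rateProd_pos hG hp j S).ne'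
  cases a <;> simp only [sumRateProd, sumRate, Fin.sum_univ_two, other_zero, other_one,
    rate_tablePolicy hG hinj hp, Real.logb_mul (hr _ _) (hr _ _), add_div]

theorem logb_div_le_iff {x y : ℝ} (hx : 0 < x) (hy : 0 < y) :
    Real.logb 2 x / n ≤ Real.logb 2 y / n ↔ x ≤ y := by
  have : (0 : ℝ) < n := Nat.cast_pos.2 (NeZero.pos n)
  rw [div_le_div_iff_of_pos_right this, Real.logb_le_logb one_lt_two hx hy]

theorem rate_le_rate_iff (hG : ∀ s j k, 0 ≤ G s j k) (hinj : Function.Injective G)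
    (hp : ∀ s k, 0 ≤ p s k) {i j : Fin 2} {S T : Finset (Fin 2)} :
    rate (uniformLaw G) (tablePolicy G p) i S ≤ rate (uniformLaw G) (tablePolicy G p) j T ↔
      rateProd G p i S ≤ rateProd G p j T := by
  rw [rate_tablePolicy hG hinj hp, rate_tablePolicy hG hinj hp,
    logb_div_le_iff (rateProd_pos hG hp _ _) (rateProd_pos hG hp _ _)]

theorem sumRate_le_sumRate_iff (hG : ∀ s j k, 0 ≤ G s j k) (hinj : Function.Injective G)
    (hp : ∀ s k, 0 ≤ p s k) {a b : Basic} :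
    sumRate (uniformLaw G) (tablePolicy G p) a ≤ sumRate (uniformLaw G) (tablePolicy G p) b ↔
      sumRateProd G p a ≤ sumRateProd G p b := by
  rw [sumRate_tablePolicy hG hinj hp, sumRate_tablePolicy hG hinj hp,
    logb_div_le_iff (sumRateProd_pos hG hp _) (sumRateProd_pos hG hp _)]

theorem sumRate_lt_sumRate_iff (hG : ∀ s j k, 0 ≤ G s j k) (hinj : Function.Injective G)
    (hp : ∀ s k, 0 ≤ p s k) {a b : Basic} :
    sumRate (uniformLaw G) (tablePolicy G p) a < sumRate (uniformLaw G) (tablePolicy G p) b ↔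
      sumRateProd G p a < sumRateProd G p b := by
  rw [← not_le, ← not_le, sumRate_le_sumRate_iff hG hinj hp]

theorem sumRate_eq_sumRate_iff (hG : ∀ s j k, 0 ≤ G s j k) (hinj : Function.Injective G)
    (hp : ∀ s k, 0 ≤ p s k) {a b : Basic} :
    sumRate (uniformLaw G) (tablePolicy G p) a = sumRate (uniformLaw G) (tablePolicy G p) b ↔
      sumRateProd G p a = sumRateProd G p b := by
  rw [le_antisymm_iff, le_antisymm_iff, sumRate_le_sumRate_iff hG hinj hp,
    sumRate_le_sumRate_iff hG hinj hp]

end Table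

/-! ### Non-waterfilling optimal policies -/

theorem ReducedCondition.congr {ν : Measure Fading} {P Q : Policy} (h : rate ν Q = rate ν P)
    {x : Case} (hx : ReducedCondition ν P x) : ReducedCondition ν Q x := by
  have hs : sumRate ν Q = sumRate ν P := by
    funext a
    cases a <;> simp only [sumRate, h]
  cases x <;> simpa only [ReducedCondition, h, hs] using hx

/-- Under the conditions of a case, a mixture of its binding expressions, with the rates of user `2`
at the receivers where they are smallest, takes the value of the policy. -/
theorem mixedRate_eq_policyValue {ν : Measure Fading} {μ : Fin 2 → ℝ} (h0 : 0 < μ 0)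
    (h1 : μ 0 < μ 1) {P : Policy} {x : Case} (hx : ReducedCondition ν P x) {w : Basic → ℝ}
    {b : Fin 2 → ℝ} (hw1 : ∑ a, w a = 1) (hwx : ∀ a, w a ≠ 0 → a ∈ x.parts)
    (hb1 : ∑ i, b i = 1) (hmin : ∀ j, b j ≠ 0 → ∀ i, rate ν P j {1} ≤ rate ν P i {1}) :
    mixedRate ν (mixCoef μ fun y => w y.1 * b y.2) P = policyValue ν μ P := by
  refine mixedRate_eq_of_support ?_ fun y hy => ?_
  · rw [Fintype.sum_prod_type]
    simp only [← Finset.mul_sum, hb1, mul_one, hw1]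
  · rw [mixedRate_coef_eq_of_minimizer (hmin _ (right_ne_zero_of_mul hy))]
    refine le_antisymm ?_ (policyValue_le ν μ P _)
    exact Finset.le_inf' _ _ fun a _ =>
      weightedRate_le_of_reducedCondition h0 h1 hx (hwx _ (left_ne_zero_of_mul hy)) a

/-- In the state with power gains `g`, the powers `p` and `q` agree in all received powers on which
a mixture with weights `w`, `b` depends. -/
def SameReceived (w : Basic → ℝ) (b : Fin 2 → ℝ) (g : Fin 2 → Fin 2 → ℝ) (p q : Fin 2 → ℝ) :
    Prop :=
  (0 < w .b1 → ∀ k, g k k * q k = g k k * p k) ∧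
  (0 < w .b2 → ∀ k, g (other k) k * q k = g (other k) k * p k) ∧
  (0 < w .b3a → ∑ i, g 1 i * q i = ∑ i, g 1 i * p i) ∧
  (0 < w .b3b → ∑ i, g 0 i * q i = ∑ i, g 0 i * p i) ∧
  (0 < w .b3a + w .b3b → ∀ j, 0 < b j → g j 1 * q 1 = g j 1 * p 1)

theorem mixCoef_pos {μ : Fin 2 → ℝ} (h0 : 0 < μ 0) (h1 : μ 0 < μ 1) {θ : Basic × Fin 2 → ℝ}
    (hθ : ∀ x, 0 ≤ θ x) {a : Basic} {i j : Fin 2} {S : Finset (Fin 2)} (hθa : 0 < θ (a, i))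
    (hc : 0 < coef μ a i j S) : 0 < mixCoef μ θ j S :=
  (mul_pos hθa hc).trans_le (Finset.single_le_sum (f := fun x => θ x * coef μ x.1 x.2 j S)
    (fun x _ => mul_nonneg (hθ x) (coef_nonneg h0 h1 _ _ _ _)) (Finset.mem_univ (a, i)))

theorem sameReceived_of_received_eq {μ : Fin 2 → ℝ} (h0 : 0 < μ 0) (h1 : μ 0 < μ 1)
    {w : Basic → ℝ} {b : Fin 2 → ℝ} (hw : ∀ a, 0 ≤ w a) (hb : ∀ i, 0 ≤ b i)
    (hb1 : ∑ i, b i = 1) {g : Fin 2 → Fin 2 → ℝ} (hg : ∀ j k, 0 ≤ g j k) {p q : Fin 2 → ℝ}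
    (h : ∀ j S, 0 < mixCoef μ (fun y => w y.1 * b y.2) j S →
      received j S (state g) q = received j S (state g) p) :
    SameReceived w b g p q := by
  have hθ : ∀ y : Basic × Fin 2, 0 ≤ w y.1 * b y.2 := fun y => mul_nonneg (hw _) (hb _)
  have hμ : ∀ k, 0 < μ k := Fin.forall_fin_two.2 ⟨h0, h0.trans h1⟩
  have hd : 0 < μ 1 - μ 0 := sub_pos.2 h1
  obtain ⟨i, hi⟩ : ∃ i, 0 < b i := by
    by_contra! hcon
    have := Finset.sum_nonpos fun i (_ : i ∈ Finset.univ) => hcon i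
    linarith
  simp only [received, gain_state hg] at h
  have hone : ∀ j, (∀ k, k = 1 → 0 < mixCoef μ (fun y => w y.1 * b y.2) j {k}) →
      g j 1 * q 1 = g j 1 * p 1 := fun j hj => by simpa using h j {1} (hj 1 rfl)
  refine ⟨fun ha k => ?_, fun ha k => ?_, fun ha => ?_, fun ha => ?_, fun ha j hj => ?_⟩
  · simpa using h k {k} (mixCoef_pos h0 h1 hθ (a := .b1) (i := i) (mul_pos ha hi)
      (by simpa [coef] using hμ k))
  · simpa using h (other k) {k} (mixCoef_pos h0 h1 hθ (a := .b2) (i := i) (mul_pos ha hi)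
      (by simpa [coef, other] using hμ k))
  · refine h 1 Finset.univ (mixCoef_pos h0 h1 hθ (a := .b3a) (i := i) (mul_pos ha hi) ?_)
    have : (Finset.univ : Finset (Fin 2)) ≠ {1} := by decide
    simpa [coef, this] using h0
  · refine h 0 Finset.univ (mixCoef_pos h0 h1 hθ (a := .b3b) (i := i) (mul_pos ha hi) ?_)
    have : (Finset.univ : Finset (Fin 2)) ≠ {1} := by decide
    simpa [coef, this] using h0
  · have hu : ({1} : Finset (Fin 2)) ≠ Finset.univ := by decide
    refine hone j fun k hk => ?_
    subst hk
    rcases (hw .b3a).lt_or_eq with h3 | h3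
    · exact mixCoef_pos h0 h1 hθ (a := .b3a) (i := j) (mul_pos h3 hj)
        (by simpa [coef, hu] using hd)
    · exact mixCoef_pos h0 h1 hθ (a := .b3b) (i := j) (mul_pos (by linarith) hj)
        (by simpa [coef, hu] using hd)

/-- `marginal` as a function of the power gains. -/
def tableMarginal (μ : Fin 2 → ℝ) (w : Basic → ℝ) (b : Fin 2 → ℝ) (g : Fin 2 → Fin 2 → ℝ)
    (p : Fin 2 → ℝ) (k : Fin 2) : ℝ :=
  w .b1 * (μ k * g k k / (1 + g k k * p k))
  + w .b2 * (μ k * g (other k) k / (1 + g (other k) k * p k))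
  + w .b3a * (μ 0 * g 1 k / (1 + ∑ i, g 1 i * p i))
  + w .b3b * (μ 0 * g 0 k / (1 + ∑ i, g 0 i * p i))
  + if k = 1 then
      (w .b3a + w .b3b) * (μ 1 - μ 0) * ∑ j, b j * (g j 1 / (1 + g j 1 * p 1))
    else 0

theorem marginal_state {g : Fin 2 → Fin 2 → ℝ} (hg : ∀ j k, 0 ≤ g j k) (μ : Fin 2 → ℝ)
    (w : Basic → ℝ) (b p : Fin 2 → ℝ) (k : Fin 2) :
    marginal μ w b (state g) p k = tableMarginal μ w b g p k := by
  simp only [marginal, tableMarginal, gain_state hg]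

/-- Two states in which user `k` has power show that it does not waterfill over its link to `j`, if
its link is absent in one of them or the water levels differ. -/
theorem not_isWaterfilling_of_table [NeZero n] {G : Fin n → Fin 2 → Fin 2 → ℝ}
    (hG : ∀ s j k, 0 ≤ G s j k) {Pbar : Fin 2 → ℝ} {f : Fading → ℝ} {j k : Fin 2} {s t : Fin n}
    (hs : 0 < f (state (G s))) (ht : 0 < f (state (G t)))
    (hst : G s j k = 0 ∨ (f (state (G s)) * G s j k + 1) * G t j k ≠
      (f (state (G t)) * G t j k + 1) * G s j k) :
    ¬ IsWaterfilling (uniformLaw G) Pbar j k f := by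
  rintro ⟨l, hl, hf, -⟩
  have key : ∀ t, 0 < f (state (G t)) →
      G t j k ≠ 0 ∧ f (state (G t)) * G t j k + 1 = 1 / l * G t j k := by
    intro t ht
    have h := (ae_uniformLaw G).1 hf t
    by_cases hz : state (G t) j k = 0
    · rw [if_pos hz] at h
      exact absurd h ht.ne'
    · rw [if_neg hz, gain_state (hG t)] at h
      rw [state_eq_zero_iff (hG t)] at hz
      refine ⟨hz, ?_⟩
      rcases max_choice (1 / l - 1 / G t j k) 0 with hm | hm <;> rw [hm] at h
      · rw [h, sub_mul, one_div_mul_cancel hz, sub_add_cancel]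
      · exact absurd h ht.ne'
  rcases hst with h | h
  · exact (key s hs).1 h
  · refine h ?_
    rw [(key s hs).2, (key t ht).2]
    ring

/-- Multiuser waterfilling at `j` spends no power where receiver `j` does not hear the user. -/
theorem not_isMultiuserWaterfilling_of_table [NeZero n] {G : Fin n → Fin 2 → Fin 2 → ℝ}
    (hG : ∀ s j k, 0 ≤ G s j k) {Pbar μ : Fin 2 → ℝ} {P : Policy} {j k : Fin 2} {s : Fin n}
    (hs : 0 < P k (state (G s))) (hz : G s j k = 0) :
    ¬ IsMultiuserWaterfilling (uniformLaw G) Pbar μ j P := by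
  rintro ⟨l, hl, hf, -⟩
  have h := (ae_uniformLaw G).1 hf s k
  rw [if_pos ((state_eq_zero_iff (hG s) j k).2 hz)] at h
  exact absurd h hs.ne'

/-- A table of powers that satisfies the conditions of the case `x`, that is stationary for weights
carried by the case, and that is determined by the received powers in the mixture together with the
power budgets, is the only optimal policy up to null sets. It is not waterfilling on a link with
unequal water levels, or at a receiver that does not hear all of the spent power. -/
theorem exists_nonWaterfilling_of_table [NeZero n] {G : Fin n → Fin 2 → Fin 2 → ℝ}
    {p : Fin n → Fin 2 → ℝ} {μ : Fin 2 → ℝ} {x : Case} {w : Basic → ℝ} {b l : Fin 2 → ℝ}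
    (hG : ∀ s j k, 0 ≤ G s j k) (hinj : Function.Injective G)
    (hlink : ∀ j k, ∃ s, G s j k ≠ 0) (hp : ∀ s k, 0 ≤ p s k) (hsum : ∀ k, 0 < ∑ s, p s k)
    (h0 : 0 < μ 0) (h1 : μ 0 < μ 1)
    (hw : ∀ a, 0 ≤ w a) (hw1 : ∑ a, w a = 1) (hwx : ∀ a, w a ≠ 0 → a ∈ x.parts)
    (hb : ∀ i, 0 ≤ b i) (hb1 : ∑ i, b i = 1)
    (hmin : ∀ j, b j ≠ 0 → ∀ i, rateProd G p j {1} ≤ rateProd G p i {1})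
    (hl : ∀ k, 0 < l k)
    (hst : ∀ s k, tableMarginal μ w b (G s) (p s) k ≤ l k ∧
      (0 < p s k → tableMarginal μ w b (G s) (p s) k = l k))
    (hx : ReducedCondition (uniformLaw G) (tablePolicy G p) x)
    (huniq : ∀ q : Fin n → Fin 2 → ℝ, (∀ s k, 0 ≤ q s k) → (∀ k, ∑ s, q s k = ∑ s, p s k) →
      (∀ s, SameReceived w b (G s) (p s) (q s)) → ∀ s k, q s k = p s k)
    (hwf : ∀ j k, ∃ s t, 0 < p s k ∧ 0 < p t k ∧
      (G s j k = 0 ∨ (p s k * G s j k + 1) * G t j k ≠ (p t k * G t j k + 1) * G s j k))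
    (hmwf : ∀ j, ∃ k s, 0 < p s k ∧ G s j k = 0) :
    ∃ (ν : Measure Fading) (Pbar μ : Fin 2 → ℝ),
      IsAdmissible ν Pbar ∧ 0 < μ 0 ∧ μ 0 < μ 1 ∧ (∃ P, IsOptimal ν Pbar μ P) ∧
      ∀ P, IsOptimal ν Pbar μ P → Selects ν Pbar μ x P ∧ IsNonWaterfilling ν Pbar μ P := by
  have hn : (0 : ℝ) < n := Nat.cast_pos.2 (NeZero.pos n)
  set ν := uniformLaw G with hνdef
  set Pbar : Fin 2 → ℝ := fun k => (∑ s, p s k) / n with hPbar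
  have hν : IsAdmissible ν Pbar :=
    isAdmissible_uniformLaw hG hlink fun k => div_pos (hsum k) hn
  refine ⟨ν, Pbar, μ, hν, h0, h1, exists_isOptimal hν h0 h1, fun Q hQ => ?_⟩
  obtain ⟨hQ, hQmax⟩ := (isOptimal_iff_policyValue hν h0 h1).1 hQ
  set P := tablePolicy G p
  have hP : P ∈ policies ν Pbar := tablePolicy_mem_policies hG hinj hp
  have hPs : ∀ s k, P k (state (G s)) = p s k := tablePolicy_state hG hinj
  have hQa := policies_subset_allocations hQ
  have hPa := policies_subset_allocations hP
  set c := mixCoef μ fun y => w y.1 * b y.2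
  have hθ0 : ∀ y : Basic × Fin 2, 0 ≤ w y.1 * b y.2 := fun y => mul_nonneg (hw _) (hb _)
  have hθ1 : ∑ y : Basic × Fin 2, w y.1 * b y.2 = 1 := by
    rw [Fintype.sum_prod_type]
    simp only [← Finset.mul_sum, hb1, mul_one, hw1]
  have hc := mixCoef_nonneg h0 h1 hθ0
  have hstat : IsStationary ν c l P := by
    refine (ae_uniformLaw G).2 fun s k => ?_
    have hpow : powers P (state (G s)) = p s := funext fun k => hPs s k
    rw [← marginal_eq_slope hb1, marginal_state (hG s), hpow, hPs]
    exact hst s k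
  have hfull : ∀ k, ∫ h, P k h ∂ν = Pbar k := fun k => by
    simp only [hνdef, hPbar, integral_uniformLaw, hPs]
  have hval : mixedRate ν c P = policyValue ν μ P :=
    mixedRate_eq_policyValue h0 h1 hx hw1 hwx hb1 fun j hj i =>
      (rate_le_rate_iff hG hinj hp).2 (hmin j hj i)
  have hcase : ∀ R, caseRate ν μ x R ≤ mixedRate ν c R := fun R =>
    inf_weightedRate_le_mixedRate h1 x.parts_nonempty hθ0 hθ1
      (fun y hy => hwx _ (left_ne_zero_of_mul hy)) R
  -- an optimal policy `Q` also maximizes the mixture `c`, so it has the same received powers as `P`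
  have hPQ : mixedRate ν c P ≤ mixedRate ν c Q :=
    hval.le.trans ((hQmax P hP).trans ((policyValue_le_caseRate ν μ x Q).trans (hcase Q)))
  have hlog := log_two_pos
  have hbudget : ∀ k, ∫ h, Q k h ∂ν ≤ ∫ h, P k h ∂ν := fun k => (hQ k).2.2.2.trans (hfull k).ge
  have hterm : ∀ k, l k * (∫ h, Q k h ∂ν - ∫ h, P k h ∂ν) ≤ 0 := fun k =>
    mul_nonpos_of_nonneg_of_nonpos (hl k).le (sub_nonpos.2 (hbudget k))
  have hPQ' := mul_le_mul_of_nonneg_left hPQ hlog.le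
  have hle := hstat.mixedRate_le hν hc hPa hQa
  have hQfull : ∀ k, ∫ h, Q k h ∂ν = ∫ h, P k h ∂ν := by
    intro k
    have hz : l k * (∫ h, Q k h ∂ν - ∫ h, P k h ∂ν) = 0 :=
      (Finset.sum_eq_zero_iff_of_nonpos fun k _ => hterm k).1
        (le_antisymm (Finset.sum_nonpos fun k _ => hterm k) (by linarith)) k (Finset.mem_univ k)
    exact sub_eq_zero.1 ((mul_eq_zero.1 hz).resolve_left (hl k).ne')
  have hrec := hstat.received_eq hν hc hPa hQa
    ((add_le_of_nonpos_right (Finset.sum_nonpos fun k _ => hterm k)).trans hPQ')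
  have hQs : ∀ s k, Q k (state (G s)) = p s k := by
    refine huniq (fun s k => Q k (state (G s))) (fun s k => (hQ k).2.1 _) (fun k => ?_) fun s => ?_
    · have := hQfull k
      rw [hfull k, hνdef, integral_uniformLaw] at this
      exact (div_left_inj' hn.ne').1 this
    · refine sameReceived_of_received_eq h0 h1 hw hb hb1 (hG s) fun j S hjS => ?_
      have := (ae_uniformLaw G).1 hrec s j S hjS
      have hpow : powers P (state (G s)) = p s := funext fun k => hPs s k
      rw [hpow] at this
      exact this
  have hrate : rate ν Q = rate ν P := by
    funext j S
    refine integral_congr_ae ((ae_uniformLaw G).2 fun s => ?_)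
    simp only [hQs, hPs]
  refine ⟨⟨⟨hQ, fun R hR => ?_⟩, caseCondition_of_reducedCondition hν h0 h1 hQa
    (hx.congr hrate)⟩, fun j k => ?_, fun j => ?_⟩
  · calc caseRate ν μ x R ≤ mixedRate ν c R := hcase R
      _ ≤ mixedRate ν c P := hstat.mixedRate_le_of_mem_policies hν hc hl hP hR hfull
      _ = policyValue ν μ P := hval
      _ ≤ policyValue ν μ Q := hQmax P hP
      _ ≤ caseRate ν μ x Q := policyValue_le_caseRate ν μ x Q
  · obtain ⟨s, t, hs, ht, h⟩ := hwf j k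
    exact not_isWaterfilling_of_table hG (s := s) (t := t) (by rwa [hQs]) (by rwa [hQs])
      (by rwa [hQs, hQs])
  · obtain ⟨k, s, hs, h⟩ := hmwf j
    exact not_isMultiuserWaterfilling_of_table hG (k := k) (by rwa [hQs]) h

/-! ### Examples for the active and boundary cases

In each example `G` lists the power gains of the equiprobable states, as rows for the two receivers,
and `p` the optimal powers of the two users in these states. Most states are heard by one receiver
only, so that each receiver misses some of the spent power. The weights and prices are the solution
of the stationarity conditions at `p`. The examples for `3b`, `(1,3b)`, `(2,3b)` and `(2,3c)` are those
for `3a`, `(2,3a)`, `(1,3a)` and `(1,3c)` with the receivers exchanged. -/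

/-- The weights of the four rate expressions as a function. -/
def weights (u₁ u₂ u₃ u₄ : ℝ) : Basic → ℝ
  | .b1 => u₁
  | .b2 => u₂
  | .b3a => u₃
  | .b3b => u₄

theorem forall_basic {q : Basic → Prop} : (∀ a, q a) ↔ q .b1 ∧ q .b2 ∧ q .b3a ∧ q .b3b :=
  ⟨fun h => ⟨h _, h _, h _, h _⟩, fun h a => by cases a <;> simp [h]⟩

theorem exists_nonWaterfilling_c3a : ∃ (ν : Measure Fading) (Pbar μ : Fin 2 → ℝ),
    IsAdmissible ν Pbar ∧ 0 < μ 0 ∧ μ 0 < μ 1 ∧ (∃ P, IsOptimal ν Pbar μ P) ∧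
    ∀ P, IsOptimal ν Pbar μ P → Selects ν Pbar μ .c3a P ∧ IsNonWaterfilling ν Pbar μ P := by
  let G : Fin 3 → Fin 2 → Fin 2 → ℝ :=
    ![![![0, 1], ![0, 0]], ![![0, 0], ![1, 1]], ![![4, 0], ![1, 0]]]
  let p : Fin 3 → Fin 2 → ℝ := ![![0, 1], ![1, 3 / 2], ![5 / 2, 0]]
  have hG : ∀ s j k, 0 ≤ G s j k := by norm_num [G, Fin.forall_fin_succ]
  have hp : ∀ s k, 0 ≤ p s k := by norm_num [p, Fin.forall_fin_succ]
  have hinj : Function.Injective G := by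
    intro s t h
    have h' : G s 0 0 = G t 0 0 ∧ G s 1 0 = G t 1 0 ∧ G s 1 1 = G t 1 1 := by simp [h]
    fin_cases s <;> fin_cases t <;> first | rfl | (norm_num [G] at h')
  have hx : ReducedCondition (uniformLaw G) (tablePolicy G p) .c3a := by
    simp only [ReducedCondition, sumRate_lt_sumRate_iff hG hinj hp]
    norm_num [G, p, sumRateProd, rateProd, Fin.prod_univ_succ, Fin.sum_univ_succ]
  refine exists_nonWaterfilling_of_table (μ := ![7, 11]) (w := weights 0 0 1 0)
    (b := ![1, 0]) (l := ![2, 2]) hG hinj ?_ hp ?_ ?_ ?_ ?_ ?_ ?_ ?_ ?_ ?_ ?_ ?_ hx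
    (fun q hq0 hq hr => ?_) ?_ ?_
  case refine_13 =>
    norm_num [G, p, Fin.forall_fin_succ, Fin.sum_univ_succ, SameReceived, weights] at hq0 hq hr ⊢
    -- the received powers and the total powers are linear equations for the table `q`
    refine ⟨?_, ?_⟩ <;> grind
  all_goals norm_num [G, p, Fin.forall_fin_succ, Fin.exists_fin_succ, Fin.sum_univ_succ,
    Fin.prod_univ_succ, forall_basic, sum_basic, weights, Case.parts, rateProd, tableMarginal]

theorem exists_nonWaterfilling_c3b : ∃ (ν : Measure Fading) (Pbar μ : Fin 2 → ℝ),
    IsAdmissible ν Pbar ∧ 0 < μ 0 ∧ μ 0 < μ 1 ∧ (∃ P, IsOptimal ν Pbar μ P) ∧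
    ∀ P, IsOptimal ν Pbar μ P → Selects ν Pbar μ .c3b P ∧ IsNonWaterfilling ν Pbar μ P := by
  let G : Fin 3 → Fin 2 → Fin 2 → ℝ :=
    ![![![0, 0], ![0, 1]], ![![1, 1], ![0, 0]], ![![1, 0], ![4, 0]]]
  let p : Fin 3 → Fin 2 → ℝ := ![![0, 1], ![1, 3 / 2], ![5 / 2, 0]]
  have hG : ∀ s j k, 0 ≤ G s j k := by norm_num [G, Fin.forall_fin_succ]
  have hp : ∀ s k, 0 ≤ p s k := by norm_num [p, Fin.forall_fin_succ]
  have hinj : Function.Injective G := by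
    intro s t h
    have h' : G s 0 0 = G t 0 0 ∧ G s 1 0 = G t 1 0 ∧ G s 1 1 = G t 1 1 := by simp [h]
    fin_cases s <;> fin_cases t <;> first | rfl | (norm_num [G] at h')
  have hx : ReducedCondition (uniformLaw G) (tablePolicy G p) .c3b := by
    simp only [ReducedCondition, sumRate_lt_sumRate_iff hG hinj hp]
    norm_num [G, p, sumRateProd, rateProd, Fin.prod_univ_succ, Fin.sum_univ_succ]
  refine exists_nonWaterfilling_of_table (μ := ![7, 11]) (w := weights 0 0 0 1)
    (b := ![0, 1]) (l := ![2, 2]) hG hinj ?_ hp ?_ ?_ ?_ ?_ ?_ ?_ ?_ ?_ ?_ ?_ ?_ hx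
    (fun q hq0 hq hr => ?_) ?_ ?_
  case refine_13 =>
    norm_num [G, p, Fin.forall_fin_succ, Fin.sum_univ_succ, SameReceived, weights] at hq0 hq hr ⊢
    refine ⟨?_, ?_⟩ <;> grind
  all_goals norm_num [G, p, Fin.forall_fin_succ, Fin.exists_fin_succ, Fin.sum_univ_succ,
    Fin.prod_univ_succ, forall_basic, sum_basic, weights, Case.parts, rateProd, tableMarginal]

theorem exists_nonWaterfilling_c3c : ∃ (ν : Measure Fading) (Pbar μ : Fin 2 → ℝ),
    IsAdmissible ν Pbar ∧ 0 < μ 0 ∧ μ 0 < μ 1 ∧ (∃ P, IsOptimal ν Pbar μ P) ∧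
    ∀ P, IsOptimal ν Pbar μ P → Selects ν Pbar μ .c3c P ∧ IsNonWaterfilling ν Pbar μ P := by
  let G : Fin 2 → Fin 2 → Fin 2 → ℝ :=
    ![![![1, 1], ![0, 0]], ![![0, 0], ![1, 1]]]
  let p : Fin 2 → Fin 2 → ℝ := ![![1, 1], ![1, 1]]
  have hG : ∀ s j k, 0 ≤ G s j k := by norm_num [G, Fin.forall_fin_succ]
  have hp : ∀ s k, 0 ≤ p s k := by norm_num [p, Fin.forall_fin_succ]
  have hinj : Function.Injective G := by
    intro s t h
    have h' : G s 0 0 = G t 0 0 ∧ G s 1 0 = G t 1 0 ∧ G s 1 1 = G t 1 1 := by simp [h]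
    fin_cases s <;> fin_cases t <;> first | rfl | (norm_num [G] at h')
  have hx : ReducedCondition (uniformLaw G) (tablePolicy G p) .c3c := by
    simp only [ReducedCondition, sumRate_lt_sumRate_iff hG hinj hp,
      sumRate_eq_sumRate_iff hG hinj hp]
    norm_num [G, p, sumRateProd, rateProd, Fin.prod_univ_succ, Fin.sum_univ_succ]
  refine exists_nonWaterfilling_of_table (μ := ![1, 2]) (w := weights 0 0 (1 / 2) (1 / 2))
    (b := ![1 / 2, 1 / 2]) (l := ![1 / 6, 5 / 12]) hG hinj ?_ hp ?_ ?_ ?_ ?_ ?_ ?_ ?_ ?_ ?_ ?_ ?_ hx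
    (fun q hq0 hq hr => ?_) ?_ ?_
  case refine_13 =>
    norm_num [G, p, Fin.forall_fin_succ, Fin.sum_univ_succ, SameReceived, weights] at hq0 hq hr ⊢
    refine ⟨?_, ?_⟩ <;> grind
  all_goals norm_num [G, p, Fin.forall_fin_succ, Fin.exists_fin_succ, Fin.sum_univ_succ,
    Fin.prod_univ_succ, forall_basic, sum_basic, weights, Case.parts, rateProd, tableMarginal]

theorem exists_nonWaterfilling_c13a : ∃ (ν : Measure Fading) (Pbar μ : Fin 2 → ℝ),
    IsAdmissible ν Pbar ∧ 0 < μ 0 ∧ μ 0 < μ 1 ∧ (∃ P, IsOptimal ν Pbar μ P) ∧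
    ∀ P, IsOptimal ν Pbar μ P → Selects ν Pbar μ .c13a P ∧ IsNonWaterfilling ν Pbar μ P := by
  let G : Fin 3 → Fin 2 → Fin 2 → ℝ :=
    ![![![1, 0], ![0, 0]], ![![0, 0], ![2, 1]], ![![0, 4], ![0, 1]]]
  let p : Fin 3 → Fin 2 → ℝ := ![![1, 0], ![1, 1], ![0, 7 / 5]]
  have hG : ∀ s j k, 0 ≤ G s j k := by norm_num [G, Fin.forall_fin_succ]
  have hp : ∀ s k, 0 ≤ p s k := by norm_num [p, Fin.forall_fin_succ]
  have hinj : Function.Injective G := by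
    intro s t h
    have h' : G s 0 0 = G t 0 0 ∧ G s 1 0 = G t 1 0 ∧ G s 1 1 = G t 1 1 := by simp [h]
    fin_cases s <;> fin_cases t <;> first | rfl | (norm_num [G] at h')
  have hx : ReducedCondition (uniformLaw G) (tablePolicy G p) .c13a := by
    simp only [ReducedCondition, rate_le_rate_iff hG hinj hp, sumRate_lt_sumRate_iff hG hinj hp,
      sumRate_eq_sumRate_iff hG hinj hp]
    norm_num [G, p, sumRateProd, rateProd, Fin.prod_univ_succ, Fin.sum_univ_succ]
  refine exists_nonWaterfilling_of_table (μ := ![2, 3]) (w := weights (1 / 2) 0 (1 / 2) 0)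
    (b := ![0, 1]) (l := ![1 / 2, 5 / 4]) hG hinj ?_ hp ?_ ?_ ?_ ?_ ?_ ?_ ?_ ?_ ?_ ?_ ?_ hx
    (fun q hq0 hq hr => ?_) ?_ ?_
  case refine_13 =>
    norm_num [G, p, Fin.forall_fin_succ, Fin.sum_univ_succ, SameReceived, weights] at hq0 hq hr ⊢
    refine ⟨?_, ?_⟩ <;> grind
  all_goals norm_num [G, p, Fin.forall_fin_succ, Fin.exists_fin_succ, Fin.sum_univ_succ,
    Fin.prod_univ_succ, forall_basic, sum_basic, weights, Case.parts, rateProd, tableMarginal]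

theorem exists_nonWaterfilling_c23a : ∃ (ν : Measure Fading) (Pbar μ : Fin 2 → ℝ),
    IsAdmissible ν Pbar ∧ 0 < μ 0 ∧ μ 0 < μ 1 ∧ (∃ P, IsOptimal ν Pbar μ P) ∧
    ∀ P, IsOptimal ν Pbar μ P → Selects ν Pbar μ .c23a P ∧ IsNonWaterfilling ν Pbar μ P := by
  let G : Fin 3 → Fin 2 → Fin 2 → ℝ :=
    ![![![0, 1], ![0, 0]], ![![0, 0], ![1, 4]], ![![4, 0], ![1, 0]]]
  let p : Fin 3 → Fin 2 → ℝ := ![![0, 1], ![1, 1 / 2], ![5 / 3, 0]]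
  have hG : ∀ s j k, 0 ≤ G s j k := by norm_num [G, Fin.forall_fin_succ]
  have hp : ∀ s k, 0 ≤ p s k := by norm_num [p, Fin.forall_fin_succ]
  have hinj : Function.Injective G := by
    intro s t h
    have h' : G s 0 0 = G t 0 0 ∧ G s 1 0 = G t 1 0 ∧ G s 1 1 = G t 1 1 := by simp [h]
    fin_cases s <;> fin_cases t <;> first | rfl | (norm_num [G] at h')
  have hx : ReducedCondition (uniformLaw G) (tablePolicy G p) .c23a := by
    simp only [ReducedCondition, rate_le_rate_iff hG hinj hp, sumRate_lt_sumRate_iff hG hinj hp,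
      sumRate_eq_sumRate_iff hG hinj hp]
    norm_num [G, p, sumRateProd, rateProd, Fin.prod_univ_succ, Fin.sum_univ_succ]
  refine exists_nonWaterfilling_of_table (μ := ![2, 3]) (w := weights 0 (1 / 2) (1 / 2) 0)
    (b := ![1, 0]) (l := ![3 / 4, 1]) hG hinj ?_ hp ?_ ?_ ?_ ?_ ?_ ?_ ?_ ?_ ?_ ?_ ?_ hx
    (fun q hq0 hq hr => ?_) ?_ ?_
  case refine_13 =>
    norm_num [G, p, Fin.forall_fin_succ, Fin.sum_univ_succ, SameReceived, weights] at hq0 hq hr ⊢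
    refine ⟨?_, ?_⟩ <;> grind
  all_goals norm_num [G, p, Fin.forall_fin_succ, Fin.exists_fin_succ, Fin.sum_univ_succ,
    Fin.prod_univ_succ, forall_basic, sum_basic, weights, Case.parts, rateProd, tableMarginal]

theorem exists_nonWaterfilling_c13b : ∃ (ν : Measure Fading) (Pbar μ : Fin 2 → ℝ),
    IsAdmissible ν Pbar ∧ 0 < μ 0 ∧ μ 0 < μ 1 ∧ (∃ P, IsOptimal ν Pbar μ P) ∧
    ∀ P, IsOptimal ν Pbar μ P → Selects ν Pbar μ .c13b P ∧ IsNonWaterfilling ν Pbar μ P := by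
  let G : Fin 3 → Fin 2 → Fin 2 → ℝ :=
    ![![![0, 0], ![0, 1]], ![![1, 4], ![0, 0]], ![![1, 0], ![4, 0]]]
  let p : Fin 3 → Fin 2 → ℝ := ![![0, 1], ![1, 1 / 2], ![5 / 3, 0]]
  have hG : ∀ s j k, 0 ≤ G s j k := by norm_num [G, Fin.forall_fin_succ]
  have hp : ∀ s k, 0 ≤ p s k := by norm_num [p, Fin.forall_fin_succ]
  have hinj : Function.Injective G := by
    intro s t h
    have h' : G s 0 0 = G t 0 0 ∧ G s 1 0 = G t 1 0 ∧ G s 1 1 = G t 1 1 := by simp [h]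
    fin_cases s <;> fin_cases t <;> first | rfl | (norm_num [G] at h')
  have hx : ReducedCondition (uniformLaw G) (tablePolicy G p) .c13b := by
    simp only [ReducedCondition, rate_le_rate_iff hG hinj hp, sumRate_lt_sumRate_iff hG hinj hp,
      sumRate_eq_sumRate_iff hG hinj hp]
    norm_num [G, p, sumRateProd, rateProd, Fin.prod_univ_succ, Fin.sum_univ_succ]
  refine exists_nonWaterfilling_of_table (μ := ![2, 3]) (w := weights (1 / 2) 0 0 (1 / 2))
    (b := ![0, 1]) (l := ![3 / 4, 1]) hG hinj ?_ hp ?_ ?_ ?_ ?_ ?_ ?_ ?_ ?_ ?_ ?_ ?_ hx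
    (fun q hq0 hq hr => ?_) ?_ ?_
  case refine_13 =>
    norm_num [G, p, Fin.forall_fin_succ, Fin.sum_univ_succ, SameReceived, weights] at hq0 hq hr ⊢
    refine ⟨?_, ?_⟩ <;> grind
  all_goals norm_num [G, p, Fin.forall_fin_succ, Fin.exists_fin_succ, Fin.sum_univ_succ,
    Fin.prod_univ_succ, forall_basic, sum_basic, weights, Case.parts, rateProd, tableMarginal]

theorem exists_nonWaterfilling_c23b : ∃ (ν : Measure Fading) (Pbar μ : Fin 2 → ℝ),
    IsAdmissible ν Pbar ∧ 0 < μ 0 ∧ μ 0 < μ 1 ∧ (∃ P, IsOptimal ν Pbar μ P) ∧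
    ∀ P, IsOptimal ν Pbar μ P → Selects ν Pbar μ .c23b P ∧ IsNonWaterfilling ν Pbar μ P := by
  let G : Fin 3 → Fin 2 → Fin 2 → ℝ :=
    ![![![0, 0], ![1, 0]], ![![2, 1], ![0, 0]], ![![0, 1], ![0, 4]]]
  let p : Fin 3 → Fin 2 → ℝ := ![![1, 0], ![1, 1], ![0, 7 / 5]]
  have hG : ∀ s j k, 0 ≤ G s j k := by norm_num [G, Fin.forall_fin_succ]
  have hp : ∀ s k, 0 ≤ p s k := by norm_num [p, Fin.forall_fin_succ]
  have hinj : Function.Injective G := by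
    intro s t h
    have h' : G s 0 0 = G t 0 0 ∧ G s 1 0 = G t 1 0 ∧ G s 1 1 = G t 1 1 := by simp [h]
    fin_cases s <;> fin_cases t <;> first | rfl | (norm_num [G] at h')
  have hx : ReducedCondition (uniformLaw G) (tablePolicy G p) .c23b := by
    simp only [ReducedCondition, rate_le_rate_iff hG hinj hp, sumRate_lt_sumRate_iff hG hinj hp,
      sumRate_eq_sumRate_iff hG hinj hp]
    norm_num [G, p, sumRateProd, rateProd, Fin.prod_univ_succ, Fin.sum_univ_succ]
  refine exists_nonWaterfilling_of_table (μ := ![2, 3]) (w := weights 0 (1 / 2) 0 (1 / 2))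
    (b := ![1, 0]) (l := ![1 / 2, 5 / 4]) hG hinj ?_ hp ?_ ?_ ?_ ?_ ?_ ?_ ?_ ?_ ?_ ?_ ?_ hx
    (fun q hq0 hq hr => ?_) ?_ ?_
  case refine_13 =>
    norm_num [G, p, Fin.forall_fin_succ, Fin.sum_univ_succ, SameReceived, weights] at hq0 hq hr ⊢
    refine ⟨?_, ?_⟩ <;> grind
  all_goals norm_num [G, p, Fin.forall_fin_succ, Fin.exists_fin_succ, Fin.sum_univ_succ,
    Fin.prod_univ_succ, forall_basic, sum_basic, weights, Case.parts, rateProd, tableMarginal]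

theorem exists_nonWaterfilling_c13c : ∃ (ν : Measure Fading) (Pbar μ : Fin 2 → ℝ),
    IsAdmissible ν Pbar ∧ 0 < μ 0 ∧ μ 0 < μ 1 ∧ (∃ P, IsOptimal ν Pbar μ P) ∧
    ∀ P, IsOptimal ν Pbar μ P → Selects ν Pbar μ .c13c P ∧ IsNonWaterfilling ν Pbar μ P := by
  let G : Fin 3 → Fin 2 → Fin 2 → ℝ :=
    ![![![8 / 5, 4], ![0, 0]], ![![0, 0], ![8, 4 / 11]], ![![1, 0], ![0, 2 / 7]]]
  let p : Fin 3 → Fin 2 → ℝ := ![![5 / 8, 3 / 2], ![3 / 4, 11 / 4], ![1, 7 / 2]]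
  have hG : ∀ s j k, 0 ≤ G s j k := by norm_num [G, Fin.forall_fin_succ]
  have hp : ∀ s k, 0 ≤ p s k := by norm_num [p, Fin.forall_fin_succ]
  have hinj : Function.Injective G := by
    intro s t h
    have h' : G s 0 0 = G t 0 0 ∧ G s 1 0 = G t 1 0 ∧ G s 1 1 = G t 1 1 := by simp [h]
    fin_cases s <;> fin_cases t <;> first | rfl | (norm_num [G] at h')
  have hx : ReducedCondition (uniformLaw G) (tablePolicy G p) .c13c := by
    simp only [ReducedCondition, rate_le_rate_iff hG hinj hp, sumRate_eq_sumRate_iff hG hinj hp]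
    norm_num [G, p, sumRateProd, rateProd, Fin.prod_univ_succ, Fin.sum_univ_succ]
  refine exists_nonWaterfilling_of_table (μ := ![2, 3]) (w := weights (1 / 3) 0 (1 / 3) (1 / 3))
    (b := ![0, 1]) (l := ![2 / 3, 1 / 3]) hG hinj ?_ hp ?_ ?_ ?_ ?_ ?_ ?_ ?_ ?_ ?_ ?_ ?_ hx
    (fun q hq0 hq hr => ?_) ?_ ?_
  case refine_13 =>
    norm_num [G, p, Fin.forall_fin_succ, Fin.sum_univ_succ, SameReceived, weights] at hq0 hq hr ⊢
    refine ⟨?_, ?_⟩ <;> grind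
  all_goals norm_num [G, p, Fin.forall_fin_succ, Fin.exists_fin_succ, Fin.sum_univ_succ,
    Fin.prod_univ_succ, forall_basic, sum_basic, weights, Case.parts, rateProd, tableMarginal]

theorem exists_nonWaterfilling_c23c : ∃ (ν : Measure Fading) (Pbar μ : Fin 2 → ℝ),
    IsAdmissible ν Pbar ∧ 0 < μ 0 ∧ μ 0 < μ 1 ∧ (∃ P, IsOptimal ν Pbar μ P) ∧
    ∀ P, IsOptimal ν Pbar μ P → Selects ν Pbar μ .c23c P ∧ IsNonWaterfilling ν Pbar μ P := by
  let G : Fin 3 → Fin 2 → Fin 2 → ℝ :=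
    ![![![0, 0], ![8 / 5, 4]], ![![8, 4 / 11], ![0, 0]], ![![0, 2 / 7], ![1, 0]]]
  let p : Fin 3 → Fin 2 → ℝ := ![![5 / 8, 3 / 2], ![3 / 4, 11 / 4], ![1, 7 / 2]]
  have hG : ∀ s j k, 0 ≤ G s j k := by norm_num [G, Fin.forall_fin_succ]
  have hp : ∀ s k, 0 ≤ p s k := by norm_num [p, Fin.forall_fin_succ]
  have hinj : Function.Injective G := by
    intro s t h
    have h' : G s 0 0 = G t 0 0 ∧ G s 1 0 = G t 1 0 ∧ G s 1 1 = G t 1 1 := by simp [h]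
    fin_cases s <;> fin_cases t <;> first | rfl | (norm_num [G] at h')
  have hx : ReducedCondition (uniformLaw G) (tablePolicy G p) .c23c := by
    simp only [ReducedCondition, rate_le_rate_iff hG hinj hp, sumRate_eq_sumRate_iff hG hinj hp]
    norm_num [G, p, sumRateProd, rateProd, Fin.prod_univ_succ, Fin.sum_univ_succ]
  refine exists_nonWaterfilling_of_table (μ := ![2, 3]) (w := weights 0 (1 / 3) (1 / 3) (1 / 3))
    (b := ![1, 0]) (l := ![2 / 3, 1 / 3]) hG hinj ?_ hp ?_ ?_ ?_ ?_ ?_ ?_ ?_ ?_ ?_ ?_ ?_ hx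
    (fun q hq0 hq hr => ?_) ?_ ?_
  case refine_13 =>
    norm_num [G, p, Fin.forall_fin_succ, Fin.sum_univ_succ, SameReceived, weights] at hq0 hq hr ⊢
    refine ⟨?_, ?_⟩ <;> grind
  all_goals norm_num [G, p, Fin.forall_fin_succ, Fin.exists_fin_succ, Fin.sum_univ_succ,
    Fin.prod_univ_succ, forall_basic, sum_basic, weights, Case.parts, rateProd, tableMarginal]

/-! ### The search through the cases -/

theorem exists_isCaseOptimal {ν : Measure Fading} {Pbar μ : Fin 2 → ℝ}
    (hν : IsAdmissible ν Pbar) (h0 : 0 < μ 0) (h1 : μ 0 < μ 1) (x : Case) :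
    ∃ P, IsCaseOptimal ν Pbar μ x P :=
  exists_forall_inf_weightedRate_le hν h0 h1 x.parts_nonempty

theorem isOptimal_of_selects {ν : Measure Fading} {Pbar μ : Fin 2 → ℝ}
    (hν : IsAdmissible ν Pbar) (h0 : 0 < μ 0) (h1 : μ 0 < μ 1) {x : Case} {P : Policy}
    (h : Selects ν Pbar μ x P) : IsOptimal ν Pbar μ P :=
  (isOptimal_iff_policyValue hν h0 h1).2 ⟨h.1.1, (selects_imp_policyValue_max hν h0 h1 h).2⟩

theorem isGreatest_of_selects {ν : Measure Fading} {Pbar μ : Fin 2 → ℝ}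
    (hν : IsAdmissible ν Pbar) (h0 : 0 < μ 0) (h1 : μ 0 < μ 1) {x : Case} {P : Policy}
    (h : Selects ν Pbar μ x P) :
    IsGreatest ((fun R : Fin 2 → ℝ => ∑ k, μ k * R k) '' capacityRegion ν Pbar)
      (caseRate ν μ x P) := by
  obtain ⟨he, hmax⟩ := selects_imp_policyValue_max hν h0 h1 h
  rw [he]
  exact isGreatest_policyValue hν h0 h1 h.1.1 hmax

theorem weightedRate_le_of_partsEqual {ν : Measure Fading} {Pbar μ : Fin 2 → ℝ} {x : Case}
    {P Q : Policy} (hP : IsCaseOptimal ν Pbar μ x P) (hQ : Q ∈ policies ν Pbar)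
    (heq : PartsEqual ν μ x Q) {a : Basic} (ha : a ∈ x.parts) :
    weightedRate ν μ Q a ≤ weightedRate ν μ P a :=
  calc weightedRate ν μ Q a ≤ caseRate ν μ x Q :=
        Finset.le_inf' _ _ fun b hb => (heq a ha b hb).le
    _ ≤ caseRate ν μ x P := hP.2 Q hQ
    _ ≤ weightedRate ν μ P a := Finset.inf'_le _ ha

theorem exists_isSearchOutput {ν : Measure Fading} {Pbar μ : Fin 2 → ℝ}
    (h : ∃ x P, Selects ν Pbar μ x P) : ∃ x P, IsSearchOutput ν Pbar μ x P := by
  obtain ⟨x, ⟨P, hP⟩, hmin⟩ := (measure Case.rank).wf.has_min {x | ∃ P, Selects ν Pbar μ x P} h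
  exact ⟨x, P, hP, fun y hy Q hQ => hmin y ⟨Q, hQ⟩ hy⟩

end CMAC

end

theorem mainTheorem9 :
    (∀ (ν : Measure CMAC.Fading) (Pbar μ : Fin 2 → ℝ),
      CMAC.IsAdmissible ν Pbar → 0 < μ 0 → μ 0 < μ 1 →
      -- every case problem has a solution
      (∀ x, ∃ P, CMAC.IsCaseOptimal ν Pbar μ x P) ∧
      -- a case-optimal policy that satisfies its case conditions is optimal, achieves the value
      -- of its case, and solves the equality-constrained problem of its case
      (∀ x P, CMAC.Selects ν Pbar μ x P →
        CMAC.IsOptimal ν Pbar μ P ∧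
        IsGreatest ((fun R : Fin 2 → ℝ => ∑ k, μ k * R k) '' CMAC.capacityRegion ν Pbar)
          (CMAC.caseRate ν μ x P) ∧
        ∀ Q ∈ CMAC.policies ν Pbar, CMAC.PartsEqual ν μ x Q →
          ∀ a ∈ x.parts, CMAC.weightedRate ν μ Q a ≤ CMAC.weightedRate ν μ P a) ∧
      -- every optimal policy arises from one of the cases
      (∀ P, CMAC.IsOptimal ν Pbar μ P → ∃ x, CMAC.Selects ν Pbar μ x P) ∧
      -- the cases exclude each other, except for the tie of `(1,3c)` and `(2,3c)`
      (∀ P ∈ CMAC.policies ν Pbar, ∀ x y,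
        CMAC.CaseCondition ν μ x P → CMAC.CaseCondition ν μ y P →
          x = y ∨ ∀ a b, CMAC.sumRate ν P a = CMAC.sumRate ν P b) ∧
      -- the ordered search stops, and only at optimal policies
      (∃ x P, CMAC.IsSearchOutput ν Pbar μ x P) ∧
      (∀ x P, CMAC.IsSearchOutput ν Pbar μ x P → CMAC.IsOptimal ν Pbar μ P) ∧
      -- inactive cases: waterfilling over the bottleneck links
      (∀ P ∈ CMAC.policies ν Pbar,
        (CMAC.IsCaseOptimal ν Pbar μ .c1 P ↔ ∀ k, CMAC.IsWaterfilling ν Pbar k k (P k)) ∧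
        (CMAC.IsCaseOptimal ν Pbar μ .c2 P ↔
          ∀ k, CMAC.IsWaterfilling ν Pbar (CMAC.other k) k (P k))) ∧
      (∀ P, CMAC.Selects ν Pbar μ .c1 P → ∀ k,
        CMAC.rate ν P k {k} = CMAC.linkCapacity ν Pbar k k ∧
        CMAC.linkCapacity ν Pbar k k < CMAC.linkCapacity ν Pbar (CMAC.other k) k) ∧
      (∀ P, CMAC.Selects ν Pbar μ .c2 P → ∀ k,
        CMAC.rate ν P (CMAC.other k) {k} = CMAC.linkCapacity ν Pbar (CMAC.other k) k ∧
        CMAC.linkCapacity ν Pbar (CMAC.other k) k < CMAC.linkCapacity ν Pbar k k) ∧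
      -- cases 3a and 3b when the smallest single-user rate of user 2 is at the same receiver
      (∀ P ∈ CMAC.policies ν Pbar,
        (CMAC.rate ν P 1 {1} < CMAC.rate ν P 0 {1} →
          (CMAC.IsCaseOptimal ν Pbar μ .c3a P ↔
            CMAC.IsMultiuserWaterfilling ν Pbar μ 1 P)) ∧
        (CMAC.rate ν P 0 {1} < CMAC.rate ν P 1 {1} →
          (CMAC.IsCaseOptimal ν Pbar μ .c3b P ↔
            CMAC.IsMultiuserWaterfilling ν Pbar μ 0 P))) ∧
      -- all cases, in particular the active and the boundary ones: opportunistic policies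
      (∀ x, ∀ P ∈ CMAC.policies ν Pbar,
        CMAC.IsCaseOptimal ν Pbar μ x P ↔ CMAC.IsOpportunistic ν Pbar μ x P)) ∧
    -- in every active and boundary case these are in general not waterfilling policies
    (∀ x : CMAC.Case, x ≠ .c1 → x ≠ .c2 →
      ∃ (ν : Measure CMAC.Fading) (Pbar μ : Fin 2 → ℝ),
        CMAC.IsAdmissible ν Pbar ∧ 0 < μ 0 ∧ μ 0 < μ 1 ∧
        (∃ P, CMAC.IsOptimal ν Pbar μ P) ∧
        ∀ P, CMAC.IsOptimal ν Pbar μ P →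
          CMAC.Selects ν Pbar μ x P ∧ CMAC.IsNonWaterfilling ν Pbar μ P) := by

  refine ⟨fun ν Pbar μ hν h0 h1 => ⟨CMAC.exists_isCaseOptimal hν h0 h1, fun x P h =>
    ⟨CMAC.isOptimal_of_selects hν h0 h1 h, CMAC.isGreatest_of_selects hν h0 h1 h,
      fun Q hQ heq a ha => CMAC.weightedRate_le_of_partsEqual h.1 hQ heq ha⟩,
    fun P hP => CMAC.exists_selects_of_isOptimal hν h0 h1 hP, fun P hP x y hx hy => ?_, ?_,
    fun x P h => CMAC.isOptimal_of_selects hν h0 h1 h.1,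
    fun P hP => ⟨CMAC.isCaseOptimal_c1_iff hν h0 h1 hP, CMAC.isCaseOptimal_c2_iff hν h0 h1 hP⟩,
    fun P hP => CMAC.bottleneck_of_selects_c1 hν h0 h1 hP,
    fun P hP => CMAC.bottleneck_of_selects_c2 hν h0 h1 hP,
    fun P hP => ⟨CMAC.isCaseOptimal_c3a_iff hν h0 h1 hP, CMAC.isCaseOptimal_c3b_iff hν h0 h1 hP⟩,
    fun x P hP => CMAC.isCaseOptimal_iff_isOpportunistic hν h0 h1 hP⟩, fun x hx1 hx2 => ?_⟩
  · have hPa := CMAC.policies_subset_allocations hP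
    exact CMAC.eq_or_sumRate_eq_of_reducedCondition hν hPa
      (CMAC.reducedCondition_of_caseCondition hν h0 h1 hPa hx)
      (CMAC.reducedCondition_of_caseCondition hν h0 h1 hPa hy)
  · obtain ⟨P, hP⟩ := CMAC.exists_isOptimal hν h0 h1
    obtain ⟨x, hx⟩ := CMAC.exists_selects_of_isOptimal hν h0 h1 hP
    exact CMAC.exists_isSearchOutput ⟨x, P, hx⟩
  · cases x
    exacts [absurd rfl hx1, absurd rfl hx2, CMAC.exists_nonWaterfilling_c3a,
      CMAC.exists_nonWaterfilling_c3b, CMAC.exists_nonWaterfilling_c3c,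
      CMAC.exists_nonWaterfilling_c13a, CMAC.exists_nonWaterfilling_c23a,
      CMAC.exists_nonWaterfilling_c13b, CMAC.exists_nonWaterfilling_c23b,
      CMAC.exists_nonWaterfilling_c13c, CMAC.exists_nonWaterfilling_c23c]
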